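/- Let $q$ be a prime power. Represent $\mathrm{PG}(2,q^3)$, with line at infinity $\ell_\infty$ of equation $z=0$, in $\mathrm{PG}(6,q)$ by the Bruck–Bose correspondence: identify $\mathbb F_{q^3}$ with $\mathbb F_q^3$, let $\Sigma_\infty\cong\mathrm{PG}(5,q)$ be the hyperplane $z=0$ of $\mathrm{PG}(6,q)$, and let the affine point $(\alpha,\beta,1)$ correspond to $([\alpha],[\beta],1)$ and the point $(\alpha,\beta,0)$ of $\ell_\infty$ to the plane $\{([\alpha x],[\beta x],0): x\in\mathbb F_{q^3}\setminus\{0\}\}$ of $\Sigma_\infty$. These planes form a regular $2$-spread $\mathcal S$ of $\Sigma_\infty$. Write $[X]$ for the set of points of $\mathrm{PG}(6,q)$ that corresponds to a set $X$ of points of $\mathrm{PG}(2,q^3)$. Let $\pi$ be an order-$q$-subplane of $\mathrm{PG}(2,q^3)$ exterior to $\ell_\infty$ (disjoint from it). Its exterior splash $\mathbb S$ is the set of points of $\ell_\infty$ on extended lines of $\pi$, also regarded as a set of planes of $\mathcal S$. A cover of $\mathbb S$ is a set of pairwise disjoint planes of $\Sigma_\infty$ that covers the same points as $\mathbb S$ and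 each of whose planes meets each plane of $\mathbb S$ in exactly one point. A $(\pi,\ell_\infty)$-special conic is a conic of $\pi$ whose extension to $\mathrm{PG}(2,q^3)$ contains the fixed points of the group of all homographies that fix $\pi$ and $\ell_\infty$. For a set $\mathbb X$ of planes of $\Sigma_\infty$, a transversal line of $\mathbb X$ is a line of $\mathrm{PG}(5,q^3)$ that meets the extension of every plane of $\mathbb X$. An $\mathbb X$-special twisted cubic is a twisted cubic in a $3$-space of $\mathrm{PG}(6,q)$ that is not in $\Sigma_\infty$ and contains a plane of $\mathbb X$, such that its extension to $\mathrm{PG}(6,q^3)$ meets the transversal lines of $\mathbb X$. The tangent cover of $\pi$ is the cover $\mathbb T$ of $\mathbb S$ such that for every point $Q$ of $\pi$ some plane of $\mathbb T$ contains all the points in which the tangents at $Q$ to the $\mathcal S$-special twisted cubics $[m]$, for $m$ a line of $\pi$ through $Q$, meet $\Sigma_\infty$. The conic cover $\mathbb C$ of $\pi$ is the other cover of $\mathbb S$. Theorem 3.8. Let $P$ be a point of $\pi$ and $\ell$ a line of $\pi$ through $P$. Then there is a unique $(\pi,\ell_\infty)$-special conic $\mathcal C$ of $\pi$ through $P$ with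 tangent $\ell$; $\pi$ has exactly one conic cover $\mathbb C$; the points of $\ell$ in $\pi$ form an $\mathcal S$-special twisted cubic $[\ell]$ and the points of $\mathcal C$ form a $\mathbb C$-special twisted cubic $[\mathcal C]$ in $\mathrm{PG}(6,q)$; and the unique tangent at $P$ to the $\mathcal S$-special twisted cubic $[\ell]$ and the unique tangent at $P$ to the $\mathbb C$-special twisted cubic $[\mathcal C]$ are the same line. -/

import Mathlib

open scoped TensorProduct

noncomputable section

namespace ExteriorSplash

/-! ### Twisted cubics over an arbitrary field -/

/-- A twisted cubic in the projective space of the `k`-space `V`: the rational curve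
`(s : t) ↦ s³ c₀ + s² t c₁ + s t² c₂ + t³ c₃`, where `c₀, c₁, c₂, c₃` are linearly independent,
so that it is a normal rational curve of the `3`-space they span. -/
structure TwistedCubic (k V : Type*) [Field k] [AddCommGroup V] [Module k V] where
  coeff : Fin 4 → V
  linInd : LinearIndependent k coeff

namespace TwistedCubic

variable {k V : Type*} [Field k] [AddCommGroup V] [Module k V]

def param (N : TwistedCubic k V) (s t : k) : V :=
  s ^ 3 • N.coeff 0 + (s ^ 2 * t) • N.coeff 1 + (s * t ^ 2) • N.coeff 2 + t ^ 3 • N.coeff 3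

/-- The points of the twisted cubic with coordinates in `k`. -/
def points (N : TwistedCubic k V) : Set (Projectivization k V) :=
  {p | ∃ (s t : k) (h : N.param s t ≠ 0), p = Projectivization.mk k (N.param s t) h}

/-- The `3`-space that contains the twisted cubic. -/
def space (N : TwistedCubic k V) : Submodule k V :=
  Submodule.span k (Set.range N.coeff)

/-- The tangent line at the point with parameter `(s : t)`: it is spanned by the point and the two
partial derivatives of the parametrization (the point itself is listed because Euler's relation
degenerates in characteristic three). -/
def tangentLine (N : TwistedCubic k V) (s t : k) : Submodule k V :=
  Submodule.span k
    {N.param s t,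
      (3 * s ^ 2) • N.coeff 0 + (2 * s * t) • N.coeff 1 + t ^ 2 • N.coeff 2,
      s ^ 2 • N.coeff 1 + (2 * s * t) • N.coeff 2 + (3 * t ^ 2) • N.coeff 3}

/-- `T` is a tangent line of the twisted cubic `N` at its point `p`. -/
def IsTangentAt (N : TwistedCubic k V) (p : Projectivization k V) (T : Submodule k V) : Prop :=
  ∃ (s t : k) (h : N.param s t ≠ 0),
    p = Projectivization.mk k (N.param s t) h ∧ T = N.tangentLine s t

/-- The extension of a twisted cubic to a larger field. -/
def extension (K : Type*) [Field K] [Algebra k K] (N : TwistedCubic k V) :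
    TwistedCubic K (K ⊗[k] V) where
  coeff i := 1 ⊗ₜ[k] N.coeff i
  linInd := Module.Flat.linearIndependent_one_tmul N.linInd

end TwistedCubic

/-! ### The plane `PG(2,q³)` and its Bruck-Bose representation in `PG(6,q)`

Throughout `F` is the field with `q` elements and `K` is its cubic extension. -/

/-- The points of `PG(2,q³)`, with homogeneous coordinates `(x, y, z)`. -/
abbrev Pt (K : Type*) [Field K] := Projectivization K (Fin 3 → K)

/-- The line at infinity of `PG(2,q³)`, with equation `z = 0`. -/
def lineInf (K : Type*) [Field K] : Submodule K (Fin 3 → K) :=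
  LinearMap.ker (LinearMap.proj (R := K) (φ := fun _ : Fin 3 => K) 2)

section

variable (F K : Type*) [Field F] [Field K] [Algebra F K]

/-- The seven-dimensional `F`-space underlying `PG(6,q)`; a vector `([x], [y], z)` is written
`(x, y, z)`, the coordinate vector `[x]` over `F` of an element `x` of `K` being identified
with `x`. -/
abbrev BB := K × K × F

/-- The hyperplane at infinity of `PG(6,q)`, with equation `z = 0`. -/
def SigmaInf : Submodule F (BB F K) :=
  LinearMap.ker (LinearMap.snd F K F ∘ₗ LinearMap.snd F K (K × F))

/-- The semilinear map `(x, y, z) ↦ (x, y, z)` from the space of `PG(6,q)` to that of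
`PG(2,q³)`. -/
def bbLin : BB F K →ₛₗ[algebraMap F K] (Fin 3 → K) where
  toFun v := ![v.1, v.2.1, algebraMap F K v.2.2]
  map_add' v w := by
    ext i; fin_cases i <;> simp
  map_smul' a v := by
    ext i; fin_cases i <;> simp [Algebra.smul_def]

theorem bbLin_injective : Function.Injective (bbLin F K) := by
  rintro ⟨x, y, z⟩ ⟨x', y', z'⟩ h
  have h0 : x = x' := congrFun h 0
  have h1 : y = y' := congrFun h 1
  have h2 : algebraMap F K z = algebraMap F K z' := congrFun h 2
  rw [h0, h1, (algebraMap F K).injective h2]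

/-- The Bruck-Bose correspondence, read from `PG(6,q)` to `PG(2,q³)`: it is bijective between the
affine points of the two spaces, and sends every point of a spread element to the point of the
line at infinity that this spread element represents. -/
def bbMap : Projectivization F (BB F K) → Pt K :=
  Projectivization.map (bbLin F K) (bbLin_injective F K)

/-- The set `[X]` of points of `PG(6,q)` that corresponds to a set `X` of points of `PG(2,q³)`. -/
def bb (X : Set (Pt K)) : Set (Projectivization F (BB F K)) :=
  bbMap F K ⁻¹' X

/-- The spread element `[T]` for a point `T = (α, β, 0)` of the line at infinity: the plane of all
points `([α x], [β x], 0)`. -/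
def spreadPlane (T : Pt K) : Submodule F (BB F K) :=
  T.submodule.comap (bbLin F K)

/-- The regular `2`-spread of `SigmaInf` that defines the Bruck-Bose representation. -/
def regularSpread : Set (Submodule F (BB F K)) :=
  {α | ∃ T : Pt K, T.submodule ≤ lineInf K ∧ α = spreadPlane F K T}

end

section

variable {F K : Type*} [Field F] [Field K] [Algebra F K]

/-- A transversal line of a set `X` of planes of `SigmaInf`: a line of the cubic extension
`PG(5,q³)` of `SigmaInf` that meets the extension of every plane of `X`. -/
def IsTransversal (X : Set (Submodule F (BB F K))) (g : Submodule K (K ⊗[F] BB F K)) : Prop :=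
  g ≤ (SigmaInf F K).baseChange K ∧ Module.finrank K g = 2 ∧
    ∀ α ∈ X, g ⊓ α.baseChange K ≠ ⊥

/-- An `X`-special twisted cubic: it lies in a `3`-space that is not in `SigmaInf` and contains a
plane of `X`, and its extension to `PG(6,q³)` meets the transversal lines of `X`. -/
def IsSpecialCubic (X : Set (Submodule F (BB F K))) (N : TwistedCubic F (BB F K)) : Prop :=
  ¬ N.space ≤ SigmaInf F K ∧ (∃ α ∈ X, α ≤ N.space) ∧
    ∀ g, IsTransversal X g →
      ∃ p ∈ (N.extension K).points, p.submodule ≤ g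

end

/-! ### Order-`q`-subplanes -/

/-- An order-`q`-subplane of `PG(2,q³)`, that is, the image of `PG(2,q)` under a homography: it is
given by a frame of `PG(2,q³)`, and consists of the points with coordinates in `F` with respect to
this frame. -/
structure Subplane (F K : Type*) [Field F] [Field K] [Algebra F K] where
  frame : Module.Basis (Fin 3) K (Fin 3 → K)

namespace Subplane

variable {F K : Type*} [Field F] [Field K] [Algebra F K]

def points (π : Subplane F K) : Set (Pt K) :=
  {P | ∃ (w : Fin 3 → F) (h : ∑ i, algebraMap F K (w i) • π.frame i ≠ 0),
    P = Projectivization.mk K (∑ i, algebraMap F K (w i) • π.frame i) h}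

/-- The subplane is exterior to the line at infinity. -/
def IsExterior (π : Subplane F K) : Prop :=
  ∀ P ∈ π.points, ¬ P.submodule ≤ lineInf K

/-- `L` is (the extension to `PG(2,q³)` of) a line of the subplane. -/
def IsLine (π : Subplane F K) (L : Submodule K (Fin 3 → K)) : Prop :=
  Module.finrank K L = 2 ∧
    ∃ P ∈ π.points, ∃ Q ∈ π.points, P ≠ Q ∧ P.submodule ≤ L ∧ Q.submodule ≤ L

/-- The points of the subplane on the line `L`. -/
def linePoints (π : Subplane F K) (L : Submodule K (Fin 3 → K)) : Set (Pt K) :=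
  {P | P ∈ π.points ∧ P.submodule ≤ L}

/-- The exterior splash, as a set of planes of the regular spread: the spread elements of the
points of the line at infinity that lie on an extended line of the subplane. -/
def splash (π : Subplane F K) : Set (Submodule F (BB F K)) :=
  {α | ∃ T : Pt K, T.submodule ≤ lineInf K ∧ (∃ L, π.IsLine L ∧ T.submodule ≤ L) ∧
    α = spreadPlane F K T}

/-- The homography `g` fixes the subplane (setwise) and the line at infinity. -/
def IsStabilizer (π : Subplane F K) (g : (Fin 3 → K) ≃ₗ[K] (Fin 3 → K)) : Prop :=
  Projectivization.map g.toLinearMap g.injective '' π.points = π.points ∧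
    (lineInf K).map g.toLinearMap = lineInf K

/-- `E` is fixed by the group of all homographies that fix the subplane and the line at
infinity. -/
def IsFixedPoint (π : Subplane F K) (E : Pt K) : Prop :=
  ∀ g : (Fin 3 → K) ≃ₗ[K] (Fin 3 → K), π.IsStabilizer g →
    Projectivization.map g.toLinearMap g.injective E = E

/-- A conic of the subplane: a nonzero quadratic form over `F` in the coordinates with respect to
the frame of the subplane. -/
structure Conic (π : Subplane F K) where
  poly : MvPolynomial (Fin 3) F
  homogeneous : poly.IsHomogeneous 2
  ne_zero : poly ≠ 0

namespace Conic

variable {π : Subplane F K}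

/-- The extension of the conic to `PG(2,q³)`. -/
def extension (C : π.Conic) : Set (Pt K) :=
  {P | MvPolynomial.aeval (π.frame.equivFun P.rep) C.poly = 0}

/-- The points of the conic in the subplane. -/
def points (C : π.Conic) : Set (Pt K) :=
  {P | P ∈ π.points ∧ P ∈ C.extension}

/-- The conic is special with respect to the line at infinity: its extension contains the fixed
points of the group of all homographies that fix the subplane and the line at infinity. -/
def IsSpecial (C : π.Conic) : Prop :=
  ∀ E, π.IsFixedPoint E → E ∈ C.extension

/-- The conic is tangent to the line `L` of the subplane at `P`: the point `P` is the only point of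
the subplane that is on both. -/
def IsTangentTo (C : π.Conic) (L : Submodule K (Fin 3 → K)) (P : Pt K) : Prop :=
  C.points ∩ π.linePoints L = {P}

end Conic

/-- A cover (switching set) of the exterior splash: a set of pairwise disjoint planes of `SigmaInf`
that cover the same points as the splash, each of them meeting each plane of the splash in exactly
one point. -/
def IsCover (π : Subplane F K) (X : Set (Submodule F (BB F K))) : Prop :=
  (∀ α ∈ X, α ≤ SigmaInf F K ∧ Module.finrank F α = 3) ∧
  (∀ α ∈ X, ∀ β ∈ X, α ≠ β → α ⊓ β = ⊥) ∧
  (∀ v : BB F K, (∃ α ∈ X, v ∈ α) ↔ ∃ β ∈ π.splash, v ∈ β) ∧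
  ∀ α ∈ X, ∀ β ∈ π.splash, Module.finrank F (α ⊓ β : Submodule F (BB F K)) = 1

/-- The tangent cover: the cover whose planes contain the intersections with `SigmaInf` of the
tangent planes of `[π]`, where the tangent plane at a point is formed by the tangent lines at this
point to the twisted cubics `[ℓ]`, for the lines `ℓ` of the subplane through it. -/
def IsTangentCover (π : Subplane F K) (X : Set (Submodule F (BB F K))) : Prop :=
  π.IsCover X ∧
  ∀ p ∈ bb F K π.points, ∃ α ∈ X, ∀ L, π.IsLine L → (bbMap F K p).submodule ≤ L →
    ∀ N : TwistedCubic F (BB F K), IsSpecialCubic (regularSpread F K) N →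
      N.points = bb F K (π.linePoints L) →
        ∀ T, N.IsTangentAt p T → T ⊓ SigmaInf F K ≤ α

/-- The conic cover: the other one of the two covers. -/
def IsConicCover (π : Subplane F K) (X : Set (Submodule F (BB F K))) : Prop :=
  π.IsCover X ∧ ¬ π.IsTangentCover X

end Subplane

end ExteriorSplash

end

open ExteriorSplash

noncomputable section

namespace ExteriorSplash

/-! ### The Frobenius automorphism of the cubic extension -/

section Frobenius

variable {F K : Type*} [Field F] [Field K] [Algebra F K]

/-! Let `σ` be the Frobenius map of `K` over `F`, and let N be the norm (`nm`). An exterior subplane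
has coordinates in which it consists of the points (u, σu, σ²u) and the line at infinity is the
vanishing of the first coordinate (`IsFrob.exists_normalForm`); the parameter of `P` can be taken to
be 1. Dividing by u, its affine points in `PG(6,q)` are (σu/u, σ²u/u, 1).

In these coordinates the splash is the set of planes y = kx with N(k) = -1 (`NormalForm.splash_eq`),
and its points fill the hypersurface N(y) = -N(x) at infinity. A plane of a cover is the graph of an
`F`-linear map. Counting and a polynomial identity leave only y = bσ(x) and y = bσ²(x) with N(b) =
-1 (`IsFrob.linear_classification`), so there are exactly two covers. Differentiating along the
lines through a point shows that σ² gives the tangent cover, hence σ gives the conic cover.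

The stabilizer of the subplane and the line at infinity is diagonal in these coordinates, and its
fixed points are the three base points. The special conics are therefore tr(a σ(u) σ²(u)) = 0, where
tr is the trace. Prescribing a point and a tangent determines a up to a factor in `F`. The conic
tangent at 1 to the line spanned by 1 and r is the image of that line under u ↦ u⁻¹
(`NormalForm.HasForm.points_eq`).

The common tangent comes from a symmetry. The `F`-linear involution (x, y, z) ↦ (σy, σ²x, z) of
`PG(6,q)` interchanges the splash with the conic cover and realizes u ↦ u⁻¹ on the affine points of
the subplane, so it carries [ℓ] to [C]. It fixes the point (1, 1, 1) and negates the tangent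
direction (σr - r, σ²r - r, 0) there, so the two tangents coincide (`IsFrob.tanLine_swap`).

That every special cubic with the given points has this tangent, whatever its parametrization,
follows from `IsFrob.isTangentAt_iff`: meeting one transversal line forces a factorization of the
coordinate forms, after which only linear forms matter. Existence of the special cubics needs all
transversal lines of the splash, which `IsFrob.eq_transLine` shows to be the three conjugate ones.
-/

/-- `σ` generates the Galois group of the cubic extension `K` of the finite field `F`: it is the
power map for the order of `F`. -/
structure IsFrob (σ : K →ₐ[F] K) : Prop where
  cube : ∀ x, σ (σ (σ x)) = x
  fixed : ∀ x, σ x = x → ∃ a : F, algebraMap F K a = x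
  two_le : 2 ≤ Nat.card F
  pow : ∀ x, σ x = x ^ Nat.card F
  card : Nat.card K = Nat.card F ^ 3

theorem exists_isFrob [Finite F] (hK : Module.finrank F K = 3) :
    ∃ σ : K →ₐ[F] K, IsFrob σ := by
  have : Module.Finite F K := Module.finite_of_finrank_pos (by omega)
  have : Finite K := Module.finite_of_finite F
  cases nonempty_fintype F
  have hord := FiniteField.orderOf_frobeniusAlgHom F K
  refine ⟨FiniteField.frobeniusAlgHom F K, ?_, ?_, ?_, ?_, ?_⟩
  · intro x
    have h := pow_orderOf_eq_one (FiniteField.frobeniusAlgHom F K)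
    rw [hord, hK] at h
    exact DFunLike.congr_fun h x
  · intro x hx
    by_contra hne
    push Not at hne
    have hx' : x ^ Fintype.card F = x := hx
    have hcard : 1 < Fintype.card F := Fintype.one_lt_card
    -- A fixed element outside `F` and the q elements of `F` would be q + 1 roots of X^q - X.
    have hp : (Polynomial.X ^ Fintype.card F - Polynomial.X : Polynomial K) = 0 := by
      have hinj := FaithfulSMul.algebraMap_injective F K
      refine Polynomial.eq_zero_of_natDegree_lt_card_of_eval_eq_zero _
        (f := fun o : Option F => o.elim x (algebraMap F K)) ?_ ?_ ?_
      · rintro (_ | a) (_ | b) h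
        · rfl
        · exact absurd h.symm (hne b)
        · exact absurd h (hne a)
        · exact congrArg some (hinj h)
      · rintro (_ | a)
        · simp [hx']
        · simp [← map_pow, FiniteField.pow_card]
      · rw [FiniteField.X_pow_card_sub_X_natDegree_eq K hcard, Fintype.card_option]
        omega
    exact FiniteField.X_pow_card_sub_X_ne_zero K hcard hp
  · rw [Nat.card_eq_fintype_card]; exact Fintype.one_lt_card
  · intro x; rw [Nat.card_eq_fintype_card]; rfl
  · rw [Module.natCard_eq_pow_finrank (K := F) (V := K), hK]

variable {σ : K →ₐ[F] K}

theorem IsFrob.finite (hσ : IsFrob σ) : Finite K := by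
  apply Nat.finite_of_card_ne_zero
  rw [hσ.card]
  have := hσ.two_le
  positivity

theorem IsFrob.injective (_hσ : IsFrob σ) : Function.Injective σ := σ.toRingHom.injective

/-- A polynomial of small degree that vanishes at all `σ x / x` is zero. -/
theorem IsFrob.poly_eq_zero (hσ : IsFrob σ) (f : Polynomial K)
    (hdeg : f.natDegree ≤ 2 * Nat.card F + 2) (hf : ∀ x, x ≠ 0 → f.eval (σ x / x) = 0) :
    f = 0 := by
  have := hσ.finite
  cases nonempty_fintype K
  have h2 := hσ.two_le
  set q := Nat.card F with hq
  have hc : Fintype.card K = q ^ 3 := by rw [← Nat.card_eq_fintype_card, hσ.card]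
  have hpos : 0 < q - 1 := by omega
  -- Since σx/x = x^(q-1), substituting X^(q-1) gives a polynomial that vanishes at all q³ - 1 =
  -- (q-1)(q²+q+1) units. Its degree is at most (q-1)(2q+2), which is smaller because q ≥ 2.
  have hE : Polynomial.expand K (q - 1) f = 0 := by
    classical
    refine Polynomial.eq_zero_of_natDegree_lt_card_of_eval_eq_zero _
      (f := fun x : Kˣ => (x : K)) Units.val_injective ?_ ?_
    · intro x
      rw [Polynomial.expand_eval]
      have hx : (x : K) ≠ 0 := x.ne_zero
      have : (x : K) ^ (q - 1) = σ x / x := by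
        rw [hσ.pow, eq_div_iff hx, ← pow_succ]
        congr 1; omega
      rw [this]
      exact hf _ hx
    · rw [Polynomial.natDegree_expand, Fintype.card_units, hc]
      obtain ⟨m, hm⟩ : ∃ m, q = m + 2 := ⟨q - 2, by omega⟩
      rw [hm] at hdeg ⊢
      have h1 : m + 2 - 1 = m + 1 := by omega
      have h3 : (m + 2) ^ 3 - 1 = (m + 1) * (m ^ 2 + 5 * m + 7) := by
        have : (m + 2) ^ 3 = (m + 1) * (m ^ 2 + 5 * m + 7) + 1 := by ring
        omega
      rw [h1, h3, mul_comm]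
      apply Nat.mul_lt_mul_of_pos_left _ (by omega)
      nlinarith
  rwa [Polynomial.expand_eq_zero hpos] at hE

/-- Dividing the relation by u turns it into a + bt + ct^(q+1) = 0 for every t = σu/u, and such a
polynomial is zero by `IsFrob.poly_eq_zero`. -/
theorem IsFrob.conj_linearIndependent (hσ : IsFrob σ) {a b c : K}
    (h : ∀ u, a * u + b * σ u + c * σ (σ u) = 0) : a = 0 ∧ b = 0 ∧ c = 0 := by
  have h2 := hσ.two_le
  have key : (Polynomial.C a + Polynomial.C b * Polynomial.X
      + Polynomial.C c * Polynomial.X ^ (Nat.card F + 1) : Polynomial K) = 0 := by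
    apply hσ.poly_eq_zero
    · compute_degree
      omega
    · intro x hx
      have h1 := h x
      have hs : σ x ≠ 0 := by simpa using hx
      have : σ (σ x) = (σ x) ^ Nat.card F := hσ.pow _
      have h3 : (σ x / x) ^ (Nat.card F + 1) = σ (σ x) / x := by
        rw [pow_succ, div_pow, ← this, ← hσ.pow x]
        field_simp
      simp only [Polynomial.eval_add, Polynomial.eval_mul, Polynomial.eval_C, Polynomial.eval_X,
        Polynomial.eval_pow, h3]
      field_simp
      linear_combination h1
  have h0 := congrArg (fun p => Polynomial.coeff p 0) key
  have h1 := congrArg (fun p => Polynomial.coeff p 1) key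
  have h3 := congrArg (fun p => Polynomial.coeff p (Nat.card F + 1)) key
  simp [Polynomial.coeff_C, Polynomial.coeff_X, Polynomial.coeff_X_pow] at h0 h1 h3
  have hq0 : Nat.card F ≠ 0 := by omega
  simp [hq0] at h0 h1 h3
  exact ⟨h0, h1, h3⟩

theorem IsFrob.exists_ne (hσ : IsFrob σ) : ∃ r, σ r ≠ r := by
  by_contra! h
  have := hσ.conj_linearIndependent (a := 1) (b := -1) (c := 0) (fun u => by rw [h u]; ring)
  exact one_ne_zero this.1

theorem IsFrob.ne₂ (hσ : IsFrob σ) {r : K} (hr : σ r ≠ r) : σ (σ r) ≠ r := fun h => by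
  apply hr
  have := congrArg σ h
  rw [hσ.cube] at this
  exact this.symm

theorem IsFrob.ne₁₂ (hσ : IsFrob σ) {r : K} (hr : σ r ≠ r) : σ (σ r) ≠ σ r :=
  fun h => hr (hσ.injective h)

/-- The norm of an element of `K`. -/
def nm (σ : K →ₐ[F] K) (x : K) : K := x * σ x * σ (σ x)

/-- The trace of an element of `K`. -/
def tr (σ : K →ₐ[F] K) (x : K) : K := x + σ x + σ (σ x)

theorem nm_mul (x y : K) : nm σ (x * y) = nm σ x * nm σ y := by simp [nm]; ring

theorem nm_ne_zero {x : K} (hx : x ≠ 0) : nm σ x ≠ 0 := by simp [nm, hx]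

theorem ne_zero_of_nm {x : K} (hx : nm σ x = -1) : x ≠ 0 := by
  rintro rfl; simp [nm] at hx

theorem IsFrob.exists_nm (hσ : IsFrob σ) (x : K) : ∃ a : F, algebraMap F K a = nm σ x :=
  hσ.fixed _ (by simp only [nm, map_mul, hσ.cube]; ring)

theorem IsFrob.exists_tr (hσ : IsFrob σ) (x : K) : ∃ a : F, algebraMap F K a = tr σ x :=
  hσ.fixed _ (by simp only [tr, map_add, hσ.cube]; ring)

theorem IsFrob.nm_map (hσ : IsFrob σ) (x : K) : nm σ (σ x) = nm σ x := by
  simp only [nm, hσ.cube]; ring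

/-- The resolvent y = z + cσ(z) + cσ(c)σ²(z) satisfies cσ(y) = y because c has norm 1. It is nonzero
for some z by the independence of the conjugates. -/
theorem IsFrob.hilbert90 (hσ : IsFrob σ) {c : K} (hc : nm σ c = 1) :
    ∃ y, y ≠ 0 ∧ c * σ y = y := by
  by_contra! h
  have h0 : ∀ z, 1 * z + c * σ z + (c * σ c) * σ (σ z) = 0 := by
    intro z
    by_contra hz
    refine h _ hz ?_
    simp only [map_add, map_mul, hσ.cube, map_one]
    unfold nm at hc
    linear_combination z * hc
  exact one_ne_zero (hσ.conj_linearIndependent h0).1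

/-- The solutions of `σ x / x = const` form a one-dimensional space. -/
theorem IsFrob.exists_smul_of_ratio (hσ : IsFrob σ) {x y : K} (hx : x ≠ 0)
    (h : σ y * x = y * σ x) : ∃ a : F, y = algebraMap F K a * x := by
  have hs : σ x ≠ 0 := by simpa using hx
  obtain ⟨a, ha⟩ := hσ.fixed (y / x) (by rw [map_div₀]; field_simp; linear_combination h)
  exact ⟨a, by rw [ha]; field_simp⟩

/-- Elements `1, r, r²` of the cubic extension are independent over the ground field. -/
theorem IsFrob.powers_independent (hσ : IsFrob σ) {r : K} (hr : σ r ≠ r) {s t m : F}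
    (h : algebraMap F K s + algebraMap F K t * r + algebraMap F K m * r ^ 2 = 0) :
    s = 0 ∧ t = 0 ∧ m = 0 := by
  have h1 := congrArg σ h
  have h2 := congrArg σ h1
  simp only [map_add, map_mul, map_pow, AlgHom.commutes, map_zero] at h1 h2
  have d1 := sub_ne_zero.2 hr
  have d2 := sub_ne_zero.2 (hσ.ne₂ hr)
  have d3 := sub_ne_zero.2 (hσ.ne₁₂ hr)
  have e1 : algebraMap F K t + algebraMap F K m * (σ r + r) = 0 :=
    mul_left_cancel₀ d1 (by linear_combination h1 - h)
  have e2 : algebraMap F K t + algebraMap F K m * (σ (σ r) + r) = 0 :=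
    mul_left_cancel₀ d2 (by linear_combination h2 - h)
  have e3 : algebraMap F K m = 0 := mul_left_cancel₀ d3 (by linear_combination e2 - e1)
  have e4 : algebraMap F K t = 0 := by linear_combination e1 - (σ r + r) * e3
  have e5 : algebraMap F K s = 0 := by linear_combination h - r * e4 - r ^ 2 * e3
  simpa using And.intro e5 (And.intro e4 e3)

theorem IsFrob.finrank_eq (hσ : IsFrob σ) : Module.finrank F K = 3 := by
  have := hσ.finite
  have : Finite F := Finite.of_injective _ (FaithfulSMul.algebraMap_injective F K)
  have h := Module.natCard_eq_pow_finrank (K := F) (V := K)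
  rw [hσ.card] at h
  exact (Nat.pow_right_injective hσ.two_le h).symm

theorem IsFrob.exists_coords (hσ : IsFrob σ) {r : K} (hr : σ r ≠ r) (u : K) :
    ∃ s t m : F, u = algebraMap F K s + algebraMap F K t * r + algebraMap F K m * r ^ 2 := by
  have hli : LinearIndependent F ![1, r, r ^ 2] := by
    rw [Fintype.linearIndependent_iff]
    intro g hg
    simp only [Fin.sum_univ_three, Algebra.smul_def] at hg
    have := hσ.powers_independent hr (s := g 0) (t := g 1) (m := g 2) (by simpa using hg)
    intro i; fin_cases i
    · exact this.1
    · exact this.2.1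
    · exact this.2.2
  have htop := hli.span_eq_top_of_card_eq_finrank (by simp [hσ.finrank_eq])
  have hu : u ∈ Submodule.span F (Set.range ![1, r, r ^ 2]) := by rw [htop]; trivial
  obtain ⟨c, hc⟩ := (Submodule.mem_span_range_iff_exists_fun F).1 hu
  refine ⟨c 0, c 1, c 2, ?_⟩
  rw [← hc]
  simp [Fin.sum_univ_three, Algebra.smul_def]

/-- Every `F`-linear map of `K` is a linearized polynomial. -/
theorem IsFrob.exists_linearized (hσ : IsFrob σ) (A : K →ₗ[F] K) :
    ∃ a b c : K, ∀ x, A x = a * x + b * σ x + c * σ (σ x) := by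
  obtain ⟨r, hr⟩ := hσ.exists_ne
  have d1 := sub_ne_zero.2 hr
  have d2 := sub_ne_zero.2 (hσ.ne₂ hr)
  have d3 := sub_ne_zero.2 (hσ.ne₁₂ hr)
  set r1 := σ r
  set r2 := σ r1
  -- The values at 1, r, r² give a Vandermonde system for the three coefficients, solved by
  -- elimination.
  let c := ((A (r ^ 2) - A 1 * r ^ 2) - (A r - A 1 * r) * (r1 + r)) / ((r2 - r) * (r2 - r1))
  let b := ((A r - A 1 * r) - c * (r2 - r)) / (r1 - r)
  let a := A 1 - b - c
  have hb : b * (r1 - r) = (A r - A 1 * r) - c * (r2 - r) := by simp only [b]; field_simp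
  have hc : c * ((r2 - r) * (r2 - r1)) =
      (A (r ^ 2) - A 1 * r ^ 2) - (A r - A 1 * r) * (r1 + r) := by simp only [c]; field_simp
  refine ⟨a, b, c, fun x => ?_⟩
  obtain ⟨s, t, m, rfl⟩ := hσ.exists_coords hr x
  have hs : ∀ (s : F) (y : K), A (algebraMap F K s * y) = algebraMap F K s * A y := by
    intro s y; rw [← Algebra.smul_def, map_smul, Algebra.smul_def]
  have h1 : A (algebraMap F K s) = algebraMap F K s * A 1 := by simpa using hs s 1
  simp only [map_add, map_mul, map_pow, AlgHom.commutes, hs, h1]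
  simp only [a]
  change _ = (A 1 - b - c) * (algebraMap F K s + algebraMap F K t * r + algebraMap F K m * r ^ 2)
    + b * (algebraMap F K s + algebraMap F K t * r1 + algebraMap F K m * r1 ^ 2)
    + c * (algebraMap F K s + algebraMap F K t * r2 + algebraMap F K m * r2 ^ 2)
  linear_combination (-algebraMap F K t - algebraMap F K m * (r1 + r)) * hb - algebraMap F K m * hc

end Frobenius

/-! ### Covers of the splash in coordinates -/

section Covers

variable {F K : Type*} [Field F] [Field K] [Algebra F K] {σ : K →ₐ[F] K}

/-- The substitution x ↦ rx multiplies the sum by τ(r)/r, which differs from 1. The term at x = 0 is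
0 by the convention for division. -/
theorem IsFrob.sum_ratio_eq_zero [Fintype K] (hσ : IsFrob σ) :
    ∑ x : K, σ x / x = 0 ∧ ∑ x : K, σ (σ x) / x = 0 := by
  obtain ⟨r, hr⟩ := hσ.exists_ne
  have hr0 : r ≠ 0 := by rintro rfl; simp at hr
  have main : ∀ τ : K →+* K, τ r ≠ r → ∑ x : K, τ x / x = 0 := by
    intro τ hτ
    have h := Fintype.sum_equiv (Equiv.mulLeft₀ r hr0) (fun x => (τ r / r) * (τ x / x))
      (fun x => τ x / x) (fun x => by simp [map_mul, mul_div_mul_comm])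
    rw [← Finset.mul_sum] at h
    have h1 : (τ r / r - 1) * ∑ x : K, τ x / x = 0 := by rw [sub_mul, h]; ring
    refine (mul_eq_zero.1 h1).resolve_left ?_
    rwa [← ne_eq, sub_ne_zero, ne_eq, div_eq_one_iff_eq hr0]
  exact ⟨main σ.toRingHom hr, main (σ.toRingHom.comp σ.toRingHom) (hσ.ne₂ hr)⟩

/-- The term at 0 is 0/0 = 0, so the sum is the number of units, which is -1 in `K`. -/
theorem sum_self_ratio [Fintype K] : ∑ x : K, x / x = -1 := by
  classical
  have h : ∀ x : K, x / x = 1 - if x = 0 then 1 else 0 := by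
    intro x; by_cases hx : x = 0 <;> simp [hx]
  have hc : ((Fintype.card K : ℕ) : K) = 0 := Nat.cast_card_eq_zero K
  rw [Finset.sum_congr rfl (fun x _ => h x), Finset.sum_sub_distrib]
  simp

/-- Sorting the terms by their value shows that only the sizes of the fibres matter; the fibre over
0 contributes nothing. -/
theorem sum_eq_of_card_fiber_eq [Fintype K] [DecidableEq K] (f g : K → K)
    (h : ∀ k, k ≠ 0 → (Finset.univ.filter (f · = k)).card = (Finset.univ.filter (g · = k)).card) :
    ∑ x, f x = ∑ x, g x := by
  have key : ∀ f : K → K, ∑ x, f x = ∑ k, (Finset.univ.filter (f · = k)).card • k := by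
    intro f
    rw [← Finset.sum_fiberwise Finset.univ f f]
    refine Finset.sum_congr rfl fun k _ => ?_
    rw [Finset.sum_congr rfl (fun x hx => (Finset.mem_filter.1 hx).2), Finset.sum_const]
  rw [key f, key g]
  refine Finset.sum_congr rfl fun k _ => ?_
  by_cases hk : k = 0
  · simp [hk]
  · rw [h k hk]

open Classical in
theorem card_ratio_fiber [Fintype K] (A : K →ₗ[F] K) {k : K}
    (hk : k ≠ 0) :
    (Finset.univ.filter (fun x => A x / x = k)).card
      = Nat.card F ^ Module.finrank F (LinearMap.ker (A - k • LinearMap.id)) - 1 := by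
  have : Finite F := Finite.of_injective _ (FaithfulSMul.algebraMap_injective F K)
  rw [← Module.natCard_eq_pow_finrank]
  have h1 : Finset.univ.filter (fun x => A x / x = k) =
      (Finset.univ.filter (fun x => x ∈ LinearMap.ker (A - k • LinearMap.id))).erase 0 := by
    ext x
    simp only [Finset.mem_filter, Finset.mem_univ, true_and, Finset.mem_erase, LinearMap.mem_ker,
      LinearMap.sub_apply, LinearMap.smul_apply, LinearMap.id_apply, smul_eq_mul, sub_eq_zero]
    by_cases hx : x = 0
    · simp [hx, hk.symm]
    · simp [hx, div_eq_iff hx]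
  rw [h1, Finset.card_erase_of_mem (by simp), Nat.card_eq_fintype_card, Fintype.card_subtype]

/-- Since b/k has norm 1, Hilbert 90 gives a nonzero solution of bσ(y) = ky; any other solution x
has the same ratio σ(x)/x, so it is an `F`-multiple of y. -/
theorem IsFrob.finrank_ker (hσ : IsFrob σ) {b k : K} (hb : nm σ b = -1) (hk : nm σ k = -1) :
    Module.finrank F (LinearMap.ker (b • σ.toLinearMap - k • LinearMap.id)) = 1 := by
  have hk0 := ne_zero_of_nm hk
  have hb0 := ne_zero_of_nm hb
  obtain ⟨y, hy0, hy⟩ := hσ.hilbert90 (c := b / k) (by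
    have : nm σ (b / k) * nm σ k = nm σ b := by rw [← nm_mul, div_mul_cancel₀ _ hk0]
    rw [hb, hk] at this
    linear_combination -this)
  have hy' : b * σ y = k * y := by
    field_simp at hy; linear_combination hy
  refine finrank_eq_one_iff'.2 ⟨⟨y, ?_⟩, ?_, ?_⟩
  · simp [hy']
  · simpa [Subtype.ext_iff] using hy0
  · rintro ⟨x, hx⟩
    have hx' : b * σ x = k * x := by simpa [sub_eq_zero] using hx
    obtain ⟨a, ha⟩ := hσ.exists_smul_of_ratio (x := y) (y := x) hy0
      (mul_left_cancel₀ hb0 (by linear_combination y * hx' - x * hy'))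
    exact ⟨a, Subtype.ext (by simp [ha, Algebra.smul_def])⟩

/-- Applying `σ` to bσ²(x) = kx gives σ(k)σ(x) = σ(b)x, which is the case already treated. -/
theorem IsFrob.finrank_ker₂ (hσ : IsFrob σ) {b k : K} (hb : nm σ b = -1) (hk : nm σ k = -1) :
    Module.finrank F
      (LinearMap.ker (b • (σ.toLinearMap ∘ₗ σ.toLinearMap) - k • LinearMap.id)) = 1 := by
  rw [← hσ.finrank_ker (b := σ k) (k := σ b) (by rw [hσ.nm_map, hk]) (by rw [hσ.nm_map, hb])]
  suffices h : LinearMap.ker (b • (σ.toLinearMap ∘ₗ σ.toLinearMap) - k • LinearMap.id)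
      = LinearMap.ker (σ k • σ.toLinearMap - σ b • LinearMap.id) by rw [h]
  ext x
  simp only [LinearMap.mem_ker, LinearMap.sub_apply, LinearMap.smul_apply, LinearMap.comp_apply,
    LinearMap.id_apply, smul_eq_mul, sub_eq_zero, AlgHom.toLinearMap_apply]
  constructor
  · intro h
    have := congrArg σ h
    simp only [map_mul, hσ.cube] at this
    exact this.symm
  · intro h
    apply hσ.injective
    simp only [map_mul, hσ.cube]
    exact h.symm

/-- The linear maps that change the sign of the norm and have a one-dimensional space in common
with every such multiplication. -/
theorem IsFrob.linear_classification (hσ : IsFrob σ) (A : K →ₗ[F] K)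
    (hN : ∀ x, nm σ (A x) = - nm σ x)
    (h1 : ∀ k, nm σ k = -1 → Module.finrank F (LinearMap.ker (A - k • LinearMap.id)) = 1) :
    ∃ b, nm σ b = -1 ∧
      (A = b • σ.toLinearMap ∨ A = b • (σ.toLinearMap ∘ₗ σ.toLinearMap)) := by
  classical
  have := hσ.finite
  cases nonempty_fintype K
  obtain ⟨a, b, c, hA⟩ := hσ.exists_linearized A
  have hz : ∀ (B : K →ₗ[F] K), (∀ x, nm σ (B x) = - nm σ x) → ∀ k, nm σ k ≠ -1 →
      Module.finrank F (LinearMap.ker (B - k • LinearMap.id)) = 0 := by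
    intro B hB k hk
    rw [Submodule.finrank_eq_zero, LinearMap.ker_eq_bot']
    intro x hx
    by_contra hx0
    have h : B x = k * x := by simpa [sub_eq_zero] using hx
    apply hk
    have := hB x
    rw [h, nm_mul] at this
    exact mul_right_cancel₀ (nm_ne_zero (σ := σ) hx0) (by rw [this]; ring)
  have hm1 : nm σ (-1 : K) = -1 := by simp [nm]
  -- The map -σ serves as a standard of comparison: for it too a nonzero k is a value of B(x)/x for
  -- q - 1 elements x if N(k) = -1, and for none otherwise. Hence the sums of A(x)/x and B(x)/x
  -- agree. The first is minus the coefficient a, and the second is 0.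
  let B : K →ₗ[F] K := (-1 : K) • σ.toLinearMap
  have hBN : ∀ x, nm σ (B x) = - nm σ x := by
    intro x
    simp only [B, LinearMap.smul_apply, AlgHom.toLinearMap_apply, smul_eq_mul]
    rw [nm_mul, hσ.nm_map, hm1]; ring
  have hsum := sum_eq_of_card_fiber_eq (fun x => A x / x) (fun x => B x / x) (by
    intro k hk
    rw [card_ratio_fiber A hk, card_ratio_fiber B hk]
    by_cases hk1 : nm σ k = -1
    · rw [h1 k hk1, hσ.finrank_ker hm1 hk1]
    · rw [hz A hN k hk1, hz B hBN k hk1])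
  obtain ⟨s1, s2⟩ := hσ.sum_ratio_eq_zero
  have s0 := sum_self_ratio (K := K)
  have ha : a = 0 := by
    have e1 : ∑ x, A x / x = a * ∑ x : K, x / x + b * ∑ x, σ x / x + c * ∑ x, σ (σ x) / x := by
      simp only [Finset.mul_sum, ← Finset.sum_add_distrib]
      refine Finset.sum_congr rfl fun x _ => ?_
      rw [hA]; ring
    have e2 : ∑ x, B x / x = - ∑ x, σ x / x := by
      rw [← Finset.sum_neg_distrib]
      refine Finset.sum_congr rfl fun x _ => ?_
      simp [B]; ring
    rw [e1, e2, s0, s1, s2] at hsum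
    linear_combination -hsum
  subst ha
  have hbc : b = 0 ∨ c = 0 := by
    set q := Nat.card F with hq
    have h2 : 2 ≤ q := hσ.two_le
    -- With t = σx/x, the identity N(bσx + cσ²x) = -N(x) becomes a polynomial identity in t of
    -- degree at most 2q + 2. Its constant coefficient is bσ(c)σ²(b), so b or c vanishes.
    have key : (Polynomial.C (b * σ b * σ (σ b) + c * σ c * σ (σ c) + 1) * Polynomial.X ^ (q + 1)
        + Polynomial.C (b * σ c * σ (σ b))
        + Polynomial.C (b * σ b * σ (σ c)) * Polynomial.X ^ (q + 2)
        + Polynomial.C (c * σ b * σ (σ b)) * Polynomial.X ^ (2 * q + 1)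
        + Polynomial.C (c * σ c * σ (σ b)) * Polynomial.X ^ q
        + Polynomial.C (b * σ c * σ (σ c)) * Polynomial.X
        + Polynomial.C (c * σ b * σ (σ c)) * Polynomial.X ^ (2 * q + 2) : Polynomial K) = 0 := by
      apply hσ.poly_eq_zero
      · compute_degree
        omega
      · intro x hx
        have hs : σ x ≠ 0 := by simpa using hx
        have hss : σ (σ x) ≠ 0 := by simpa using hx
        have hp : (σ x / x) ^ q = σ (σ x) / σ x := by
          rw [← hσ.pow, map_div₀]
        have hn := hN x
        rw [hA] at hn
        simp only [nm, map_add, map_mul, map_zero, hσ.cube] at hn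
        simp only [Polynomial.eval_add, Polynomial.eval_mul, Polynomial.eval_C, Polynomial.eval_X,
          Polynomial.eval_pow, pow_add, pow_mul', hp]
        field_simp
        linear_combination hn
    have h0 := congrArg (Polynomial.eval 0) key
    have hq0 : q ≠ 0 := by omega
    simp [hq0] at h0
    tauto
  have hA1 := hN 1
  rw [hA] at hA1
  rcases hbc with rfl | rfl
  · refine ⟨c, ?_, Or.inr ?_⟩
    · simpa [nm] using hA1
    · ext x; simp [hA]
  · refine ⟨b, ?_, Or.inl ?_⟩
    · simpa [nm] using hA1
    · ext x; simp [hA]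

end Covers

/-! ### Graph planes at infinity and the two covers of the splash -/

section Planes

variable {F K : Type*} [Field F] [Field K] [Algebra F K]

/-- The plane at infinity with equation `y = τ x` in the coordinates `Φ`. -/
def graphPlane (Φ : BB F K ≃ₗ[F] BB F K) (τ : K →ₗ[F] K) : Submodule F (BB F K) where
  carrier := {v | (Φ v).2.1 = τ (Φ v).1 ∧ (Φ v).2.2 = 0}
  add_mem' := by
    rintro v w ⟨h1, h2⟩ ⟨h3, h4⟩
    simp [h1, h2, h3, h4]
  zero_mem' := by simp
  smul_mem' := by
    rintro a v ⟨h1, h2⟩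
    simp [h1, h2]

variable {Φ : BB F K ≃ₗ[F] BB F K} {σ : K →ₐ[F] K}

theorem mem_graphPlane {τ : K →ₗ[F] K} {v : BB F K} :
    v ∈ graphPlane Φ τ ↔ (Φ v).2.1 = τ (Φ v).1 ∧ (Φ v).2.2 = 0 := Iff.rfl

theorem mem_SigmaInf {v : BB F K} : v ∈ SigmaInf F K ↔ v.2.2 = 0 := by simp [SigmaInf]

/-- The parametrization of the plane `y = τ x`. -/
def graphPlaneEquiv (Φ : BB F K ≃ₗ[F] BB F K) (τ : K →ₗ[F] K) : K ≃ₗ[F] graphPlane Φ τ where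
  toFun x := ⟨Φ.symm (x, τ x, 0), by simp [mem_graphPlane]⟩
  invFun v := (Φ v).1
  left_inv x := by simp
  right_inv v := by
    obtain ⟨v, h1, h2⟩ := v
    apply Subtype.ext
    apply Φ.injective
    simp only [LinearEquiv.apply_symm_apply, ← h1, ← h2]
  map_add' x y := by
    apply Subtype.ext
    change Φ.symm _ = Φ.symm _ + Φ.symm _
    rw [← map_add Φ.symm]
    simp
  map_smul' a x := by
    apply Subtype.ext
    change Φ.symm _ = a • Φ.symm _
    rw [← map_smul Φ.symm]
    simp

theorem finrank_graphPlane (hσ : IsFrob σ) (τ : K →ₗ[F] K) :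
    Module.finrank F (graphPlane Φ τ) = 3 := by
  rw [← hσ.finrank_eq, (graphPlaneEquiv Φ τ).finrank_eq]

theorem graphPlane_le_SigmaInf (hz : ∀ v, (Φ v).2.2 = v.2.2) (τ : K →ₗ[F] K) :
    graphPlane Φ τ ≤ SigmaInf F K := by
  rintro v ⟨-, h⟩
  rwa [mem_SigmaInf, ← hz]

/-- Two planes meet in the space on which their equations agree. -/
theorem finrank_graphPlane_inf (τ τ' : K →ₗ[F] K) :
    Module.finrank F (graphPlane Φ τ ⊓ graphPlane Φ τ' : Submodule F (BB F K))
      = Module.finrank F (LinearMap.ker (τ - τ')) := by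
  refine LinearEquiv.finrank_eq
    { toFun := fun v => ⟨(Φ v.1).1, ?_⟩
      invFun := fun x => ⟨Φ.symm (x.1, τ x.1, 0), ?_, ?_⟩
      left_inv := ?_
      right_inv := ?_
      map_add' := ?_
      map_smul' := ?_ }
  · obtain ⟨v, ⟨h1, -⟩, ⟨h2, -⟩⟩ := v
    simp [← h1, ← h2]
  · intro v w; apply Subtype.ext; simp
  · intro a v; apply Subtype.ext; simp
  · simp [mem_graphPlane]
  · obtain ⟨x, hx⟩ := x
    rw [LinearMap.mem_ker, LinearMap.sub_apply, sub_eq_zero] at hx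
    simp [mem_graphPlane, hx]
  · rintro ⟨v, ⟨h1, h2⟩, h3⟩
    apply Subtype.ext
    apply Φ.injective
    simp only [LinearEquiv.apply_symm_apply, ← h1, ← h2]
  · intro x; simp

/-- The family of planes `y = b τ x` with `b` of norm `-1`. -/
def family (σ : K →ₐ[F] K) (Φ : BB F K ≃ₗ[F] BB F K) (τ : K →ₗ[F] K) :
    Set (Submodule F (BB F K)) :=
  {α | ∃ b : K, nm σ b = -1 ∧ α = graphPlane Φ (b • τ)}

/-- For x ≠ 0 the plane through (x, y, 0) must have b = y/τ(x), and N(b) = -1 amounts to N(y) =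
-N(x). The condition does not depend on `τ`, so the three families cover the same points. -/
theorem exists_mem_family_iff {τ : K →ₗ[F] K} (hτ : ∀ x, nm σ (τ x) = nm σ x) {v : BB F K} :
    (∃ α ∈ family σ Φ τ, v ∈ α) ↔ (Φ v).2.2 = 0 ∧ nm σ (Φ v).2.1 = - nm σ (Φ v).1 := by
  have h0 : ∀ x, x ≠ 0 → τ x ≠ 0 := by
    intro x hx h
    have := hτ x
    rw [h] at this
    exact nm_ne_zero hx (by rw [← this]; simp [nm])
  constructor
  · rintro ⟨_, ⟨b, hb, rfl⟩, h1, h2⟩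
    refine ⟨h2, ?_⟩
    rw [h1, LinearMap.smul_apply, smul_eq_mul, nm_mul, hb, hτ]; ring
  · rintro ⟨h1, h2⟩
    by_cases hx : (Φ v).1 = 0
    · have hy : (Φ v).2.1 = 0 := by
        by_contra hy
        apply nm_ne_zero (σ := σ) hy
        rw [h2, hx]; simp [nm]
      refine ⟨_, ⟨-1, by simp [nm], rfl⟩, ?_, h1⟩
      simp [hx, hy]
    · have hx' := h0 _ hx
      refine ⟨_, ⟨(Φ v).2.1 / τ (Φ v).1, ?_, rfl⟩, ?_, h1⟩
      · have : nm σ ((Φ v).2.1 / τ (Φ v).1) * nm σ (τ (Φ v).1) = nm σ (Φ v).2.1 := by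
          rw [← nm_mul, div_mul_cancel₀ _ hx']
        apply mul_right_cancel₀ (nm_ne_zero (σ := σ) hx')
        rw [this, h2, hτ]; ring
      · simp [hx']

/-- A set of planes is a cover of the family `y = k x`. -/
def IsCoverOf (S X : Set (Submodule F (BB F K))) : Prop :=
  (∀ α ∈ X, α ≤ SigmaInf F K ∧ Module.finrank F α = 3) ∧
  (∀ α ∈ X, ∀ β ∈ X, α ≠ β → α ⊓ β = ⊥) ∧
  (∀ v : BB F K, (∃ α ∈ X, v ∈ α) ↔ ∃ β ∈ S, v ∈ β) ∧
  ∀ α ∈ X, ∀ β ∈ S, Module.finrank F (α ⊓ β : Submodule F (BB F K)) = 1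

theorem family_isCoverOf (hσ : IsFrob σ) (hz : ∀ v, (Φ v).2.2 = v.2.2) {τ : K →ₗ[F] K}
    (hτ : ∀ x, nm σ (τ x) = nm σ x)
    (hker : ∀ b k, nm σ b = -1 → nm σ k = -1 →
      Module.finrank F (LinearMap.ker (b • τ - k • LinearMap.id)) = 1) :
    IsCoverOf (family σ Φ LinearMap.id) (family σ Φ τ) := by
  refine ⟨?_, ?_, ?_, ?_⟩
  · rintro _ ⟨b, -, rfl⟩
    exact ⟨graphPlane_le_SigmaInf hz _, finrank_graphPlane hσ _⟩
  · rintro _ ⟨b, hb, rfl⟩ _ ⟨c, hc, rfl⟩ hne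
    rw [Submodule.eq_bot_iff]
    rintro v ⟨⟨h1, h2⟩, ⟨h3, -⟩⟩
    simp only [LinearMap.smul_apply, smul_eq_mul] at h1 h3
    have hbc : b ≠ c := by rintro rfl; exact hne rfl
    have hx : τ (Φ v).1 = 0 := by
      by_contra hx
      exact hbc (mul_right_cancel₀ hx (h1.symm.trans h3))
    have hx0 : (Φ v).1 = 0 := by
      by_contra hx0
      apply nm_ne_zero (σ := σ) hx0
      rw [← hτ, hx]; simp [nm]
    rw [hx, mul_zero] at h1
    apply Φ.injective
    rw [map_zero]
    exact Prod.ext hx0 (Prod.ext h1 h2)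
  · intro v
    rw [exists_mem_family_iff hτ, exists_mem_family_iff (fun _ => rfl)]
  · rintro _ ⟨b, hb, rfl⟩ _ ⟨k, hk, rfl⟩
    rw [finrank_graphPlane_inf, hker b k hb hk]

/-- On a plane of a cover N(y) = -N(x), so x = 0 forces y = 0. Projection to x is thus injective,
hence bijective as both dimensions are 3, and the plane is the graph of a linear map A with N(Ax) =
-N(x). Meeting each plane y = kx in one point says that A - k has a one-dimensional kernel, so
`IsFrob.linear_classification` applies. -/
theorem IsFrob.mem_family_of_isCoverOf (hσ : IsFrob σ) {X : Set (Submodule F (BB F K))}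
    (hX : IsCoverOf (family σ Φ LinearMap.id) X) {α : Submodule F (BB F K)} (hα : α ∈ X) :
    α ∈ family σ Φ σ.toLinearMap ∨ α ∈ family σ Φ (σ.toLinearMap ∘ₗ σ.toLinearMap) := by
  obtain ⟨h1, h2, h3, h4⟩ := hX
  have hpt : ∀ v ∈ α, (Φ v).2.2 = 0 ∧ nm σ (Φ v).2.1 = - nm σ (Φ v).1 := by
    intro v hv
    exact (exists_mem_family_iff (fun _ => rfl)).1 ((h3 v).1 ⟨α, hα, hv⟩)
  have : Module.Finite F K := Module.finite_of_finrank_pos (by rw [hσ.finrank_eq]; omega)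
  let f : α →ₗ[F] K := LinearMap.fst F K (K × F) ∘ₗ Φ.toLinearMap ∘ₗ α.subtype
  have hf : ∀ v : α, f v = (Φ v).1 := fun _ => rfl
  have hinj : Function.Injective f := by
    rw [← LinearMap.ker_eq_bot, LinearMap.ker_eq_bot']
    intro v hv
    rw [hf] at hv
    obtain ⟨e1, e2⟩ := hpt v v.2
    have e3 : (Φ v).2.1 = 0 := by
      by_contra hy
      apply nm_ne_zero (σ := σ) hy
      rw [e2, hv]; simp [nm]
    apply Subtype.ext
    apply Φ.injective
    rw [Submodule.coe_zero, map_zero]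
    exact Prod.ext hv (Prod.ext e3 e1)
  let e : α ≃ₗ[F] K := LinearEquiv.ofInjectiveOfFinrankEq f hinj
    ((h1 α hα).2.trans hσ.finrank_eq.symm)
  let A : K →ₗ[F] K := LinearMap.fst F K F ∘ₗ LinearMap.snd F K (K × F) ∘ₗ Φ.toLinearMap ∘ₗ
    α.subtype ∘ₗ e.symm.toLinearMap
  have hA : ∀ v : α, A (Φ v).1 = (Φ v).2.1 := by
    intro v
    have : (Φ v).1 = e v := rfl
    rw [this]
    simp [A]
  have hαA : α = graphPlane Φ A := by
    apply Submodule.eq_of_le_of_finrank_eq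
    · intro v hv
      exact ⟨(hA ⟨v, hv⟩).symm, (hpt v hv).1⟩
    · rw [(h1 α hα).2, finrank_graphPlane hσ]
  have hAe : ∀ x, ∃ v : α, (Φ v).1 = x := fun x => ⟨e.symm x, e.apply_symm_apply x⟩
  obtain ⟨b, hb, hAb⟩ := hσ.linear_classification A
    (by
      intro x
      obtain ⟨v, rfl⟩ := hAe x
      rw [hA]
      exact (hpt v v.2).2)
    (by
      intro k hk
      rw [← finrank_graphPlane_inf (Φ := Φ), ← hαA]
      exact h4 α hα _ ⟨k, hk, rfl⟩)
  rw [hαA]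
  rcases hAb with hAb | hAb
  · exact Or.inl ⟨b, hb, by rw [hAb]⟩
  · exact Or.inr ⟨b, hb, by rw [hAb]⟩

/-- A cover must contain a plane through (1, bτ(1), 0), and only one plane of the family passes
through this point. -/
theorem eq_family_of_subset {X : Set (Submodule F (BB F K))} {τ : K →ₗ[F] K}
    (hτ : ∀ x, nm σ (τ x) = nm σ x) (hX : IsCoverOf (family σ Φ LinearMap.id) X)
    (hsub : X ⊆ family σ Φ τ) : X = family σ Φ τ := by
  refine Set.Subset.antisymm hsub ?_
  rintro _ ⟨b, hb, rfl⟩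
  have hτ1 : τ 1 ≠ 0 := by
    intro h
    have := hτ 1
    rw [h] at this
    simp [nm] at this
  set v : BB F K := Φ.symm (1, b * τ 1, 0) with hv
  obtain ⟨α, hα, hvα⟩ := (hX.2.2.1 v).2 ((exists_mem_family_iff (fun _ => rfl)).2 (by
    simp only [hv, LinearEquiv.apply_symm_apply, true_and]
    rw [nm_mul, hb, hτ]; ring))
  obtain ⟨c, hc, rfl⟩ := hsub hα
  have h := hvα.1
  simp only [hv, LinearEquiv.apply_symm_apply, LinearMap.smul_apply, smul_eq_mul] at h
  rwa [mul_right_cancel₀ hτ1 h]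

theorem IsFrob.nm_map₂ (hσ : IsFrob σ) (x : K) :
    nm σ ((σ.toLinearMap ∘ₗ σ.toLinearMap) x) = nm σ x := by
  rw [LinearMap.comp_apply, AlgHom.toLinearMap_apply, AlgHom.toLinearMap_apply, hσ.nm_map,
    hσ.nm_map]

/-- The splash `y = k x` has precisely two covers. -/
theorem IsFrob.isCoverOf_iff (hσ : IsFrob σ) (hz : ∀ v, (Φ v).2.2 = v.2.2)
    {X : Set (Submodule F (BB F K))} :
    IsCoverOf (family σ Φ LinearMap.id) X ↔
      X = family σ Φ σ.toLinearMap ∨ X = family σ Φ (σ.toLinearMap ∘ₗ σ.toLinearMap) := by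
  constructor
  · intro hX
    by_cases h : X ⊆ family σ Φ σ.toLinearMap
    · exact Or.inl (eq_family_of_subset hσ.nm_map hX h)
    · right
      obtain ⟨α, hα, hα'⟩ := Set.not_subset.1 h
      obtain ⟨c, hc, rfl⟩ := (hσ.mem_family_of_isCoverOf hX hα).resolve_left hα'
      refine eq_family_of_subset hσ.nm_map₂ hX fun β hβ => ?_
      refine (hσ.mem_family_of_isCoverOf hX hβ).resolve_left ?_
      rintro ⟨b, hb, rfl⟩
      have hc0 := ne_zero_of_nm hc
      have hb0 := ne_zero_of_nm hb
      -- A cover cannot mix the two families: Hilbert 90 solves cσ²(y) = bσ(y) with y ≠ 0, so a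
      -- plane of one always meets a plane of the other.
      obtain ⟨y, hy0, hy⟩ := hσ.hilbert90 (c := σ (σ (c / b))) (by
        rw [hσ.nm_map, hσ.nm_map]
        have : nm σ (c / b) * nm σ b = nm σ c := by rw [← nm_mul, div_mul_cancel₀ _ hb0]
        rw [hb, hc] at this
        linear_combination -this)
      have hy' : c * σ (σ y) = b * σ y := by
        have := congrArg σ hy
        simp only [map_mul, map_div₀, hσ.cube] at this
        field_simp at this
        exact this
      have hne : graphPlane Φ (c • (σ.toLinearMap ∘ₗ σ.toLinearMap))
          ≠ graphPlane Φ (b • σ.toLinearMap) := fun h => hα' ⟨b, hb, h⟩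
      have hbot := hX.2.1 _ hα _ hβ hne
      have hmem : Φ.symm (y, b * σ y, 0) ∈ graphPlane Φ (c • (σ.toLinearMap ∘ₗ σ.toLinearMap))
          ⊓ graphPlane Φ (b • σ.toLinearMap) := by
        constructor <;> simp [mem_graphPlane, hy']
      rw [hbot, Submodule.mem_bot, LinearEquiv.map_eq_zero_iff] at hmem
      exact hy0 (congrArg Prod.fst hmem)
  · rintro (rfl | rfl)
    · exact family_isCoverOf hσ hz hσ.nm_map (fun b k hb hk => hσ.finrank_ker hb hk)
    · exact family_isCoverOf hσ hz hσ.nm_map₂ (fun b k hb hk => hσ.finrank_ker₂ hb hk)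

end Planes

/-! ### Coordinates over the cubic extension and transversal lines -/

section Transversals

variable {F K : Type*} [Field F] [Field K] [Algebra F K]

/-- The conjugate by `τ` of the first coordinate, as a functional over `K`. -/
def xc (Φ : BB F K ≃ₗ[F] BB F K) (τ : K →ₐ[F] K) : K ⊗[F] BB F K →ₗ[K] K :=
  LinearMap.liftBaseChange K (τ.toLinearMap ∘ₗ LinearMap.fst F K (K × F) ∘ₗ Φ.toLinearMap)

/-- The conjugate by `τ` of the second coordinate, as a functional over `K`. -/
def yc (Φ : BB F K ≃ₗ[F] BB F K) (τ : K →ₐ[F] K) : K ⊗[F] BB F K →ₗ[K] K :=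
  LinearMap.liftBaseChange K (τ.toLinearMap ∘ₗ LinearMap.fst F K F ∘ₗ LinearMap.snd F K (K × F)
    ∘ₗ Φ.toLinearMap)

/-- The third coordinate, as a functional over `K`. -/
def zc (Φ : BB F K ≃ₗ[F] BB F K) : K ⊗[F] BB F K →ₗ[K] K :=
  LinearMap.liftBaseChange K (Algebra.linearMap F K ∘ₗ LinearMap.snd F K F ∘ₗ
    LinearMap.snd F K (K × F) ∘ₗ Φ.toLinearMap)

variable {Φ : BB F K ≃ₗ[F] BB F K} {σ : K →ₐ[F] K}

@[simp] theorem xc_tmul (τ : K →ₐ[F] K) (a : K) (v : BB F K) :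
    xc Φ τ (a ⊗ₜ v) = a * τ (Φ v).1 := by simp [xc]

@[simp] theorem yc_tmul (τ : K →ₐ[F] K) (a : K) (v : BB F K) :
    yc Φ τ (a ⊗ₜ v) = a * τ (Φ v).2.1 := by simp [yc]

@[simp] theorem zc_tmul (a : K) (v : BB F K) :
    zc Φ (a ⊗ₜ v) = a * algebraMap F K (Φ v).2.2 := by simp [zc]

/-- The line of the cubic extension of the hyperplane at infinity on which only the coordinates
conjugate by `τ` do not vanish. -/
def transLine (σ : K →ₐ[F] K) (Φ : BB F K ≃ₗ[F] BB F K) (τ : K →ₐ[F] K) :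
    Submodule K (K ⊗[F] BB F K) where
  carrier := {w | zc Φ w = 0 ∧ (xc Φ (σ.comp τ) w = 0 ∧ xc Φ (σ.comp (σ.comp τ)) w = 0) ∧
    yc Φ (σ.comp τ) w = 0 ∧ yc Φ (σ.comp (σ.comp τ)) w = 0}
  add_mem' := by
    rintro v w ⟨h1, ⟨h2, h3⟩, h4, h5⟩ ⟨h1', ⟨h2', h3'⟩, h4', h5'⟩
    simp [*]
  zero_mem' := by simp
  smul_mem' := by
    rintro a v ⟨h1, ⟨h2, h3⟩, h4, h5⟩
    simp [*]

theorem IsFrob.vandermonde_eq_zero (hσ : IsFrob σ) {r : K} (hr : σ r ≠ r) {a b c : K}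
    (h0 : a + b * r + c * r ^ 2 = 0) (h1 : a + b * σ r + c * (σ r) ^ 2 = 0)
    (h2 : a + b * σ (σ r) + c * (σ (σ r)) ^ 2 = 0) : a = 0 ∧ b = 0 ∧ c = 0 := by
  have d1 := sub_ne_zero.2 hr
  have d2 := sub_ne_zero.2 (hσ.ne₂ hr)
  have d3 := sub_ne_zero.2 (hσ.ne₁₂ hr)
  have e1 : b + c * (σ r + r) = 0 := mul_left_cancel₀ d1 (by linear_combination h1 - h0)
  have e2 : b + c * (σ (σ r) + r) = 0 := mul_left_cancel₀ d2 (by linear_combination h2 - h0)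
  have e3 : c = 0 := mul_left_cancel₀ d3 (by linear_combination e2 - e1)
  have e4 : b = 0 := by linear_combination e1 - (σ r + r) * e3
  exact ⟨by linear_combination h0 - r * e4 - r ^ 2 * e3, e4, e3⟩

/-- These are the coefficients of the Lagrange polynomial with value 1 at r and 0 at the other
conjugates. As weights on 1, r, r² they isolate a single conjugate coordinate. -/
theorem IsFrob.exists_lagrange (hσ : IsFrob σ) {r : K} (hr : σ r ≠ r) :
    ∃ a b c : K, a + b * r + c * r ^ 2 = 1 ∧ a + b * σ r + c * (σ r) ^ 2 = 0 ∧
      a + b * σ (σ r) + c * (σ (σ r)) ^ 2 = 0 := by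
  have d1 : r - σ r ≠ 0 := sub_ne_zero.2 hr.symm
  have d2 : r - σ (σ r) ≠ 0 := sub_ne_zero.2 (hσ.ne₂ hr).symm
  have hD := mul_ne_zero d1 d2
  refine ⟨σ r * σ (σ r) / ((r - σ r) * (r - σ (σ r))),
    -(σ r + σ (σ r)) / ((r - σ r) * (r - σ (σ r))), 1 / ((r - σ r) * (r - σ (σ r))), ?_, ?_, ?_⟩
  · field_simp; ring
  · field_simp; ring
  · field_simp; ring

/-- The coordinates over `K` determine a vector. -/
theorem IsFrob.eq_zero_of_coords (hσ : IsFrob σ) {w : K ⊗[F] BB F K} (hz : zc Φ w = 0)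
    (hx0 : xc Φ (AlgHom.id F K) w = 0) (hx1 : xc Φ σ w = 0) (hx2 : xc Φ (σ.comp σ) w = 0)
    (hy0 : yc Φ (AlgHom.id F K) w = 0) (hy1 : yc Φ σ w = 0) (hy2 : yc Φ (σ.comp σ) w = 0) :
    w = 0 := by
  obtain ⟨r, hr⟩ := hσ.exists_ne
  -- The powers 1, r, r² in the first two coordinates, together with the third coordinate, give
  -- seven spanning vectors. On them the seven functionals form two Vandermonde blocks and an entry
  -- 1.
  have key : ∀ w : K ⊗[F] BB F K, ∃ a b c a' b' c' d : K,
      w = a ⊗ₜ Φ.symm (1, 0, 0) + b ⊗ₜ Φ.symm (r, 0, 0) + c ⊗ₜ Φ.symm (r ^ 2, 0, 0)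
        + a' ⊗ₜ Φ.symm (0, 1, 0) + b' ⊗ₜ Φ.symm (0, r, 0) + c' ⊗ₜ Φ.symm (0, r ^ 2, 0)
        + d ⊗ₜ Φ.symm (0, 0, 1) := by
    intro w
    induction w using TensorProduct.induction_on with
    | zero => exact ⟨0, 0, 0, 0, 0, 0, 0, by simp⟩
    | tmul k v =>
      obtain ⟨⟨x, y, z⟩, rfl⟩ := Φ.symm.surjective v
      obtain ⟨s, t, m, rfl⟩ := hσ.exists_coords hr x
      obtain ⟨s', t', m', rfl⟩ := hσ.exists_coords hr y
      refine ⟨s • k, t • k, m • k, s' • k, t' • k, m' • k, z • k, ?_⟩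
      simp only [TensorProduct.smul_tmul, ← TensorProduct.tmul_add, ← map_smul, ← map_add]
      simp [Algebra.smul_def]
    | add w w' hw hw' =>
      obtain ⟨a, b, c, a', b', c', d, rfl⟩ := hw
      obtain ⟨a₁, b₁, c₁, a₁', b₁', c₁', d₁, rfl⟩ := hw'
      refine ⟨a + a₁, b + b₁, c + c₁, a' + a₁', b' + b₁', c' + c₁', d + d₁, ?_⟩
      simp only [TensorProduct.add_tmul]
      abel
  obtain ⟨a, b, c, a', b', c', d, rfl⟩ := key w
  simp only [map_add, xc_tmul, yc_tmul, zc_tmul, LinearEquiv.apply_symm_apply, map_zero, map_one,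
    map_pow, mul_zero, add_zero, zero_add, mul_one, AlgHom.id_apply, AlgHom.comp_apply]
    at hz hx0 hx1 hx2 hy0 hy1 hy2
  obtain ⟨rfl, rfl, rfl⟩ := hσ.vandermonde_eq_zero hr hx0 hx1 hx2
  obtain ⟨rfl, rfl, rfl⟩ := hσ.vandermonde_eq_zero hr hy0 hy1 hy2
  simp [hz]

/-- A variant of `IsFrob.eq_zero_of_coords` for points of the transversal lines. -/
theorem IsFrob.eq_zero_of_mem_transLine (hσ : IsFrob σ) {τ : K →ₐ[F] K}
    (hτ : τ = AlgHom.id F K ∨ τ = σ ∨ τ = σ.comp σ) {w : K ⊗[F] BB F K}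
    (hw : w ∈ transLine σ Φ τ) (hx : xc Φ τ w = 0) (hy : yc Φ τ w = 0) : w = 0 := by
  obtain ⟨h1, ⟨h2, h3⟩, h4, h5⟩ := hw
  have c3 : σ.comp (σ.comp σ) = AlgHom.id F K := AlgHom.ext hσ.cube
  rcases hτ with rfl | rfl | rfl
  · exact hσ.eq_zero_of_coords h1 hx h2 h3 hy h4 h5
  · rw [c3] at h3 h5
    exact hσ.eq_zero_of_coords h1 h3 hx h2 h5 hy h4
  · rw [c3] at h2 h3 h4 h5
    exact hσ.eq_zero_of_coords h1 h2 h3 hx h4 h5 hy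

theorem IsFrob.finrank_transLine_le (hσ : IsFrob σ) {τ : K →ₐ[F] K}
    (hτ : τ = AlgHom.id F K ∨ τ = σ ∨ τ = σ.comp σ) :
    Module.finrank K (transLine σ Φ τ) ≤ 2 := by
  have hinj : Function.Injective (((xc Φ τ).prod (yc Φ τ)) ∘ₗ (transLine σ Φ τ).subtype) := by
    rw [injective_iff_map_eq_zero]
    rintro ⟨w, hw⟩ h
    apply Subtype.ext
    exact hσ.eq_zero_of_mem_transLine hτ hw (congrArg Prod.fst h) (congrArg Prod.snd h)
  refine (LinearMap.finrank_le_finrank_of_injective hinj).trans ?_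
  simp

/-- The vectors `Φ⁻¹(a x, b x, 0)` yield a vector over `K` of the first transversal line. -/
theorem IsFrob.exists_mem_transLine (hσ : IsFrob σ) (a b : K) {α : Submodule F (BB F K)}
    (hα : ∀ x, Φ.symm (a * x, b * x, 0) ∈ α) :
    ∃ w ∈ transLine σ Φ (AlgHom.id F K), w ∈ α.baseChange K ∧
      xc Φ (AlgHom.id F K) w = a ∧ yc Φ (AlgHom.id F K) w = b := by
  obtain ⟨r, hr⟩ := hσ.exists_ne
  obtain ⟨l, m, n, h0, h1, h2⟩ := hσ.exists_lagrange hr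
  -- The coordinates conjugate by `σ` and `σ²` carry the factors l + mσ(r) + nσ(r)² and l + mσ²(r) +
  -- nσ²(r)², which vanish; the unconjugated factor is 1.
  refine ⟨l ⊗ₜ Φ.symm (a * 1, b * 1, 0) + m ⊗ₜ Φ.symm (a * r, b * r, 0)
    + n ⊗ₜ Φ.symm (a * r ^ 2, b * r ^ 2, 0), ?_, ?_, ?_, ?_⟩
  · refine ⟨?_, ⟨?_, ?_⟩, ?_, ?_⟩
    · simp
    · simp
      linear_combination σ a * h1
    · simp
      linear_combination σ (σ a) * h2
    · simp
      linear_combination σ b * h1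
    · simp
      linear_combination σ (σ b) * h2
  · exact add_mem (add_mem (Submodule.tmul_mem_baseChange_of_mem _ (hα _))
      (Submodule.tmul_mem_baseChange_of_mem _ (hα _))) (Submodule.tmul_mem_baseChange_of_mem _ (hα _))
  · simp
    linear_combination a * h0
  · simp
    linear_combination b * h0

theorem IsFrob.transLine_id (hσ : IsFrob σ) (hz : ∀ v, (Φ v).2.2 = v.2.2) :
    transLine σ Φ (AlgHom.id F K) ≤ (SigmaInf F K).baseChange K ∧
      Module.finrank K (transLine σ Φ (AlgHom.id F K)) = 2 := by
  have hmem : ∀ a b x : K, Φ.symm (a * x, b * x, 0) ∈ SigmaInf F K := by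
    intro a b x
    rw [mem_SigmaInf, ← hz]
    simp
  have hex : ∀ a b, ∃ w ∈ transLine σ Φ (AlgHom.id F K), w ∈ (SigmaInf F K).baseChange K ∧
      xc Φ (AlgHom.id F K) w = a ∧ yc Φ (AlgHom.id F K) w = b := fun a b =>
    hσ.exists_mem_transLine a b (hmem a b)
  constructor
  · intro w hw
    obtain ⟨w', h1, h2, h3, h4⟩ := hex (xc Φ (AlgHom.id F K) w) (yc Φ (AlgHom.id F K) w)
    have : w - w' = 0 := by
      refine hσ.eq_zero_of_mem_transLine (Or.inl rfl) (Submodule.sub_mem _ hw h1) ?_ ?_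
      · rw [map_sub, h3, sub_self]
      · rw [map_sub, h4, sub_self]
    rwa [sub_eq_zero.1 this]
  · have hbij : Function.Bijective (((xc Φ (AlgHom.id F K)).prod (yc Φ (AlgHom.id F K))) ∘ₗ
        (transLine σ Φ (AlgHom.id F K)).subtype) := by
      constructor
      · rw [injective_iff_map_eq_zero]
        rintro ⟨w, hw⟩ h
        apply Subtype.ext
        exact hσ.eq_zero_of_mem_transLine (Or.inl rfl) hw (congrArg Prod.fst h)
          (congrArg Prod.snd h)
      · rintro ⟨a, b⟩
        obtain ⟨w, h1, -, h3, h4⟩ := hex a b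
        exact ⟨⟨w, h1⟩, Prod.ext h3 h4⟩
    rw [(LinearEquiv.ofBijective _ hbij).finrank_eq]
    simp

theorem IsFrob.isTransversal_transLine (hσ : IsFrob σ) (hz : ∀ v, (Φ v).2.2 = v.2.2)
    {X : Set (Submodule F (BB F K))}
    (hX : ∀ α ∈ X, ∃ a b : K, (a ≠ 0 ∨ b ≠ 0) ∧ ∀ x, Φ.symm (a * x, b * x, 0) ∈ α) :
    IsTransversal X (transLine σ Φ (AlgHom.id F K)) := by
  refine ⟨(hσ.transLine_id hz).1, (hσ.transLine_id hz).2, fun α hα => ?_⟩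
  obtain ⟨a, b, hab, h⟩ := hX α hα
  obtain ⟨w, h1, h2, h3, h4⟩ := hσ.exists_mem_transLine a b h
  rw [Submodule.ne_bot_iff]
  refine ⟨w, ⟨h1, h2⟩, ?_⟩
  rintro rfl
  rw [map_zero] at h3 h4
  rcases hab with h | h
  · exact h h3.symm
  · exact h h4.symm

theorem coords_of_mem_baseChange {k : K} {w : K ⊗[F] BB F K}
    (hw : w ∈ (graphPlane Φ (k • LinearMap.id)).baseChange K) (τ : K →ₐ[F] K) :
    yc Φ τ w = τ k * xc Φ τ w ∧ zc Φ w = 0 := by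
  have h1 : (graphPlane Φ (k • LinearMap.id)).baseChange K
      ≤ LinearMap.ker (yc Φ τ - τ k • xc Φ τ) := by
    rw [Submodule.baseChange_eq_span, Submodule.span_le]
    rintro _ ⟨v, ⟨h, -⟩, rfl⟩
    simp only [LinearMap.smul_apply, LinearMap.id_apply, smul_eq_mul] at h
    simp [h]
  have h2 : (graphPlane Φ (k • LinearMap.id)).baseChange K ≤ LinearMap.ker (zc Φ) := by
    rw [Submodule.baseChange_eq_span, Submodule.span_le]
    rintro _ ⟨v, ⟨-, h⟩, rfl⟩
    simp [h]
  have e := h1 hw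
  rw [LinearMap.mem_ker, LinearMap.sub_apply, sub_eq_zero] at e
  exact ⟨e, h2 hw⟩

/-- The elements k = -σ(x)/x have norm -1, so the hypothesis is a polynomial identity in t = σ(x)/x
with exponents 0, 1, q, q + 1. The top coefficient gives A = B, and that of t^q then gives A(κ - l)
= 0. -/
theorem IsFrob.cross_ratio_vanish (hσ : IsFrob σ) {A B κ l : K} (hne : κ ≠ l)
    (h : ∀ k, nm σ k = -1 → A * ((k - κ) * (σ k - σ l)) = B * ((σ k - σ κ) * (k - l))) :
    A = 0 ∧ B = 0 := by
  have h2 := hσ.two_le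
  have key : (Polynomial.C (A * (κ * σ l) - B * (σ κ * l))
      + Polynomial.C (A * σ l - B * σ κ) * Polynomial.X
      + Polynomial.C (A * κ - B * l) * Polynomial.X ^ Nat.card F
      + Polynomial.C (A - B) * Polynomial.X ^ (Nat.card F + 1) : Polynomial K) = 0 := by
    apply hσ.poly_eq_zero
    · compute_degree
      omega
    · intro x hx
      have hs : σ x ≠ 0 := by simpa using hx
      have hss : σ (σ x) ≠ 0 := by simpa using hx
      have h1 := h (-(σ x / x)) (by
        simp only [nm, map_neg, map_div₀, hσ.cube]; field_simp)
      have hp : (σ x / x) ^ Nat.card F = σ (σ x / x) := (hσ.pow _).symm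
      simp only [Polynomial.eval_add, Polynomial.eval_mul, Polynomial.eval_C, Polynomial.eval_X,
        Polynomial.eval_pow, pow_succ, hp]
      simp only [map_neg] at h1
      linear_combination h1
  have h0 := congrArg (fun p => Polynomial.coeff p (Nat.card F)) key
  have h1 := congrArg (fun p => Polynomial.coeff p (Nat.card F + 1)) key
  have hq0 : Nat.card F ≠ 0 := by omega
  have hq1 : 1 ≠ Nat.card F := by omega
  simp [Polynomial.coeff_C, Polynomial.coeff_X, Polynomial.coeff_X_pow, hq0, hq1, -map_sub,
    -map_mul] at h0 h1
  have hAB : A = B := by linear_combination h1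
  subst hAB
  have : A * (κ - l) = 0 := by linear_combination h0
  have hA := (mul_eq_zero.1 this).resolve_right (sub_ne_zero.2 hne)
  exact ⟨hA, hA⟩

/-- The splash `y = k x` has no transversal lines but the three obvious ones. -/
theorem IsFrob.eq_transLine (hσ : IsFrob σ) {X : Set (Submodule F (BB F K))}
    (hX : family σ Φ LinearMap.id ⊆ X) {g : Submodule K (K ⊗[F] BB F K)}
    (hg : IsTransversal X g) :
    ∃ τ : K →ₐ[F] K, (τ = AlgHom.id F K ∨ τ = σ ∨ τ = σ.comp σ) ∧ g = transLine σ Φ τ := by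
  obtain ⟨-, hg2, hg3⟩ := hg
  have c3 : σ.comp (σ.comp σ) = AlgHom.id F K := AlgHom.ext hσ.cube
  have hpt : ∀ k, nm σ k = -1 → ∃ w ∈ g, w ≠ 0 ∧
      w ∈ (graphPlane Φ (k • LinearMap.id)).baseChange K := by
    intro k hk
    obtain ⟨w, ⟨h1, h2⟩, h3⟩ := (Submodule.ne_bot_iff _).1 (hg3 _ (hX ⟨k, hk, rfl⟩))
    exact ⟨w, h1, h3, h2⟩
  obtain ⟨r, hr⟩ := hσ.exists_ne
  have hr0 : r ≠ 0 := by rintro rfl; simp at hr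
  have hs0 : σ r ≠ 0 := by simpa using hr0
  have hss0 : σ (σ r) ≠ 0 := by simpa using hr0
  -- Two distinct elements of norm -1 provide two planes of the splash; the points in which `g`
  -- meets their extensions span `g`.
  obtain ⟨κ, hκ⟩ : ∃ κ : K, κ = -1 := ⟨_, rfl⟩
  obtain ⟨l, hl⟩ : ∃ l : K, l = -(σ r / r) := ⟨_, rfl⟩
  have hκn : nm σ κ = -1 := by rw [hκ]; simp [nm]
  have hln : nm σ l = -1 := by
    rw [hl]; simp only [nm, map_neg, map_div₀, hσ.cube]; field_simp
  have hne : κ ≠ l := by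
    rw [hκ, hl]
    intro h
    rw [neg_inj, eq_comm, div_eq_one_iff_eq hr0] at h
    exact hr h
  obtain ⟨p, hpg, hp0, hp⟩ := hpt κ hκn
  obtain ⟨p', hpg', hp0', hp'⟩ := hpt l hln
  have hp_zero : ∀ {k : K} {w : K ⊗[F] BB F K},
      w ∈ (graphPlane Φ (k • LinearMap.id)).baseChange K → xc Φ (AlgHom.id F K) w = 0 →
      xc Φ σ w = 0 → xc Φ (σ.comp σ) w = 0 → w = 0 := by
    intro k w hw h0 h1 h2
    have e0 := (coords_of_mem_baseChange hw (AlgHom.id F K)).1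
    have e1 := (coords_of_mem_baseChange hw σ).1
    have e2 := (coords_of_mem_baseChange hw (σ.comp σ)).1
    rw [h0, mul_zero] at e0
    rw [h1, mul_zero] at e1
    rw [h2, mul_zero] at e2
    exact hσ.eq_zero_of_coords (coords_of_mem_baseChange hw σ).2 h0 h1 h2 e0 e1 e2
  have hind : ∀ s t : K, s • p + t • p' = 0 → s = 0 ∧ t = 0 := by
    intro s t hst
    have hτ : ∀ τ : K →ₐ[F] K, s * xc Φ τ p = 0 := by
      intro τ
      have hx := congrArg (xc Φ τ) hst
      have hy := congrArg (yc Φ τ) hst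
      simp only [map_add, map_smul, smul_eq_mul, map_zero, (coords_of_mem_baseChange hp τ).1,
        (coords_of_mem_baseChange hp' τ).1] at hx hy
      have hd : τ κ - τ l ≠ 0 := sub_ne_zero.2 fun h => hne (τ.toRingHom.injective h)
      exact mul_left_cancel₀ hd (by linear_combination hy - τ l * hx)
    have hs : s = 0 := by
      by_contra hs
      exact hp0 (hp_zero hp ((mul_eq_zero.1 (hτ _)).resolve_left hs)
        ((mul_eq_zero.1 (hτ _)).resolve_left hs) ((mul_eq_zero.1 (hτ _)).resolve_left hs))
    refine ⟨hs, ?_⟩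
    rw [hs, zero_smul, zero_add] at hst
    exact (smul_eq_zero.1 hst).resolve_right hp0'
  have hfin0 : Module.Finite K (K ⊗[F] BB F K) := by
    have : Module.Finite F K := Module.finite_of_finrank_pos (by rw [hσ.finrank_eq]; omega)
    infer_instance
  have hfin : Module.Finite K g := inferInstance
  have hspan : Submodule.span K {p, p'} = g := by
    apply Submodule.eq_of_le_of_finrank_le
    · rw [Submodule.span_le]
      rintro w (rfl | rfl) <;> assumption
    · rw [hg2]
      have hli : LinearIndependent K ![p, p'] := LinearIndependent.pair_iff.2 hind
      have := finrank_span_eq_card hli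
      rw [Matrix.range_cons_cons_empty] at this
      rw [this]
      simp
  -- The point of `g` in the plane y = kx is s p + t p'. Each conjugate of the equation of this
  -- plane is a linear relation between s and t, and two such relations are compatible only if their
  -- determinant vanishes.
  have hcross : ∀ k, nm σ k = -1 → ∀ τ τ' : K →ₐ[F] K,
      (xc Φ τ p * xc Φ τ' p') * ((τ k - τ κ) * (τ' k - τ' l))
        = (xc Φ τ' p * xc Φ τ p') * ((τ' k - τ' κ) * (τ k - τ l)) := by
    intro k hk τ τ'
    obtain ⟨w, hwg, hw0, hw⟩ := hpt k hk
    rw [← hspan] at hwg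
    obtain ⟨s, t, rfl⟩ := Submodule.mem_span_pair.1 hwg
    have e : ∀ τ : K →ₐ[F] K,
        s * xc Φ τ p * (τ k - τ κ) + t * xc Φ τ p' * (τ k - τ l) = 0 := by
      intro τ
      have := (coords_of_mem_baseChange hw τ).1
      simp only [map_add, map_smul, smul_eq_mul, (coords_of_mem_baseChange hp τ).1,
        (coords_of_mem_baseChange hp' τ).1] at this
      linear_combination -this
    have hst : s ≠ 0 ∨ t ≠ 0 := by
      by_contra! h
      exact hw0 (by rw [h.1, h.2, zero_smul, zero_smul, add_zero])
    rcases hst with h | h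
    · exact mul_left_cancel₀ h (by
        linear_combination xc Φ τ' p' * (τ' k - τ' l) * e τ - xc Φ τ p' * (τ k - τ l) * e τ')
    · exact mul_left_cancel₀ h (by
        linear_combination xc Φ τ p * (τ k - τ κ) * e τ' - xc Φ τ' p * (τ' k - τ' κ) * e τ)
  have hp2 : ∀ x, σ (σ (σ x)) = x := hσ.cube
  -- Letting k vary, all products of a coordinate of p with a different conjugate coordinate of p'
  -- vanish. Both points then have just one nonzero conjugate x-coordinate, the same for both.
  -- Replacing k by a conjugate reduces the other pairs of conjugates to the first.
  obtain ⟨a01, a10⟩ := hσ.cross_ratio_vanish hne (fun k hk => hcross k hk (AlgHom.id F K) σ)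
  obtain ⟨a12, a21⟩ := hσ.cross_ratio_vanish (κ := σ κ) (l := σ l)
    (fun h => hne (hσ.injective h)) (A := xc Φ σ p * xc Φ (σ.comp σ) p')
    (B := xc Φ (σ.comp σ) p * xc Φ σ p') (fun k hk => by
      have := hcross (σ (σ k)) (by rw [hσ.nm_map, hσ.nm_map, hk]) σ (σ.comp σ)
      simpa only [AlgHom.comp_apply, hσ.cube] using this)
  obtain ⟨a20, a02⟩ := hσ.cross_ratio_vanish (κ := σ (σ κ)) (l := σ (σ l))
    (fun h => hne (hσ.injective (hσ.injective h)))
    (A := xc Φ (σ.comp σ) p * xc Φ (AlgHom.id F K) p')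
    (B := xc Φ (AlgHom.id F K) p * xc Φ (σ.comp σ) p') (fun k hk => by
      have := hcross (σ k) (by rw [hσ.nm_map, hk]) (σ.comp σ) (AlgHom.id F K)
      simpa only [AlgHom.comp_apply, AlgHom.id_apply, hσ.cube] using this)
  have hmem : ∀ {k : K} {w : K ⊗[F] BB F K} (τ : K →ₐ[F] K),
      w ∈ (graphPlane Φ (k • LinearMap.id)).baseChange K → xc Φ (σ.comp τ) w = 0 →
      xc Φ (σ.comp (σ.comp τ)) w = 0 → w ∈ transLine σ Φ τ := by
    intro k w τ hw h1 h2
    refine ⟨(coords_of_mem_baseChange hw σ).2, ⟨h1, h2⟩, ?_, ?_⟩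
    · rw [(coords_of_mem_baseChange hw _).1, h1, mul_zero]
    · rw [(coords_of_mem_baseChange hw _).1, h2, mul_zero]
  have fin : ∀ τ : K →ₐ[F] K, (τ = AlgHom.id F K ∨ τ = σ ∨ τ = σ.comp σ) →
      p ∈ transLine σ Φ τ → p' ∈ transLine σ Φ τ → ∃ τ : K →ₐ[F] K,
        (τ = AlgHom.id F K ∨ τ = σ ∨ τ = σ.comp σ) ∧ g = transLine σ Φ τ := by
    intro τ hτ h h'
    refine ⟨τ, hτ, ?_⟩
    have hle : g ≤ transLine σ Φ τ := by
      rw [← hspan, Submodule.span_le]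
      rintro w (rfl | rfl) <;> assumption
    exact Submodule.eq_of_le_of_finrank_le hle (by rw [hg2]; exact hσ.finrank_transLine_le hτ)
  by_cases h0 : xc Φ (AlgHom.id F K) p = 0
  · by_cases h1 : xc Φ σ p = 0
    · have h2 : xc Φ (σ.comp σ) p ≠ 0 := fun h2 => hp0 (hp_zero hp h0 h1 h2)
      have b0 := (mul_eq_zero.1 a20).resolve_left h2
      have b1 := (mul_eq_zero.1 a21).resolve_left h2
      refine fin (σ.comp σ) (Or.inr (Or.inr rfl)) ?_ ?_
      · exact hmem _ hp (by rwa [c3]) (by rw [c3]; exact h1)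
      · exact hmem _ hp' (by rwa [c3]) (by rw [c3]; exact b1)
    · have b0 := (mul_eq_zero.1 a10).resolve_left h1
      have b2 := (mul_eq_zero.1 a12).resolve_left h1
      have b1 : xc Φ σ p' ≠ 0 := fun b1 => hp0' (hp_zero hp' b0 b1 b2)
      have h2 := (mul_eq_zero.1 a21).resolve_right b1
      refine fin σ (Or.inr (Or.inl rfl)) ?_ ?_
      · exact hmem _ hp h2 (by rwa [c3])
      · exact hmem _ hp' b2 (by rwa [c3])
  · have b1 := (mul_eq_zero.1 a01).resolve_left h0
    have b2 := (mul_eq_zero.1 a02).resolve_left h0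
    have b0 : xc Φ (AlgHom.id F K) p' ≠ 0 := fun b0 => hp0' (hp_zero hp' b0 b1 b2)
    have h1 := (mul_eq_zero.1 a10).resolve_right b0
    have h2 := (mul_eq_zero.1 a20).resolve_right b0
    exact fin _ (Or.inl rfl) (hmem _ hp h1 h2) (hmem _ hp' b1 b2)

end Transversals

/-! ### Twisted cubics of the lines of a subplane -/

section LineCubics

variable {F K : Type*} [Field F] [Field K] [Algebra F K]

theorem affVec_ne_zero (σ : K →ₐ[F] K) (Φ : BB F K ≃ₗ[F] BB F K) (u : K) :
    Φ.symm (σ u / u, σ (σ u) / u, 1) ≠ 0 := by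
  rw [ne_eq, LinearEquiv.map_eq_zero_iff]
  intro h
  exact one_ne_zero (congrArg (fun v : BB F K => v.2.2) h)

/-- The affine point `(σ u / u, σ² u / u, 1)` in the coordinates `Φ`. -/
def affPt (σ : K →ₐ[F] K) (Φ : BB F K ≃ₗ[F] BB F K) (u : K) : Projectivization F (BB F K) :=
  Projectivization.mk F (Φ.symm (σ u / u, σ (σ u) / u, 1)) (affVec_ne_zero σ Φ u)

/-- The nonzero vectors of the `F`-space spanned by `v` and `w`. -/
def lineSet (F : Type*) {K : Type*} [Field F] [Field K] [Algebra F K] (v w : K) : Set K :=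
  {u | u ≠ 0 ∧ ∃ s t : F, u = algebraMap F K s * v + algebraMap F K t * w}

/-- The tangent at the point of parameter `v` of the line spanned by `v` and `w`. -/
def tanLine (σ : K →ₐ[F] K) (Φ : BB F K ≃ₗ[F] BB F K) (v w : K) : Submodule F (BB F K) :=
  Submodule.span F {Φ.symm (σ v / v, σ (σ v) / v, 1),
    -- This is the derivative at t = 0 of the affine point of parameter v + tw, for t in `F`.
    Φ.symm ((σ w * v - σ v * w) / v ^ 2, (σ (σ w) * v - σ (σ v) * w) / v ^ 2, 0)}

variable {Φ : BB F K ≃ₗ[F] BB F K} {σ : K →ₐ[F] K}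

theorem smul_eq_algebraMap_mul (a : F) (x : K) : a • x = algebraMap F K a * x :=
  Algebra.smul_def a x

theorem mk_eq_affPt_iff {v : BB F K} (hv : v ≠ 0) {u : K} :
    Projectivization.mk F v hv = affPt σ Φ u ↔
      (Φ v).1 = algebraMap F K (Φ v).2.2 * (σ u / u) ∧
        (Φ v).2.1 = algebraMap F K (Φ v).2.2 * (σ (σ u) / u) := by
  rw [affPt, Projectivization.mk_eq_mk_iff']
  constructor
  · rintro ⟨a, rfl⟩
    simp [smul_eq_algebraMap_mul]
  · rintro ⟨h1, h2⟩
    refine ⟨(Φ v).2.2, Φ.injective ?_⟩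
    rw [map_smul, LinearEquiv.apply_symm_apply]
    refine Prod.ext ?_ (Prod.ext ?_ ?_)
    · simp [h1, smul_eq_algebraMap_mul]
    · simp [h2, smul_eq_algebraMap_mul]
    · simp

/-- A binary cubic form with two given roots. -/
theorem cubic_factor {a₀ a₁ a₂ a₃ ρ ρ' : K} (hne : ρ ≠ ρ')
    (h : a₀ * (-ρ) ^ 3 + a₁ * (-ρ) ^ 2 + a₂ * (-ρ) + a₃ = 0)
    (h' : a₀ * (-ρ') ^ 3 + a₁ * (-ρ') ^ 2 + a₂ * (-ρ') + a₃ = 0) :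
    a₂ = (a₁ - a₀ * (ρ + ρ')) * (ρ + ρ') + a₀ * (ρ * ρ') ∧
      a₃ = (a₁ - a₀ * (ρ + ρ')) * (ρ * ρ') := by
  have h2 : a₂ = (a₁ - a₀ * (ρ + ρ')) * (ρ + ρ') + a₀ * (ρ * ρ') :=
    mul_left_cancel₀ (sub_ne_zero.2 hne) (by linear_combination h' - h)
  subst h2
  exact ⟨rfl, by linear_combination h⟩

theorem TwistedCubic.coeff_not_proportional (N : TwistedCubic F (BB F K)) (a : F) :
    N.coeff 1 ≠ a • N.coeff 0 := by
  intro h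
  have := Fintype.linearIndependent_iff.1 N.linInd ![a, -1, 0, 0]
    (by simp [Fin.sum_univ_four, h]) 1
  simp at this

/-- The factorization of a special twisted cubic in the coordinates over `K`. -/
theorem IsFrob.exists_factorization (hσ : IsFrob σ) (hz : ∀ v, (Φ v).2.2 = v.2.2)
    {N : TwistedCubic F (BB F K)} (hN : ¬ N.space ≤ SigmaInf F K)
    (hpt : ∃ p ∈ (N.extension K).points, p.submodule ≤ transLine σ Φ (AlgHom.id F K)) :
    ∃ (ρ l₀ l₁ m₀ m₁ ζ : K), σ ρ ≠ ρ ∧ ζ ≠ 0 ∧ (l₁ ≠ l₀ * ρ ∨ m₁ ≠ m₀ * ρ) ∧ 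
      ((Φ (N.coeff 0)).1 = ζ * l₀ ∧ (Φ (N.coeff 1)).1 = ζ * (l₁ + l₀ * (σ ρ + σ (σ ρ))) ∧
        (Φ (N.coeff 2)).1 = ζ * (l₁ * (σ ρ + σ (σ ρ)) + l₀ * (σ ρ * σ (σ ρ))) ∧
        (Φ (N.coeff 3)).1 = ζ * (l₁ * (σ ρ * σ (σ ρ)))) ∧
      ((Φ (N.coeff 0)).2.1 = ζ * m₀ ∧ (Φ (N.coeff 1)).2.1 = ζ * (m₁ + m₀ * (σ ρ + σ (σ ρ))) ∧
        (Φ (N.coeff 2)).2.1 = ζ * (m₁ * (σ ρ + σ (σ ρ)) + m₀ * (σ ρ * σ (σ ρ))) ∧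
        (Φ (N.coeff 3)).2.1 = ζ * (m₁ * (σ ρ * σ (σ ρ)))) ∧
      (algebraMap F K (Φ (N.coeff 0)).2.2 = ζ * 1 ∧ algebraMap F K (Φ (N.coeff 1)).2.2 = ζ * (ρ + 1 * (σ ρ + σ (σ ρ))) ∧
        algebraMap F K (Φ (N.coeff 2)).2.2 = ζ * (ρ * (σ ρ + σ (σ ρ)) + 1 * (σ ρ * σ (σ ρ))) ∧
        algebraMap F K (Φ (N.coeff 3)).2.2 = ζ * (ρ * (σ ρ * σ (σ ρ)))) := by
  obtain ⟨_, ⟨S, T, hST, rfl⟩, hp⟩ := hpt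
  rw [Projectivization.submodule_mk, Submodule.span_singleton_le_iff_mem] at hp
  obtain ⟨hpz, ⟨hpx1, hpx2⟩, hpy1, hpy2⟩ := hp
  simp only [TwistedCubic.param, TwistedCubic.extension, map_add, map_smul, smul_eq_mul, zc_tmul,
    xc_tmul, yc_tmul, one_mul, AlgHom.comp_apply, AlgHom.id_apply] at hpz hpx1 hpx2 hpy1 hpy2
  have hext : ∀ c : BB F K, (Φ c).1 = 0 → (Φ c).2.1 = 0 → (Φ c).2.2 = 0 → c = 0 := by
    intro c h1 h2 h3
    apply Φ.injective
    rw [map_zero]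
    exact Prod.ext h1 (Prod.ext h2 h3)
  have hT : T ≠ 0 := by
    rintro rfl
    have hS : S ≠ 0 := by
      rintro rfl
      exact hST (by simp [TwistedCubic.param])
    simp [hS] at hpz hpx1 hpy1
    exact N.linInd.ne_zero 0 (hext _ hpx1 hpy1 hpz)
  set ρ := -(S / T) with hρ
  have hS : S = -ρ * T := by rw [hρ]; field_simp
  have hT3 : T ^ 3 ≠ 0 := pow_ne_zero _ hT
  rw [hS] at hpz hpx1 hpx2 hpy1 hpy2
  have red : ∀ a₀ a₁ a₂ a₃ : K, (-ρ * T) ^ 3 * a₀ + (-ρ * T) ^ 2 * T * a₁ + (-ρ * T) * T ^ 2 * a₂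
      + T ^ 3 * a₃ = 0 → a₀ * (-ρ) ^ 3 + a₁ * (-ρ) ^ 2 + a₂ * (-ρ) + a₃ = 0 := by
    intro a₀ a₁ a₂ a₃ h
    exact mul_left_cancel₀ hT3 (by linear_combination h)
  replace hpz := red _ _ _ _ hpz
  replace hpx1 := red _ _ _ _ hpx1
  replace hpx2 := red _ _ _ _ hpx2
  replace hpy1 := red _ _ _ _ hpy1
  replace hpy2 := red _ _ _ _ hpy2
  -- Conjugating back, the cubic forms of the x- and y-coordinates vanish at (-σρ : 1) and (-σ²ρ :
  -- 1), and that of z at all three conjugates of (-ρ : 1).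
  have hx2 := congrArg (fun x => σ (σ x)) hpx1
  have hx1 := congrArg σ hpx2
  have hy2 := congrArg (fun x => σ (σ x)) hpy1
  have hy1 := congrArg σ hpy2
  have hz1 := congrArg σ hpz
  have hz2 := congrArg σ hz1
  simp only [map_add, map_mul, map_pow, map_neg, hσ.cube, AlgHom.commutes, map_zero]
    at hx1 hx2 hy1 hy2 hz1 hz2
  -- If ρ were in `F`, all coordinates would vanish at one parameter over `F`, a dependence between
  -- the coefficients of the cubic.
  have hρF : σ ρ ≠ ρ := by
    intro h
    obtain ⟨b, hb⟩ := hσ.fixed ρ h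
    rw [h, ← hb] at hx1 hy1
    rw [← hb] at hpz
    have hvan : N.param (-b) 1 = 0 := by
      apply hext
      · simp only [TwistedCubic.param, map_add, map_smul, Prod.fst_add, Prod.smul_fst,
          smul_eq_algebraMap_mul, map_mul, map_pow, map_neg, map_one]
        linear_combination hx1
      · simp only [TwistedCubic.param, map_add, map_smul, Prod.fst_add, Prod.smul_fst,
          Prod.snd_add, Prod.smul_snd, smul_eq_algebraMap_mul, map_mul, map_pow, map_neg, map_one]
        linear_combination hy1
      · apply FaithfulSMul.algebraMap_injective F K
        simp only [TwistedCubic.param, map_add, map_smul,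
          Prod.snd_add, Prod.smul_snd, smul_eq_mul, map_mul, map_pow, map_neg, map_one, map_zero]
        linear_combination hpz
    have := Fintype.linearIndependent_iff.1 N.linInd
      ![(-b) ^ 3, (-b) ^ 2 * 1, (-b) * 1 ^ 2, 1 ^ 3]
      (by simpa [Fin.sum_univ_four, TwistedCubic.param] using hvan) 3
    simp at this
  have n01 : σ ρ ≠ σ (σ ρ) := (hσ.ne₁₂ hρF).symm
  obtain ⟨fx2, fx3⟩ := cubic_factor n01 hx1 hx2
  obtain ⟨fy2, fy3⟩ := cubic_factor n01 hy1 hy2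
  obtain ⟨fz2, fz3⟩ := cubic_factor n01 hz1 hz2
  set ζ := algebraMap F K (Φ (N.coeff 0)).2.2 with hζ
  have hz_lin : algebraMap F K (Φ (N.coeff 1)).2.2 - ζ * (σ ρ + σ (σ ρ)) = ζ * ρ := by
    have h1 : σ ρ - ρ ≠ 0 := sub_ne_zero.2 hρF
    have h2 : σ (σ ρ) - ρ ≠ 0 := sub_ne_zero.2 (hσ.ne₂ hρF)
    rw [fz2, fz3] at hpz
    exact mul_left_cancel₀ (mul_ne_zero h1 h2) (by linear_combination hpz)
  rw [hz_lin] at fz2 fz3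
  have hζ0 : ζ ≠ 0 := by
    intro h0
    apply hN
    rw [TwistedCubic.space, Submodule.span_le]
    have c0 : (Φ (N.coeff 0)).2.2 = 0 :=
      FaithfulSMul.algebraMap_injective F K (by rw [← hζ, h0, map_zero])
    have c1 : (Φ (N.coeff 1)).2.2 = 0 :=
      FaithfulSMul.algebraMap_injective F K (by
        rw [map_zero]; linear_combination hz_lin + (ρ + σ ρ + σ (σ ρ)) * h0)
    have c2 : (Φ (N.coeff 2)).2.2 = 0 :=
      FaithfulSMul.algebraMap_injective F K (by rw [fz2, h0, map_zero]; ring)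
    have c3 : (Φ (N.coeff 3)).2.2 = 0 :=
      FaithfulSMul.algebraMap_injective F K (by rw [fz3, h0, map_zero]; ring)
    rintro _ ⟨i, rfl⟩
    rw [SetLike.mem_coe, mem_SigmaInf, ← hz]
    fin_cases i <;> assumption
  refine ⟨ρ, (Φ (N.coeff 0)).1 / ζ,
    ((Φ (N.coeff 1)).1 - (Φ (N.coeff 0)).1 * (σ ρ + σ (σ ρ))) / ζ, (Φ (N.coeff 0)).2.1 / ζ,
    ((Φ (N.coeff 1)).2.1 - (Φ (N.coeff 0)).2.1 * (σ ρ + σ (σ ρ))) / ζ, ζ, hρF, hζ0, ?_, ?_⟩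
  -- If both linear factors were proportional to that of z, the second coefficient of the cubic
  -- would be the trace of ρ times the first.
  · by_contra! h
    obtain ⟨h1, h2⟩ := h
    obtain ⟨e, he⟩ := hσ.exists_tr ρ
    rw [tr] at he
    field_simp at h1 h2
    refine N.coeff_not_proportional e (Φ.injective ?_)
    rw [map_smul]
    refine Prod.ext ?_ (Prod.ext ?_ (FaithfulSMul.algebraMap_injective F K ?_))
    · rw [Prod.smul_fst, smul_eq_algebraMap_mul, he]
      linear_combination h1
    · rw [Prod.smul_snd, Prod.smul_fst, smul_eq_algebraMap_mul, he]
      linear_combination h2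
    · rw [Prod.smul_snd, Prod.smul_snd, smul_eq_mul, map_mul, he]
      linear_combination hz_lin
  · refine ⟨⟨?_, ?_, ?_, ?_⟩, ⟨?_, ?_, ?_, ?_⟩, ?_, ?_, ?_, ?_⟩
    · field_simp
    · field_simp; ring
    · rw [fx2]; field_simp
    · rw [fx3]; field_simp
    · field_simp
    · field_simp; ring
    · rw [fy2]; field_simp
    · rw [fy3]; field_simp
    · rw [mul_one]
    · linear_combination hz_lin
    · rw [fz2]; ring
    · rw [fz3]; ring

/-- Euler's relation and the chain rule for the tangent line. -/
theorem TwistedCubic.tangentLine_eq_span_pair {k V : Type*} [Field k] [AddCommGroup V] [Module k V]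
    (N : TwistedCubic k V) {s t s' t' : k} (h : s * t' - s' * t ≠ 0) :
    N.tangentLine s t = Submodule.span k {N.param s t,
      s' • ((3 * s ^ 2) • N.coeff 0 + (2 * s * t) • N.coeff 1 + t ^ 2 • N.coeff 2)
        + t' • (s ^ 2 • N.coeff 1 + (2 * s * t) • N.coeff 2 + (3 * t ^ 2) • N.coeff 3)} := by
  set A := (3 * s ^ 2) • N.coeff 0 + (2 * s * t) • N.coeff 1 + t ^ 2 • N.coeff 2 with hA
  set B := s ^ 2 • N.coeff 1 + (2 * s * t) • N.coeff 2 + (3 * t ^ 2) • N.coeff 3 with hB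
  have euler : s • A + t • B = (3 : k) • N.param s t := by
    rw [hA, hB, TwistedCubic.param]; module
  apply le_antisymm
  · rw [TwistedCubic.tangentLine, Submodule.span_le]
    have h1 : N.param s t ∈ Submodule.span k {N.param s t, s' • A + t' • B} :=
      Submodule.subset_span (by simp)
    have h2 : s' • A + t' • B ∈ Submodule.span k {N.param s t, s' • A + t' • B} :=
      Submodule.subset_span (by simp)
    rintro x (rfl | rfl | rfl)
    · exact h1
    · have : A = (s * t' - s' * t)⁻¹ • (t' • (3 : k) • N.param s t - t • (s' • A + t' • B)) := by
        rw [← euler, eq_inv_smul_iff₀ h]; module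
      have hmem := Submodule.smul_mem _ (s * t' - s' * t)⁻¹ (Submodule.sub_mem _
        (Submodule.smul_mem _ t' (Submodule.smul_mem _ (3 : k) h1)) (Submodule.smul_mem _ t h2))
      rw [← this] at hmem
      exact hmem
    · have : B = (s * t' - s' * t)⁻¹ • (s • (s' • A + t' • B) - s' • (3 : k) • N.param s t) := by
        rw [← euler, eq_inv_smul_iff₀ h]; module
      have hmem := Submodule.smul_mem _ (s * t' - s' * t)⁻¹ (Submodule.sub_mem _
        (Submodule.smul_mem _ s h2) (Submodule.smul_mem _ s' (Submodule.smul_mem _ (3 : k) h1)))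
      rw [← this] at hmem
      exact hmem
  · rw [Submodule.span_le]
    rintro x (rfl | rfl)
    · exact Submodule.subset_span (by simp)
    · refine add_mem (Submodule.smul_mem _ _ (Submodule.subset_span ?_))
        (Submodule.smul_mem _ _ (Submodule.subset_span ?_))
      · simp [hA]
      · simp [hB]

theorem span_pair_change {k V : Type*} [Field k] [AddCommGroup V] [Module k V] {p d p' d' : V}
    {a b c : k} (ha : a ≠ 0) (hc : c ≠ 0) (hp : p = a • p') (hd : d = b • p' + c • d') :
    Submodule.span k {p, d} = Submodule.span k {p', d'} := by
  subst hp hd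
  apply le_antisymm
  · rw [Submodule.span_le]
    rintro x (rfl | rfl)
    · exact Submodule.mem_span_pair.2 ⟨a, 0, by module⟩
    · exact Submodule.mem_span_pair.2 ⟨b, c, rfl⟩
  · rw [Submodule.span_le]
    rintro x (rfl | rfl)
    · exact Submodule.mem_span_pair.2 ⟨a⁻¹, 0, by rw [smul_smul, inv_mul_cancel₀ ha]; module⟩
    · refine Submodule.mem_span_pair.2 ⟨-(c⁻¹ * b * a⁻¹), c⁻¹, ?_⟩
      match_scalars <;> field_simp
      ring

/-- A component of the derivative of a factorized twisted cubic. -/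
theorem tangent_component {S T S' T' ζ ρ ρ₁ ρ₂ l₀ l₁ v v₁ w w₁ κ κ' c d d₃ E : K} (hv : v ≠ 0)
    (hE : E ≠ 0) (g1 : S + ρ * T = κ * v) (hl1 : l₀ * S + l₁ * T = κ * v₁)
    (g2 : S' + ρ * T' = κ' * (c * v + d * w)) (hl2 : l₀ * S' + l₁ * T' = κ' * (c * v₁ + d * w₁))
    (r5 : κ' * E = κ * d₃) :
    S' * (3 * S ^ 2 * (ζ * l₀) + 2 * S * T * (ζ * (l₁ + l₀ * (ρ₁ + ρ₂)))
        + T ^ 2 * (ζ * (l₁ * (ρ₁ + ρ₂) + l₀ * (ρ₁ * ρ₂))))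
      + T' * (S ^ 2 * (ζ * (l₁ + l₀ * (ρ₁ + ρ₂))) + 2 * S * T * (ζ * (l₁ * (ρ₁ + ρ₂)
        + l₀ * (ρ₁ * ρ₂))) + 3 * T ^ 2 * (ζ * (l₁ * (ρ₁ * ρ₂))))
    = (S' * (3 * S ^ 2 * ζ + 2 * S * T * (ζ * (ρ + (ρ₁ + ρ₂)))
        + T ^ 2 * (ζ * (ρ * (ρ₁ + ρ₂) + ρ₁ * ρ₂)))
      + T' * (S ^ 2 * (ζ * (ρ + (ρ₁ + ρ₂))) + 2 * S * T * (ζ * (ρ * (ρ₁ + ρ₂)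
        + ρ₁ * ρ₂)) + 3 * T ^ 2 * (ζ * (ρ * (ρ₁ * ρ₂))))) * (v₁ / v)
      + d₃ * d / E * (ζ * ((S + ρ * T) * (S + ρ₁ * T) * (S + ρ₂ * T)))
        * ((w₁ * v - v₁ * w) / v ^ 2) := by
  have hA : (l₀ * S + l₁ * T) * v = (S + ρ * T) * v₁ := by rw [g1, hl1]; ring
  have hB : ((l₀ * S' + l₁ * T') * v - (S' + ρ * T') * v₁) * E
      = κ * d₃ * d * (w₁ * v - v₁ * w) := by
    rw [g2, hl2]; linear_combination d * (w₁ * v - v₁ * w) * r5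
  have hR : ∀ x y z : K, x * (v * E * v) = y * v₁ * E * v + d₃ * d * z * (w₁ * v - v₁ * w) →
      x = y * (v₁ / v) + d₃ * d / E * z * ((w₁ * v - v₁ * w) / v ^ 2) := by
    intro x y z h
    field_simp
    linear_combination h
  apply hR
  -- The left side is the derivative of ζ(S + ρ₁T)(S + ρ₂T)(l₀S + l₁T) in the direction (S', T'). By
  -- the product rule it splits into the part treated by `hA` and the part treated by `hB`.
  linear_combination
    ζ * v * E * (((S' + ρ₁ * T') * (S + ρ₂ * T) + (S + ρ₁ * T) * (S' + ρ₂ * T'))) * hA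
    + ζ * v * ((S + ρ₁ * T) * (S + ρ₂ * T)) * hB
    - d₃ * d * ζ * (S + ρ₁ * T) * (S + ρ₂ * T) * (w₁ * v - v₁ * w) * g1

/-- The tangents of a special twisted cubic that consists of the points of a line of a subplane. -/
theorem IsFrob.isTangentAt_iff (hσ : IsFrob σ) (hz : ∀ v, (Φ v).2.2 = v.2.2)
    {N : TwistedCubic F (BB F K)} (hN : ¬ N.space ≤ SigmaInf F K)
    (hpt : ∃ p ∈ (N.extension K).points, p.submodule ≤ transLine σ Φ (AlgHom.id F K))
    {v w : K} (hvw : σ w * v - σ v * w ≠ 0)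
    (hpts : N.points = affPt σ Φ '' lineSet F v w) (T : Submodule F (BB F K)) :
    N.IsTangentAt (affPt σ Φ v) T ↔ T = tanLine σ Φ v w := by
  have hv : v ≠ 0 := by rintro rfl; simp at hvw
  obtain ⟨ρ, l₀, l₁, m₀, m₁, ζ, hρ, hζ, hlm, ⟨x0, x1, x2, x3⟩, ⟨y0, y1, y2, y3⟩,
    z0, z1, z2, z3⟩ := hσ.exists_factorization hz hN hpt
  have hg : ∀ s t : F, s ≠ 0 ∨ t ≠ 0 → algebraMap F K s + ρ * algebraMap F K t ≠ 0 := by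
    intro s t hst h
    have := hσ.powers_independent hρ (s := s) (t := t) (m := 0) (by
      rw [map_zero]; linear_combination h)
    rcases hst with h | h
    · exact h this.1
    · exact h this.2.1
  have hg1 : ∀ s t : F, σ (algebraMap F K s + ρ * algebraMap F K t)
      = algebraMap F K s + σ ρ * algebraMap F K t := by intro s t; simp
  have hg2 : ∀ s t : F, σ (σ (algebraMap F K s + ρ * algebraMap F K t))
      = algebraMap F K s + σ (σ ρ) * algebraMap F K t := by intro s t; simp
  have hx : ∀ s t : F, (Φ (N.param s t)).1 = ζ *
      ((algebraMap F K s + σ ρ * algebraMap F K t) * (algebraMap F K s + σ (σ ρ) * algebraMap F K t)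
        * (l₀ * algebraMap F K s + l₁ * algebraMap F K t)) := by
    intro s t
    simp [TwistedCubic.param, smul_eq_algebraMap_mul, x0, x1, x2, x3]
    ring
  have hy : ∀ s t : F, (Φ (N.param s t)).2.1 = ζ *
      ((algebraMap F K s + σ ρ * algebraMap F K t) * (algebraMap F K s + σ (σ ρ) * algebraMap F K t)
        * (m₀ * algebraMap F K s + m₁ * algebraMap F K t)) := by
    intro s t
    simp [TwistedCubic.param, smul_eq_algebraMap_mul, y0, y1, y2, y3]
    ring
  have hzz : ∀ s t : F, algebraMap F K (Φ (N.param s t)).2.2 = ζ *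
      ((algebraMap F K s + ρ * algebraMap F K t) * (algebraMap F K s + σ ρ * algebraMap F K t)
        * (algebraMap F K s + σ (σ ρ) * algebraMap F K t)) := by
    intro s t
    simp [TwistedCubic.param, z0, z1, z2, z3]
    ring
  have hne1 : ∀ s t : F, s ≠ 0 ∨ t ≠ 0 → algebraMap F K s + σ ρ * algebraMap F K t ≠ 0 := by
    intro s t hst
    rw [← hg1]; exact (map_ne_zero σ).2 (hg s t hst)
  have hne2 : ∀ s t : F, s ≠ 0 ∨ t ≠ 0 → algebraMap F K s + σ (σ ρ) * algebraMap F K t ≠ 0 := by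
    intro s t hst
    rw [← hg2]; exact (map_ne_zero σ).2 ((map_ne_zero σ).2 (hg s t hst))
  -- After cancelling the common factor ζ(s + σ(ρ)t)(s + σ²(ρ)t), the point is given by three linear
  -- forms in s, t. They must be proportional to (u, σu, σ²u).
  have hrat : ∀ s t : F, ∀ u : K, u ≠ 0 → ∀ h : N.param s t ≠ 0, s ≠ 0 ∨ t ≠ 0 →
      Projectivization.mk F (N.param s t) h = affPt σ Φ u → ∃ κ : K, κ ≠ 0 ∧
        algebraMap F K s + ρ * algebraMap F K t = κ * u ∧
        l₀ * algebraMap F K s + l₁ * algebraMap F K t = κ * σ u ∧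
        m₀ * algebraMap F K s + m₁ * algebraMap F K t = κ * σ (σ u) := by
    intro s t u hu h hst hmk
    rw [mk_eq_affPt_iff] at hmk
    obtain ⟨e1, e2⟩ := hmk
    rw [hx, hzz] at e1
    rw [hy, hzz] at e2
    have n0 := hg s t hst
    have n1 := hne1 s t hst
    have n2 := hne2 s t hst
    have nn := mul_ne_zero hζ (mul_ne_zero n1 n2)
    refine ⟨(algebraMap F K s + ρ * algebraMap F K t) / u, div_ne_zero n0 hu, ?_, ?_, ?_⟩
    · field_simp
    · exact mul_left_cancel₀ nn (by linear_combination e1)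
    · exact mul_left_cancel₀ nn (by linear_combination e2)
  have hparam : ∀ s t : F, s ≠ 0 ∨ t ≠ 0 → N.param s t ≠ 0 := by
    intro s t hst h
    have := hzz s t
    rw [h] at this
    simp only [map_zero, Prod.snd_zero] at this
    exact mul_ne_zero hζ (mul_ne_zero (mul_ne_zero (hg s t hst) (hne1 s t hst)) (hne2 s t hst))
      this.symm
  have hex : ∀ s t : F, s ≠ 0 ∨ t ≠ 0 → ∃ (κ : K) (c d : F), κ ≠ 0 ∧
        algebraMap F K s + ρ * algebraMap F K t
          = κ * (algebraMap F K c * v + algebraMap F K d * w) ∧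
        l₀ * algebraMap F K s + l₁ * algebraMap F K t
          = κ * (algebraMap F K c * σ v + algebraMap F K d * σ w) ∧
        m₀ * algebraMap F K s + m₁ * algebraMap F K t
          = κ * (algebraMap F K c * σ (σ v) + algebraMap F K d * σ (σ w)) := by
    intro s t hst
    have hmem : Projectivization.mk F (N.param s t) (hparam s t hst) ∈ N.points := ⟨s, t, _, rfl⟩
    rw [hpts] at hmem
    obtain ⟨u, ⟨hu0, c, d, rfl⟩, hu⟩ := hmem
    obtain ⟨κ, h0, h1, h2, h3⟩ := hrat s t _ hu0 _ hst hu.symm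
    refine ⟨κ, c, d, h0, h1, ?_, ?_⟩
    · simpa using h2
    · simpa using h3
  have main : ∀ (s t : F) (h : N.param s t ≠ 0),
      affPt σ Φ v = Projectivization.mk F (N.param s t) h → N.tangentLine s t = tanLine σ Φ v w := by
    intro s t h hp
    have hst : s ≠ 0 ∨ t ≠ 0 := by
      by_contra! h0
      exact h (by simp [TwistedCubic.param, h0.1, h0.2])
    obtain ⟨s', t', hδ⟩ : ∃ s' t' : F, s * t' - s' * t ≠ 0 := by
      rcases hst with h | h
      · exact ⟨0, 1, by simpa using h⟩
      · exact ⟨1, 0, by simpa using h⟩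
    have hst' : s' ≠ 0 ∨ t' ≠ 0 := by
      by_contra! h0
      exact hδ (by rw [h0.1, h0.2]; ring)
    have hst'' : s + s' ≠ 0 ∨ t + t' ≠ 0 := by
      by_contra! h0
      exact hδ (by rw [eq_neg_of_add_eq_zero_left h0.1, eq_neg_of_add_eq_zero_left h0.2]; ring)
    -- The scalars `κ`, `κ'` are only known in `K`. Comparing the points of parameters (s, t), (s',
    -- t') and their sum shows that their ratio lies in `F` (`r5`), so the change of parameter along
    -- the line is defined over `F`.
    obtain ⟨κ, hκ, g1, hl1, hm1⟩ := hrat s t v hv h hst hp.symm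
    obtain ⟨κ', c, d, hκ', g2, hl2, hm2⟩ := hex s' t' hst'
    obtain ⟨κ'', c₃, d₃, hκ'', g3, hl3, hm3⟩ := hex (s + s') (t + t') hst''
    rw [map_add, map_add] at g3 hl3 hm3
    have r1 : (κ'' * algebraMap F K c₃ - κ - κ' * algebraMap F K c) * v
        + (κ'' * algebraMap F K d₃ - κ' * algebraMap F K d) * w = 0 := by
      linear_combination g1 + g2 - g3
    have r2 : (κ'' * algebraMap F K c₃ - κ - κ' * algebraMap F K c) * σ v
        + (κ'' * algebraMap F K d₃ - κ' * algebraMap F K d) * σ w = 0 := by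
      linear_combination hl1 + hl2 - hl3
    have r3 : κ'' * algebraMap F K d₃ - κ' * algebraMap F K d = 0 :=
      mul_left_cancel₀ hvw (by linear_combination v * r2 - σ v * r1)
    have r4 : κ'' * algebraMap F K c₃ - κ - κ' * algebraMap F K c = 0 :=
      mul_left_cancel₀ hvw (by linear_combination σ w * r1 - w * r2)
    -- For d = 0 the independent parameters (s, t) and (s', t') would give the same point, so both
    -- pairs of linear forms would be proportional, against `hlm`.
    have hd : d ≠ 0 := by
      rintro rfl
      have hδK : algebraMap F K (s * t' - s' * t) ≠ 0 := (map_ne_zero _).2 hδ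
      rw [map_sub, map_mul, map_mul] at hδK
      simp only [map_zero, zero_mul, add_zero] at g2 hl2 hm2
      rcases hlm with h | h
      · apply h
        rw [← sub_eq_zero]
        exact mul_left_cancel₀ hδK (by
          linear_combination (algebraMap F K s + ρ * algebraMap F K t) * hl2
            - (l₀ * algebraMap F K s + l₁ * algebraMap F K t) * g2 + κ' * algebraMap F K c *
              (σ v * g1 - v * hl1))
      · apply h
        rw [← sub_eq_zero]
        exact mul_left_cancel₀ hδK (by
          linear_combination (algebraMap F K s + ρ * algebraMap F K t) * hm2
            - (m₀ * algebraMap F K s + m₁ * algebraMap F K t) * g2 + κ' * algebraMap F K c *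
              (σ (σ v) * g1 - v * hm1))
    have hdK : algebraMap F K d ≠ 0 := by simpa using hd
    have hd₃ : d₃ ≠ 0 := by
      rintro rfl
      rw [map_zero, mul_zero, zero_sub, neg_eq_zero] at r3
      exact mul_ne_zero hκ' hdK r3
    have hd₃K : algebraMap F K d₃ ≠ 0 := by simpa using hd₃
    have r5 : κ' * algebraMap F K (d * c₃ - c * d₃) = κ * algebraMap F K d₃ := by
      simp only [map_sub, map_mul]
      linear_combination algebraMap F K d₃ * r4 - algebraMap F K c₃ * r3
    have he : d * c₃ - c * d₃ ≠ 0 := by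
      intro h0
      rw [h0, map_zero, mul_zero] at r5
      exact mul_ne_zero hκ hd₃K r5.symm
    have heK : algebraMap F K (d * c₃ - c * d₃) ≠ 0 := (map_ne_zero _).2 he
    have ha : (Φ (N.param s t)).2.2 ≠ 0 := by
      intro h0
      have := hzz s t
      rw [h0, map_zero] at this
      exact mul_ne_zero hζ (mul_ne_zero (mul_ne_zero (hg s t hst) (hne1 s t hst)) (hne2 s t hst))
        this.symm
    have hP := mk_eq_affPt_iff (σ := σ) (Φ := Φ) h |>.1 hp.symm
    rw [N.tangentLine_eq_span_pair hδ, tanLine]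
    obtain ⟨D, hD⟩ : ∃ D : BB F K,
      D = s' • ((3 * s ^ 2) • N.coeff 0 + (2 * s * t) • N.coeff 1 + t ^ 2 • N.coeff 2)
        + t' • (s ^ 2 • N.coeff 1 + (2 * s * t) • N.coeff 2 + (3 * t ^ 2) • N.coeff 3) := ⟨_, rfl⟩
    rw [← hD]
    have haK := hzz s t
    have hfK : algebraMap F K (d₃ * d / (d * c₃ - c * d₃) * (Φ (N.param s t)).2.2)
        = algebraMap F K d₃ * algebraMap F K d / algebraMap F K (d * c₃ - c * d₃)
          * algebraMap F K (Φ (N.param s t)).2.2 := by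
      simp only [map_mul, map_div₀]
    refine span_pair_change (a := (Φ (N.param s t)).2.2) (b := (Φ D).2.2)
      (c := d₃ * d / (d * c₃ - c * d₃) * (Φ (N.param s t)).2.2) ha
      (mul_ne_zero (div_ne_zero (mul_ne_zero hd₃ hd) he) ha) ?_ ?_
    · apply Φ.injective
      rw [map_smul, LinearEquiv.apply_symm_apply]
      refine Prod.ext ?_ (Prod.ext ?_ ?_)
      · rw [hP.1, Prod.smul_fst, smul_eq_algebraMap_mul]
      · rw [hP.2, Prod.smul_snd, Prod.smul_fst, smul_eq_algebraMap_mul]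
      · simp
    · apply Φ.injective
      rw [map_add, map_smul, map_smul, LinearEquiv.apply_symm_apply, LinearEquiv.apply_symm_apply]
      have hDz : algebraMap F K (Φ D).2.2 = algebraMap F K s' *
          (3 * algebraMap F K s ^ 2 * ζ + 2 * algebraMap F K s * algebraMap F K t
            * (ζ * (ρ + (σ ρ + σ (σ ρ)))) + algebraMap F K t ^ 2 *
            (ζ * (ρ * (σ ρ + σ (σ ρ)) + σ ρ * σ (σ ρ)))) + algebraMap F K t' *
          (algebraMap F K s ^ 2 * (ζ * (ρ + (σ ρ + σ (σ ρ)))) + 2 * algebraMap F K s *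
            algebraMap F K t * (ζ * (ρ * (σ ρ + σ (σ ρ)) + σ ρ * σ (σ ρ)))
            + 3 * algebraMap F K t ^ 2 * (ζ * (ρ * (σ ρ * σ (σ ρ))))) := by
        simp only [hD, map_add, map_smul, Prod.snd_add, Prod.smul_snd, smul_eq_mul, map_mul, map_pow,
          map_ofNat, z0, z1, z2, z3]
        ring
      refine Prod.ext ?_ (Prod.ext ?_ ?_)
      · simp only [Prod.fst_add, Prod.smul_fst, smul_eq_algebraMap_mul]
        rw [hfK, haK, hDz]
        simp only [hD, map_add, map_smul, Prod.fst_add, Prod.smul_fst, smul_eq_algebraMap_mul,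
          x0, x1, x2, x3, map_mul, map_pow, map_ofNat]
        exact tangent_component hv heK g1 hl1 g2 hl2 r5
      · simp only [Prod.fst_add, Prod.smul_fst, Prod.snd_add, Prod.smul_snd,
          smul_eq_algebraMap_mul]
        rw [hfK, haK, hDz]
        simp only [hD, map_add, map_smul, Prod.fst_add, Prod.smul_fst, Prod.snd_add, Prod.smul_snd,
          smul_eq_algebraMap_mul, y0, y1, y2, y3, map_mul, map_pow, map_ofNat]
        exact tangent_component hv heK g1 hm1 g2 hm2 r5
      · simp
  constructor
  · rintro ⟨s, t, h, hp, rfl⟩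
    exact main s t h hp
  · rintro rfl
    have hmem : affPt σ Φ v ∈ N.points := by
      rw [hpts]
      exact ⟨v, ⟨hv, 1, 0, by simp⟩, rfl⟩
    obtain ⟨s, t, h, hp⟩ := hmem
    exact ⟨s, t, h, hp, (main s t h hp).symm⟩

end LineCubics

/-! ### The special twisted cubic of a line -/

section LineCubicExistence

variable {F K : Type*} [Field F] [Field K] [Algebra F K] {Φ : BB F K ≃ₗ[F] BB F K} {σ : K →ₐ[F] K}

/-- The points of a line of a subplane form a twisted cubic with the properties of a special one. -/
theorem IsFrob.exists_lineCubic (hσ : IsFrob σ) (hz : ∀ v, (Φ v).2.2 = v.2.2) {r : K}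
    (hr : σ r ≠ r) :
    ∃ N : TwistedCubic F (BB F K), ¬ N.space ≤ SigmaInf F K ∧
      (∃ α ∈ family σ Φ LinearMap.id, α ≤ N.space) ∧
      (∀ τ : K →ₐ[F] K, (τ = AlgHom.id F K ∨ τ = σ ∨ τ = σ.comp σ) →
        ∃ p ∈ (N.extension K).points, p.submodule ≤ transLine σ Φ τ) ∧
      N.points = affPt σ Φ '' lineSet F 1 r := by
  obtain ⟨e₁, he₁⟩ := hσ.exists_tr r
  obtain ⟨e₃, he₃⟩ := hσ.exists_nm r
  obtain ⟨e₂, he₂⟩ := hσ.exists_tr (r * σ r)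
  rw [tr] at he₁ he₂
  rw [nm] at he₃
  rw [map_mul, map_mul, hσ.cube] at he₂
  have d1 : σ r - r ≠ 0 := sub_ne_zero.2 hr
  have d2 : σ (σ r) - r ≠ 0 := sub_ne_zero.2 (hσ.ne₂ hr)
  have d3 : σ (σ r) - σ r ≠ 0 := sub_ne_zero.2 (hσ.ne₁₂ hr)
  have hr0 : r ≠ 0 := by rintro rfl; simp at hr
  have hs0 : σ r ≠ 0 := (map_ne_zero σ).2 hr0
  have hss0 : σ (σ r) ≠ 0 := (map_ne_zero σ).2 hs0
  -- Multiplying (σu/u, σ²u/u, 1) by N(u) gives (σ(u)²σ²(u), σ(u)σ²(u)², N(u)); these vectors are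
  -- its coefficients at u = s + tr.
  obtain ⟨c, hc⟩ : ∃ c : Fin 4 → BB F K, c = ![Φ.symm (1, 1, 1),
    Φ.symm (2 * σ r + σ (σ r), σ r + 2 * σ (σ r), e₁),
    Φ.symm (σ r ^ 2 + 2 * σ r * σ (σ r), 2 * σ r * σ (σ r) + σ (σ r) ^ 2, e₂),
    Φ.symm (σ r ^ 2 * σ (σ r), σ r * σ (σ r) ^ 2, e₃)] := ⟨_, rfl⟩
  have c0 : Φ (c 0) = (1, 1, 1) := by simp [hc]
  have c1 : Φ (c 1) = (2 * σ r + σ (σ r), σ r + 2 * σ (σ r), e₁) := by simp [hc]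
  have c2 : Φ (c 2) = (σ r ^ 2 + 2 * σ r * σ (σ r), 2 * σ r * σ (σ r) + σ (σ r) ^ 2, e₂) := by
    simp [hc]
  have c3 : Φ (c 3) = (σ r ^ 2 * σ (σ r), σ r * σ (σ r) ^ 2, e₃) := by simp [hc]
  have hli : LinearIndependent F c := by
    rw [Fintype.linearIndependent_iff]
    intro g hg
    rw [Fin.sum_univ_four] at hg
    have hg' := congrArg Φ hg
    simp only [map_add, map_smul, c0, c1, c2, c3, map_zero] at hg'
    have hX := congrArg (fun v : BB F K => v.1) hg'
    have hY := congrArg (fun v : BB F K => v.2.1) hg'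
    simp only [Prod.fst_add, Prod.smul_fst, Prod.snd_add, Prod.smul_snd, smul_eq_algebraMap_mul,
      Prod.fst_zero, Prod.snd_zero] at hX hY
    have hZ := congrArg (fun v : BB F K => algebraMap F K v.2.2) hg'
    simp only [Prod.snd_add, Prod.smul_snd, Prod.snd_zero, smul_eq_mul, map_add, map_mul, he₁, he₂,
      he₃, map_one, map_zero] at hZ
    have q1 : algebraMap F K (g 1) + algebraMap F K (g 2) * (σ r + σ (σ r))
        + algebraMap F K (g 3) * (σ r * σ (σ r)) = 0 :=
      mul_left_cancel₀ d3 (by linear_combination hY - hX)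
    have q0 : algebraMap F K (g 0) + algebraMap F K (g 1) * (σ r + σ (σ r))
        + algebraMap F K (g 2) * (σ r * σ (σ r)) = 0 := by
      linear_combination hZ - r * q1
    have q0' := congrArg σ q0
    have q0'' := congrArg σ q0'
    simp only [map_add, map_mul, AlgHom.commutes, hσ.cube, map_zero] at q0' q0''
    have p1 : algebraMap F K (g 1) + algebraMap F K (g 2) * σ (σ r) = 0 :=
      mul_left_cancel₀ d1 (by linear_combination q0 - q0')
    have p2 : algebraMap F K (g 1) + algebraMap F K (g 2) * σ r = 0 :=
      mul_left_cancel₀ d2 (by linear_combination q0 - q0'')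
    have g2 : algebraMap F K (g 2) = 0 := mul_left_cancel₀ d3 (by linear_combination p1 - p2)
    have g1 : algebraMap F K (g 1) = 0 := by linear_combination p1 - σ (σ r) * g2
    have g0 : algebraMap F K (g 0) = 0 := by
      linear_combination q0 - (σ r + σ (σ r)) * g1 - σ r * σ (σ r) * g2
    have g3 : algebraMap F K (g 3) = 0 :=
      mul_left_cancel₀ (mul_ne_zero hs0 hss0) (by
        linear_combination q1 - g1 - (σ r + σ (σ r)) * g2)
    intro i
    fin_cases i
    · exact (map_eq_zero _).1 g0
    · exact (map_eq_zero _).1 g1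
    · exact (map_eq_zero _).1 g2
    · exact (map_eq_zero _).1 g3
  have hparam : ∀ s t : F, Φ ((⟨c, hli⟩ : TwistedCubic F (BB F K)).param s t) =
      (σ (algebraMap F K s + algebraMap F K t * r) ^ 2
          * σ (σ (algebraMap F K s + algebraMap F K t * r)),
        σ (algebraMap F K s + algebraMap F K t * r)
          * σ (σ (algebraMap F K s + algebraMap F K t * r)) ^ 2,
        s ^ 3 + s ^ 2 * t * e₁ + s * t ^ 2 * e₂ + t ^ 3 * e₃) := by
    intro s t
    simp only [TwistedCubic.param, map_add, map_smul, c0, c1, c2, c3]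
    refine Prod.ext ?_ (Prod.ext ?_ ?_)
    · simp only [Prod.fst_add, Prod.smul_fst, smul_eq_algebraMap_mul, map_mul, map_pow,
        AlgHom.commutes]
      ring
    · simp only [Prod.fst_add, Prod.smul_fst, Prod.snd_add, Prod.smul_snd, smul_eq_algebraMap_mul,
        map_mul, map_pow, AlgHom.commutes]
      ring
    · simp only [Prod.snd_add, Prod.smul_snd, smul_eq_mul]
      ring
  have hnorm : ∀ s t : F, algebraMap F K (s ^ 3 + s ^ 2 * t * e₁ + s * t ^ 2 * e₂ + t ^ 3 * e₃)
      = nm σ (algebraMap F K s + algebraMap F K t * r) := by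
    intro s t
    simp only [nm, map_add, map_mul, map_pow, AlgHom.commutes, he₁, he₂, he₃]
    ring
  have hmk : ∀ (s t : F) (h : (⟨c, hli⟩ : TwistedCubic F (BB F K)).param s t ≠ 0),
      algebraMap F K s + algebraMap F K t * r ≠ 0 →
      Projectivization.mk F _ h = affPt σ Φ (algebraMap F K s + algebraMap F K t * r) := by
    intro s t h hu
    rw [mk_eq_affPt_iff, hparam, hnorm, nm]
    constructor
    · field_simp
    · field_simp
  have hspace : ∀ i, c i ∈ (⟨c, hli⟩ : TwistedCubic F (BB F K)).space := fun i =>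
    Submodule.subset_span ⟨i, rfl⟩
  have hnot : ¬ (⟨c, hli⟩ : TwistedCubic F (BB F K)).space ≤ SigmaInf F K := by
    intro h
    have := h (hspace 0)
    rw [mem_SigmaInf, ← hz, c0] at this
    exact one_ne_zero this
  refine ⟨⟨c, hli⟩, hnot, ?_, ?_, ?_⟩
  -- The points of the cubic satisfy the equation of the line joining (1, 1, 1) and (r, σr, σ²r);
  -- setting z = 0 in it gives this slope. The 3-space meets infinity in vector dimension at least 4
  -- + 6 - 7 = 3, hence in the whole plane.
  · refine ⟨_, ⟨-((σ (σ r) - r) / (r - σ r)), ?_, rfl⟩, ?_⟩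
    · have d1' : r - σ r ≠ 0 := sub_ne_zero.2 hr.symm
      have d2' : r - σ (σ r) ≠ 0 := sub_ne_zero.2 (hσ.ne₂ hr).symm
      have d3' : σ r - σ (σ r) ≠ 0 := sub_ne_zero.2 (hσ.ne₁₂ hr).symm
      simp only [nm, map_neg, map_div₀, map_sub, hσ.cube]
      field_simp
    · have : Module.Finite F K := Module.finite_of_finrank_pos (by rw [hσ.finrank_eq]; omega)
      set W := (⟨c, hli⟩ : TwistedCubic F (BB F K)).space with hW
      set α := graphPlane Φ (-((σ (σ r) - r) / (r - σ r)) • LinearMap.id) with hα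
      have hrel : ∀ v ∈ W, (σ r - σ (σ r)) * algebraMap F K (Φ v).2.2
          + (σ (σ r) - r) * (Φ v).1 + (r - σ r) * (Φ v).2.1 = 0 := by
        intro v hv
        induction hv using Submodule.span_induction with
        | mem x hx =>
          obtain ⟨i, rfl⟩ := hx
          fin_cases i
          · simp [c0]
          · simp [c1, he₁]; ring
          · simp [c2, he₂]; ring
          · simp [c3, he₃]; ring
        | zero => simp
        | add x y _ _ hx hy =>
          simp only [map_add, Prod.fst_add, Prod.snd_add]
          linear_combination hx + hy
        | smul a x _ hx =>
          simp only [map_smul, Prod.smul_fst, Prod.smul_snd, smul_eq_algebraMap_mul, map_mul]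
          linear_combination algebraMap F K a * hx
      have hle : W ⊓ SigmaInf F K ≤ α := by
        rintro v ⟨h1, h2⟩
        have h2' : (Φ v).2.2 = 0 := by rw [hz]; exact mem_SigmaInf.1 h2
        have h3 := hrel v h1
        rw [h2', map_zero] at h3
        refine ⟨?_, h2'⟩
        have d1' : r - σ r ≠ 0 := sub_ne_zero.2 hr.symm
        simp only [LinearMap.smul_apply, LinearMap.id_apply, smul_eq_mul]
        field_simp
        linear_combination h3
      have hfin : Module.finrank F α ≤ Module.finrank F (W ⊓ SigmaInf F K : Submodule F (BB F K)) := by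
        rw [hα, finrank_graphPlane hσ]
        have h1 := Submodule.finrank_sup_add_finrank_inf_eq W (SigmaInf F K)
        have hW4 : Module.finrank F W = 4 := by
          rw [hW, TwistedCubic.space, finrank_span_eq_card hli]; simp
        have hS : 6 ≤ Module.finrank F (SigmaInf F K) := by
          have h2 := LinearMap.finrank_range_add_finrank_ker
            (LinearMap.snd F K F ∘ₗ LinearMap.snd F K (K × F))
          have h3 : Module.finrank F (LinearMap.range
              (LinearMap.snd F K F ∘ₗ LinearMap.snd F K (K × F))) ≤ 1 :=
            (Submodule.finrank_le _).trans (by simp)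
          simp only [Module.finrank_prod, hσ.finrank_eq, Module.finrank_self] at h2
          change _ + Module.finrank F (SigmaInf F K) = _ at h2
          omega
        have h7 : Module.finrank F (W ⊔ SigmaInf F K : Submodule F (BB F K)) ≤ 7 :=
          (Submodule.finrank_le _).trans (by simp [hσ.finrank_eq])
        omega
      rw [← Submodule.eq_of_le_of_finrank_le hle hfin]
      exact inf_le_left
  · intro τ hτ
    have hcom : ∀ x, τ (σ x) = σ (τ x) := by
      rcases hτ with rfl | rfl | rfl <;> simp
    -- At the parameter (-τr : 1), the coordinates conjugate by τ' have the factors τ'(σr) - τr and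
    -- τ'(σ²r) - τr. One of them vanishes when τ' is `σ.comp τ` or `σ.comp (σ.comp τ)`, and none
    -- when τ' = τ.
    set w := ((⟨c, hli⟩ : TwistedCubic F (BB F K)).extension K).param (-τ r) 1 with hw
    have hx : ∀ τ' : K →ₐ[F] K, xc Φ τ' w
        = (τ' (σ r) - τ r) ^ 2 * (τ' (σ (σ r)) - τ r) := by
      intro τ'
      simp only [hw, TwistedCubic.param, TwistedCubic.extension, map_add, map_smul, xc_tmul, c0, c1,
        c2, c3, smul_eq_mul, map_mul, map_pow, map_one, map_ofNat]
      ring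
    have hy : ∀ τ' : K →ₐ[F] K, yc Φ τ' w
        = (τ' (σ r) - τ r) * (τ' (σ (σ r)) - τ r) ^ 2 := by
      intro τ'
      simp only [hw, TwistedCubic.param, TwistedCubic.extension, map_add, map_smul, yc_tmul, c0, c1,
        c2, c3, smul_eq_mul, map_mul, map_pow, map_one, map_ofNat]
      ring
    have hzw : zc Φ w = (r - τ r) * (σ r - τ r) * (σ (σ r) - τ r) := by
      simp only [hw, TwistedCubic.param, TwistedCubic.extension, map_add, map_smul, zc_tmul, c0, c1,
        c2, c3, smul_eq_mul, map_one, he₁, he₂, he₃]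
      ring
    have hw0 : w ≠ 0 := by
      intro h
      have h1 := hx τ
      rw [h, map_zero, ← map_sub, ← map_sub, eq_comm, mul_eq_zero] at h1
      rcases h1 with h1 | h1
      · exact (map_ne_zero τ).2 d1 (pow_eq_zero_iff (two_ne_zero) |>.1 h1)
      · exact (map_ne_zero τ).2 d2 h1
    refine ⟨Projectivization.mk K w hw0, ⟨_, _, hw0, rfl⟩, ?_⟩
    rw [Projectivization.submodule_mk, Submodule.span_singleton_le_iff_mem]
    refine ⟨?_, ⟨?_, ?_⟩, ?_, ?_⟩
    · rw [hzw]
      rcases hτ with rfl | rfl | rfl <;> simp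
    · rw [hx]; simp [hcom, hσ.cube]
    · rw [hx]; simp [hcom, hσ.cube]
    · rw [hy]; simp [hcom, hσ.cube]
    · rw [hy]; simp [hcom, hσ.cube]
  · ext p
    constructor
    · rintro ⟨s, t, h, rfl⟩
      have hu : algebraMap F K s + algebraMap F K t * r ≠ 0 := by
        intro h0
        apply h
        apply Φ.injective
        rw [hparam, h0, map_zero]
        refine Prod.ext (by simp) (Prod.ext (by simp) ?_)
        apply FaithfulSMul.algebraMap_injective F K
        rw [hnorm, h0]
        simp [nm]
      exact ⟨_, ⟨hu, s, t, by rw [mul_one]⟩, (hmk s t h hu).symm⟩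
    · rintro ⟨_, ⟨hu, s, t, rfl⟩, rfl⟩
      rw [mul_one] at hu ⊢
      have h : (⟨c, hli⟩ : TwistedCubic F (BB F K)).param s t ≠ 0 := by
        intro h0
        have := hparam s t
        rw [h0, map_zero] at this
        have h2 := hnorm s t
        have h3 : s ^ 3 + s ^ 2 * t * e₁ + s * t ^ 2 * e₂ + t ^ 3 * e₃ = 0 :=
          (congrArg (fun v : BB F K => v.2.2) this).symm
        rw [h3, map_zero] at h2
        exact nm_ne_zero hu h2.symm
      exact ⟨s, t, h, (hmk s t h hu).symm⟩

end LineCubicExistence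

/-! ### Normal form of an exterior subplane -/

section NormalForm

variable {F K : Type*} [Field F] [Field K] [Algebra F K]

/-- Coordinates in which an exterior subplane consists of the points `(u, σ u, σ² u)`, and the line
at infinity has equation `u = 0`. -/
structure NormalForm (σ : K →ₐ[F] K) (π : Subplane F K) where
  e : Module.Basis (Fin 3) K (Fin 3 → K)
  θ : Module.Basis (Fin 3) F K
  -- The common factor `l` leaves room for rescaling the parameter u, which brings a prescribed
  -- point of the subplane to u = 1.
  l : K
  l_ne : l ≠ 0
  frame_eq : ∀ i, π.frame i = l • (θ i • e 0 + σ (θ i) • e 1 + σ (σ (θ i)) • e 2)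
  z0 : e 0 2 = 1
  z1 : e 1 2 = 0
  z2 : e 2 2 = 0
  Φ : BB F K ≃ₗ[F] BB F K
  bbLin_eq : ∀ v, bbLin F K v
    = (Φ v).1 • e 1 + (Φ v).2.1 • e 2 + algebraMap F K (Φ v).2.2 • e 0

variable {σ : K →ₐ[F] K} {π : Subplane F K}

theorem basis_comb_inj (e : Module.Basis (Fin 3) K (Fin 3 → K)) {a b c a' b' c' : K}
    (h : a • e 0 + b • e 1 + c • e 2 = a' • e 0 + b' • e 1 + c' • e 2) :
    a = a' ∧ b = b' ∧ c = c' := by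
  have h' := congrArg e.repr h
  simp only [map_add, map_smul, Module.Basis.repr_self] at h'
  have h0 := DFunLike.congr_fun h' 0
  have h1 := DFunLike.congr_fun h' 1
  have h2 := DFunLike.congr_fun h' 2
  simp at h0 h1 h2
  exact ⟨h0, h1, h2⟩

theorem basis_comb_exists (e : Module.Basis (Fin 3) K (Fin 3 → K)) (w : Fin 3 → K) :
    ∃ a b c : K, w = a • e 0 + b • e 1 + c • e 2 :=
  ⟨e.repr w 0, e.repr w 1, e.repr w 2, by
    conv_lhs => rw [← e.sum_repr w]
    rw [Fin.sum_univ_three]⟩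

/-- Exteriority means that the last coordinates θᵢ of the frame are independent over `F`, so they
form a basis of `K`. The matrix with rows (θᵢ, σθᵢ, σ²θᵢ) is then invertible, and its inverse
applied to the frame gives `e`. Comparing last coordinates yields 1, 0, 0 by the independence of the
conjugates. -/
theorem IsFrob.exists_normalForm_aux (hσ : IsFrob σ) (hπ : π.IsExterior) :
    ∃ (e : Module.Basis (Fin 3) K (Fin 3 → K)) (θ : Module.Basis (Fin 3) F K),
      (∀ i, π.frame i = θ i • e 0 + σ (θ i) • e 1 + σ (σ (θ i)) • e 2) ∧
      e 0 2 = 1 ∧ e 1 2 = 0 ∧ e 2 2 = 0 := by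
  have hli : LinearIndependent F (fun i => π.frame i 2) := by
    rw [Fintype.linearIndependent_iff]
    intro g hg
    by_contra hne
    have hsum : ∑ i, algebraMap F K (g i) • π.frame i ≠ 0 := by
      intro h
      apply hne
      intro i
      have := Fintype.linearIndependent_iff.1 π.frame.linearIndependent
        (fun i => algebraMap F K (g i)) h i
      simpa using this
    refine hπ _ ⟨g, hsum, rfl⟩ ?_
    rw [Projectivization.submodule_mk, Submodule.span_singleton_le_iff_mem]
    simpa [lineInf, Algebra.smul_def] using hg
  have : Module.Finite F K := Module.finite_of_finrank_pos (by rw [hσ.finrank_eq]; omega)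
  set θ : Module.Basis (Fin 3) F K := basisOfLinearIndependentOfCardEqFinrank hli
    (by rw [hσ.finrank_eq]; simp) with hθ
  have hθi : ∀ i, θ i = π.frame i 2 := by intro i; simp [hθ]
  have hzero : ∀ a b c : K, (∀ i, a * θ i + b * σ (θ i) + c * σ (σ (θ i)) = 0) →
      a = 0 ∧ b = 0 ∧ c = 0 := by
    intro a b c h
    apply hσ.conj_linearIndependent
    intro u
    rw [← θ.sum_repr u]
    simp only [map_sum, map_smul, Finset.mul_sum, ← Finset.sum_add_distrib]
    refine Finset.sum_eq_zero fun i _ => ?_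
    simp only [mul_smul_comm, ← smul_add, h i, smul_zero]
  set M : Matrix (Fin 3) (Fin 3) K :=
    Matrix.of fun i j => ![θ i, σ (θ i), σ (σ (θ i))] j with hM
  have hdet : IsUnit M.det := by
    rw [isUnit_iff_ne_zero, ne_eq, ← Matrix.exists_mulVec_eq_zero_iff]
    rintro ⟨x, hx0, hx⟩
    apply hx0
    obtain ⟨h0, h1, h2⟩ := hzero (x 0) (x 1) (x 2) (fun i => by
      have := congrFun hx i
      simp [hM, Matrix.mulVec, dotProduct, Fin.sum_univ_three] at this
      linear_combination this)
    ext j; fin_cases j <;> assumption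
  let e' : Fin 3 → Fin 3 → K := fun j => ∑ i, M⁻¹ j i • π.frame i
  have he' : ∀ i, π.frame i = θ i • e' 0 + σ (θ i) • e' 1 + σ (σ (θ i)) • e' 2 := by
    intro i
    have h1 : M * M⁻¹ = 1 := Matrix.mul_nonsing_inv _ hdet
    have h2 : ∑ j, M i j • e' j = π.frame i := by
      simp only [e', Finset.smul_sum, smul_smul]
      rw [Finset.sum_comm]
      simp only [← Finset.sum_smul, ← Matrix.mul_apply, h1, Matrix.one_apply, ite_smul, one_smul,
        zero_smul, Finset.sum_ite_eq, Finset.mem_univ, if_true]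
    rw [← h2, Fin.sum_univ_three]
    simp [hM]
  have hspan : ⊤ ≤ Submodule.span K (Set.range e') := by
    rw [← π.frame.span_eq, Submodule.span_le]
    rintro _ ⟨i, rfl⟩
    rw [he' i]
    exact add_mem (add_mem (Submodule.smul_mem _ _ (Submodule.subset_span ⟨0, rfl⟩))
      (Submodule.smul_mem _ _ (Submodule.subset_span ⟨1, rfl⟩)))
      (Submodule.smul_mem _ _ (Submodule.subset_span ⟨2, rfl⟩))
  let e := basisOfTopLeSpanOfCardEqFinrank e' hspan (by simp)
  have hee : ∀ j, e j = e' j := by intro j; simp [e]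
  refine ⟨e, θ, ?_, ?_⟩
  · intro i; rw [hee, hee, hee]; exact he' i
  · rw [hee, hee, hee]
    obtain ⟨h0, h1, h2⟩ := hzero (e' 0 2 - 1) (e' 1 2) (e' 2 2) (fun i => by
      have h3 := congrFun (he' i) 2
      rw [← hθi] at h3
      simp only [Pi.add_apply, Pi.smul_apply, smul_eq_mul] at h3
      linear_combination -h3)
    exact ⟨sub_eq_zero.1 h0, h1, h2⟩

/-- The coordinates of `PG(6,q)` that belong to a basis. -/
theorem IsFrob.exists_coordinates (hσ : IsFrob σ) (e : Module.Basis (Fin 3) K (Fin 3 → K))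
    (z0 : e 0 2 = 1) (z1 : e 1 2 = 0) (z2 : e 2 2 = 0) :
    ∃ Φ : BB F K ≃ₗ[F] BB F K, ∀ v, bbLin F K v
      = (Φ v).1 • e 1 + (Φ v).2.1 • e 2 + algebraMap F K (Φ v).2.2 • e 0 := by
  have : Module.Finite F K := Module.finite_of_finrank_pos (by rw [hσ.finrank_eq]; omega)
  let Ψ : BB F K →ₗ[F] BB F K :=
    { toFun := fun v => (v.1 * e 1 0 + v.2.1 * e 2 0 + algebraMap F K v.2.2 * e 0 0,
        v.1 * e 1 1 + v.2.1 * e 2 1 + algebraMap F K v.2.2 * e 0 1, v.2.2)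
      map_add' := by
        intro v w
        simp only [Prod.fst_add, Prod.snd_add, map_add, Prod.mk_add_mk, Prod.mk.injEq]
        exact ⟨by ring, by ring, trivial⟩
      map_smul' := by
        intro a v
        simp only [Prod.smul_fst, Prod.smul_snd, RingHom.id_apply, Prod.smul_mk, Prod.mk.injEq,
          smul_eq_algebraMap_mul, Algebra.algebraMap_self, map_mul]
        exact ⟨by ring, by ring, trivial⟩ }
  have hΨ : ∀ v, bbLin F K (Ψ v) = v.1 • e 1 + v.2.1 • e 2 + algebraMap F K v.2.2 • e 0 := by
    intro v
    ext i
    fin_cases i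
    · simp [Ψ, bbLin, -algebraMap_smul]
    · simp [Ψ, bbLin, -algebraMap_smul]
    · simp [Ψ, bbLin, z0, z1, z2, -algebraMap_smul]
  have hinj : Function.Injective Ψ := by
    intro v w h
    have h1 := congrArg (bbLin F K) h
    rw [hΨ, hΨ] at h1
    obtain ⟨h2, h3, h4⟩ := basis_comb_inj e (a := algebraMap F K v.2.2) (b := v.1) (c := v.2.1)
      (a' := algebraMap F K w.2.2) (b' := w.1) (c' := w.2.1) (by
        rw [add_assoc, add_comm, h1, add_assoc _ (w.1 • e 1), add_comm (algebraMap F K w.2.2 • e 0)])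
    exact Prod.ext h3 (Prod.ext h4 (FaithfulSMul.algebraMap_injective F K h2))
  refine ⟨(LinearEquiv.ofInjectiveEndo Ψ hinj).symm, fun v => ?_⟩
  obtain ⟨w, rfl⟩ := (LinearEquiv.ofInjectiveEndo Ψ hinj).surjective v
  rw [LinearEquiv.symm_apply_apply]
  exact hΨ w

namespace NormalForm

variable (n : NormalForm σ π)

/-- The vector `(u, σ u, σ² u)`. -/
def iota (u : K) : Fin 3 → K := u • n.e 0 + σ u • n.e 1 + σ (σ u) • n.e 2

theorem vec_ne_zero (u : K) :
    (1 : K) • n.e 0 + (σ u / u) • n.e 1 + (σ (σ u) / u) • n.e 2 ≠ 0 := by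
  intro h
  have := basis_comb_inj n.e (a' := 0) (b' := 0) (c' := 0) (h.trans (by simp))
  exact one_ne_zero this.1

/-- The point of the subplane with parameter `u`. -/
def pt (u : K) : Pt K := Projectivization.mk K _ (n.vec_ne_zero u)

theorem iota_eq_smul {u : K} (hu : u ≠ 0) :
    n.iota u = u • ((1 : K) • n.e 0 + (σ u / u) • n.e 1 + (σ (σ u) / u) • n.e 2) := by
  simp only [iota, smul_add, smul_smul, mul_one, mul_div_cancel₀ _ hu]

theorem pt_submodule {u : K} (hu : u ≠ 0) : (n.pt u).submodule = Submodule.span K {n.iota u} := by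
  rw [pt, Projectivization.submodule_mk, n.iota_eq_smul hu,
    Submodule.span_singleton_smul_eq (IsUnit.mk0 u hu)]

theorem pt_le_iff {u : K} (hu : u ≠ 0) {L : Submodule K (Fin 3 → K)} :
    (n.pt u).submodule ≤ L ↔ n.iota u ∈ L := by
  rw [n.pt_submodule hu, Submodule.span_singleton_le_iff_mem]

theorem iota_apply_two (u : K) : n.iota u 2 = u := by
  simp [iota, n.z0, n.z1, n.z2]

theorem iota_ne_zero {u : K} (hu : u ≠ 0) : n.iota u ≠ 0 := by
  intro h
  have := congrFun h 2
  rw [iota_apply_two] at this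
  exact hu this

theorem mk_eq_pt {u : K} (hu : u ≠ 0) {c : K} {w : Fin 3 → K} (hw : w ≠ 0)
    (h : w = c • n.iota u) : Projectivization.mk K w hw = n.pt u := by
  rw [pt, Projectivization.mk_eq_mk_iff']
  exact ⟨c * u, by rw [h, n.iota_eq_smul hu, smul_smul]⟩

theorem sum_frame (w : Fin 3 → F) : ∑ i, algebraMap F K (w i) • π.frame i
    = n.l • n.iota (∑ i, w i • n.θ i) := by
  simp only [iota, map_sum, map_smul, n.frame_eq, Finset.sum_smul, smul_add, Finset.smul_sum,
    ← Finset.sum_add_distrib]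
  refine Finset.sum_congr rfl fun i _ => ?_
  simp only [algebraMap_smul, smul_assoc, smul_comm n.l (w i)]

theorem mem_points_iff {P : Pt K} : P ∈ π.points ↔ ∃ u, u ≠ 0 ∧ P = n.pt u := by
  constructor
  · rintro ⟨w, h, rfl⟩
    have hu : ∑ i, w i • n.θ i ≠ 0 := by
      intro h0
      apply h
      rw [n.sum_frame, h0]
      simp [iota]
    exact ⟨_, hu, n.mk_eq_pt hu h (n.sum_frame w)⟩
  · rintro ⟨u, hu, rfl⟩
    have hsum : ∑ i, (n.θ.repr u i) • n.θ i = u := n.θ.sum_repr u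
    have h0 := n.sum_frame (fun i => n.θ.repr u i)
    rw [hsum] at h0
    have h : ∑ i, algebraMap F K (n.θ.repr u i) • π.frame i ≠ 0 := by
      rw [h0]
      exact smul_ne_zero n.l_ne (n.iota_ne_zero hu)
    exact ⟨_, h, (n.mk_eq_pt hu h h0).symm⟩

theorem hz (v : BB F K) : (n.Φ v).2.2 = v.2.2 := by
  have h := congrFun (n.bbLin_eq v) 2
  simp [bbLin, n.z0, n.z1, n.z2, -algebraMap_smul] at h
  exact h.symm

theorem bbMap_eq_pt_iff {u : K} {p : Projectivization F (BB F K)} :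
    bbMap F K p = n.pt u ↔ p = affPt σ n.Φ u := by
  induction p using Projectivization.ind with
  | h v hv =>
    rw [mk_eq_affPt_iff, bbMap, Projectivization.map_mk, pt, Projectivization.mk_eq_mk_iff']
    constructor
    · rintro ⟨a, ha⟩
      rw [n.bbLin_eq] at ha
      obtain ⟨h0, h1, h2⟩ := basis_comb_inj n.e (a := a) (b := a * (σ u / u))
        (c := a * (σ (σ u) / u)) (a' := algebraMap F K (n.Φ v).2.2) (b' := (n.Φ v).1)
        (c' := (n.Φ v).2.1) (by
          rw [add_assoc (algebraMap F K (n.Φ v).2.2 • n.e 0), add_comm (algebraMap F K _ • n.e 0),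
            ← ha]
          simp only [smul_add, smul_smul, mul_one])
      rw [← h0, ← h1, ← h2]
      exact ⟨rfl, rfl⟩
    · rintro ⟨h1, h2⟩
      refine ⟨algebraMap F K (n.Φ v).2.2, ?_⟩
      rw [n.bbLin_eq, h1, h2]
      simp only [smul_add, smul_smul, mul_one]
      abel

theorem bb_image_pt (S : Set K) : bb F K (n.pt '' S) = affPt σ n.Φ '' S := by
  ext p
  constructor
  · rintro ⟨u, hu, h⟩
    exact ⟨u, hu, (n.bbMap_eq_pt_iff.1 h.symm).symm⟩
  · rintro ⟨u, hu, rfl⟩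
    exact ⟨u, hu, (n.bbMap_eq_pt_iff.2 rfl).symm⟩

/-- The second affine coordinate depends on the first alone: σ²(u)/u = σ(σu/u)·(σu/u). -/
theorem pt_eq_of_ratio {u v : K} (hu : u ≠ 0) (hv : v ≠ 0) (h : σ v * u - σ u * v = 0) :
    n.pt u = n.pt v := by
  have h1 : σ u / u = σ v / v := by field_simp; linear_combination -h
  have h2 : σ (σ u) / u = σ (σ v) / v := by
    have hs : σ u ≠ 0 := (map_ne_zero σ).2 hu
    have hs' : σ v ≠ 0 := (map_ne_zero σ).2 hv
    have e1 : σ (σ u) / u = σ (σ u / u) * (σ u / u) := by rw [map_div₀]; field_simp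
    have e2 : σ (σ v) / v = σ (σ v / v) * (σ v / v) := by rw [map_div₀]; field_simp
    rw [e1, e2, h1]
  simp only [pt, h1, h2]

theorem iota_linearIndependent {v w : K} (hvw : σ w * v - σ v * w ≠ 0) :
    LinearIndependent K ![n.iota v, n.iota w] := by
  rw [LinearIndependent.pair_iff]
  intro s t h
  obtain ⟨h0, h1, -⟩ := basis_comb_inj n.e (a := s * v + t * w) (b := s * σ v + t * σ w)
    (c := s * σ (σ v) + t * σ (σ w)) (a' := 0) (b' := 0) (c' := 0) (by
      rw [zero_smul, zero_smul, zero_smul, add_zero, add_zero, ← h, iota, iota]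
      module)
  constructor
  · exact mul_left_cancel₀ hvw (by linear_combination σ w * h0 - w * h1)
  · exact mul_left_cancel₀ hvw (by linear_combination v * h1 - σ v * h0)

theorem eq_span {v w : K} (hvw : σ w * v - σ v * w ≠ 0) {L : Submodule K (Fin 3 → K)}
    (hL : Module.finrank K L = 2) (h1 : n.iota v ∈ L) (h2 : n.iota w ∈ L) :
    L = Submodule.span K {n.iota v, n.iota w} := by
  symm
  apply Submodule.eq_of_le_of_finrank_eq
  · rw [Submodule.span_le]
    rintro x (rfl | rfl) <;> assumption
  · have := finrank_span_eq_card (n.iota_linearIndependent hvw)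
    rw [Matrix.range_cons_cons_empty] at this
    rw [this, hL]
    simp

/-- Applying `σ` to the first two coordinate equations and comparing with the last two, the
conjugates of the coefficients solve the same invertible system as the coefficients. Hence these are
fixed by `σ`. -/
theorem iota_mem_span_iff (hσ : IsFrob σ) {v w u : K} (hvw : σ w * v - σ v * w ≠ 0) :
    n.iota u ∈ Submodule.span K {n.iota v, n.iota w} ↔
      ∃ s t : F, u = algebraMap F K s * v + algebraMap F K t * w := by
  rw [Submodule.mem_span_pair]
  constructor
  · rintro ⟨A, B, h⟩
    obtain ⟨h0, h1, h2⟩ := basis_comb_inj n.e (a := A * v + B * w) (b := A * σ v + B * σ w)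
      (c := A * σ (σ v) + B * σ (σ w)) (a' := u) (b' := σ u) (c' := σ (σ u)) (by
        change _ = n.iota u
        rw [← h, iota, iota]
        module)
    have hvw' : σ (σ w) * σ v - σ (σ v) * σ w ≠ 0 := by
      rw [← map_mul, ← map_mul, ← map_sub]; exact (map_ne_zero σ).2 hvw
    have k0 := congrArg σ h0
    have k1 := congrArg σ h1
    simp only [map_add, map_mul] at k0 k1
    have hA : σ A = A := by
      rw [← sub_eq_zero]
      exact mul_left_cancel₀ hvw' (by
        linear_combination σ (σ w) * k0 - σ w * k1 - σ (σ w) * h1 + σ w * h2)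
    have hB : σ B = B := by
      rw [← sub_eq_zero]
      exact mul_left_cancel₀ hvw' (by
        linear_combination σ v * k1 - σ (σ v) * k0 - σ v * h2 + σ (σ v) * h1)
    obtain ⟨s, hs⟩ := hσ.fixed A hA
    obtain ⟨t, ht⟩ := hσ.fixed B hB
    exact ⟨s, t, by rw [hs, ht, h0]⟩
  · rintro ⟨s, t, rfl⟩
    refine ⟨algebraMap F K s, algebraMap F K t, ?_⟩
    simp only [iota, map_add, map_mul, AlgHom.commutes]
    module

/-- The line of the subplane through the points of parameters `v` and `w`. -/
theorem linePoints_span (hσ : IsFrob σ) {v w : K} (hvw : σ w * v - σ v * w ≠ 0) :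
    π.linePoints (Submodule.span K {n.iota v, n.iota w}) = n.pt '' lineSet F v w := by
  ext P
  constructor
  · rintro ⟨hP, hPL⟩
    obtain ⟨u, hu, rfl⟩ := n.mem_points_iff.1 hP
    rw [n.pt_le_iff hu, n.iota_mem_span_iff hσ hvw] at hPL
    exact ⟨u, ⟨hu, hPL⟩, rfl⟩
  · rintro ⟨u, ⟨hu, hu'⟩, rfl⟩
    refine ⟨n.mem_points_iff.2 ⟨u, hu, rfl⟩, ?_⟩
    rwa [n.pt_le_iff hu, n.iota_mem_span_iff hσ hvw]

theorem pt_ne {v w : K} (hvw : σ w * v - σ v * w ≠ 0) : n.pt v ≠ n.pt w := by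
  have hv : v ≠ 0 := by rintro rfl; simp at hvw
  have hw : w ≠ 0 := by rintro rfl; simp at hvw
  intro h
  rw [pt, pt, Projectivization.mk_eq_mk_iff'] at h
  obtain ⟨a, ha⟩ := h
  obtain ⟨h0, h1, -⟩ := basis_comb_inj n.e (a := a) (b := a * (σ w / w))
    (c := a * (σ (σ w) / w)) (by
      rw [← ha]; simp only [smul_add, smul_smul, mul_one])
  subst h0
  apply hvw
  field_simp at h1
  linear_combination h1

theorem isLine_span {v w : K} (hvw : σ w * v - σ v * w ≠ 0) :
    π.IsLine (Submodule.span K {n.iota v, n.iota w}) := by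
  have hv : v ≠ 0 := by rintro rfl; simp at hvw
  have hw : w ≠ 0 := by rintro rfl; simp at hvw
  refine ⟨?_, n.pt v, n.mem_points_iff.2 ⟨v, hv, rfl⟩, n.pt w, n.mem_points_iff.2 ⟨w, hw, rfl⟩,
    n.pt_ne hvw, ?_, ?_⟩
  · have := finrank_span_eq_card (n.iota_linearIndependent hvw)
    rw [Matrix.range_cons_cons_empty] at this
    rw [this]
    simp
  · rw [n.pt_le_iff hv]
    exact Submodule.subset_span (by simp)
  · rw [n.pt_le_iff hw]
    exact Submodule.subset_span (by simp)

theorem exists_span_of_isLine {v : K} (hv : v ≠ 0) {L : Submodule K (Fin 3 → K)}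
    (hL : π.IsLine L) (hvL : (n.pt v).submodule ≤ L) :
    ∃ w, σ w * v - σ v * w ≠ 0 ∧ L = Submodule.span K {n.iota v, n.iota w} := by
  obtain ⟨hfin, P, hP, Q, hQ, hPQ, hPL, hQL⟩ := hL
  obtain ⟨R, hR, hRv, hRL⟩ : ∃ R ∈ π.points, R ≠ n.pt v ∧ R.submodule ≤ L := by
    by_cases h : P = n.pt v
    · exact ⟨Q, hQ, fun h' => hPQ (h.trans h'.symm), hQL⟩
    · exact ⟨P, hP, h, hPL⟩
  obtain ⟨w, hw, rfl⟩ := n.mem_points_iff.1 hR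
  have hvw : σ w * v - σ v * w ≠ 0 := fun h => hRv (n.pt_eq_of_ratio hv hw h).symm
  exact ⟨w, hvw, n.eq_span hvw hfin ((n.pt_le_iff hv).1 hvL) ((n.pt_le_iff hw).1 hRL)⟩

end NormalForm

end NormalForm

/-! ### The splash, its covers and the tangent cover in normal form -/

section Splash

variable {F K : Type*} [Field F] [Field K] [Algebra F K] {σ : K →ₐ[F] K} {π : Subplane F K}

/-- An exterior subplane has a normal form with a given point at parameter `1`. -/
theorem IsFrob.exists_normalForm (hσ : IsFrob σ) (hπ : π.IsExterior) {P : Pt K}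
    (hP : P ∈ π.points) : ∃ n : NormalForm σ π, P = n.pt 1 := by
  obtain ⟨e, θ, he, z0, z1, z2⟩ := hσ.exists_normalForm_aux hπ
  obtain ⟨Φ, hΦ⟩ := hσ.exists_coordinates e z0 z1 z2
  let n : NormalForm σ π := ⟨e, θ, 1, one_ne_zero, fun i => by rw [one_smul, he], z0, z1, z2, Φ, hΦ⟩
  obtain ⟨u, hu, hPu⟩ := n.mem_points_iff.1 hP
  have hs : σ u ≠ 0 := (map_ne_zero σ).2 hu
  have hss : σ (σ u) ≠ 0 := (map_ne_zero σ).2 hs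
  -- Writing the parameter as uv gives u·(v, (σu/u)σv, (σ²u/u)σ²v): the ratios go into the basis and
  -- u becomes the factor `l`.
  let c : Fin 3 → Kˣ := ![1, Units.mk0 _ (div_ne_zero hs hu), Units.mk0 _ (div_ne_zero hss hu)]
  let e' := e.unitsSMul c
  have e0 : e' 0 = e 0 := by simp [e', c, Module.Basis.unitsSMul_apply]
  have e1 : e' 1 = (σ u / u) • e 1 := by
    simp [e', c, Module.Basis.unitsSMul_apply, Units.smul_def]
  have e2 : e' 2 = (σ (σ u) / u) • e 2 := by
    simp [e', c, Module.Basis.unitsSMul_apply, Units.smul_def]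
  let θ' : Module.Basis (Fin 3) F K :=
    θ.map ((LinearEquiv.smulOfNeZero K K u⁻¹ (inv_ne_zero hu)).restrictScalars F)
  have hθ' : ∀ i, θ' i = u⁻¹ * θ i := by intro i; simp [θ']
  have z0' : e' 0 2 = 1 := by rw [e0, z0]
  have z1' : e' 1 2 = 0 := by rw [e1, Pi.smul_apply, z1, smul_zero]
  have z2' : e' 2 2 = 0 := by rw [e2, Pi.smul_apply, z2, smul_zero]
  obtain ⟨Φ', hΦ'⟩ := hσ.exists_coordinates e' z0' z1' z2'
  refine ⟨⟨e', θ', u, hu, ?_, z0', z1', z2', Φ', hΦ'⟩, ?_⟩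
  · intro i
    rw [he, hθ', e0, e1, e2]
    simp only [map_mul, map_inv₀, smul_add, smul_smul]
    congr 2
    · congr 1; field_simp
    · congr 1; field_simp
    · field_simp
  · rw [hPu]
    unfold NormalForm.pt
    congr 1
    simp only [map_one, div_one, one_smul, e0, e1, e2, n]

namespace NormalForm

variable (n : NormalForm σ π)

theorem infVec_ne_zero (k : K) : n.e 1 + k • n.e 2 ≠ 0 := by
  intro h
  have := basis_comb_inj n.e (a := 0) (b := 1) (c := k) (a' := 0) (b' := 0) (c' := 0) (by
    simpa using h)
  exact one_ne_zero this.2.1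

theorem mem_lineInf_iff {w : Fin 3 → K} : w ∈ lineInf K ↔ w 2 = 0 := by simp [lineInf]

theorem spreadPlane_mk (k : K) : spreadPlane F K (Projectivization.mk K _ (n.infVec_ne_zero k))
    = graphPlane n.Φ (k • LinearMap.id) := by
  ext v
  rw [spreadPlane, Submodule.mem_comap, Projectivization.submodule_mk,
    Submodule.mem_span_singleton, n.bbLin_eq, mem_graphPlane]
  simp only [LinearMap.smul_apply, LinearMap.id_apply, smul_eq_mul]
  constructor
  · rintro ⟨a, ha⟩
    obtain ⟨h0, h1, h2⟩ := basis_comb_inj n.e (a := 0) (b := a) (c := a * k)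
      (a' := algebraMap F K (n.Φ v).2.2) (b' := (n.Φ v).1) (c' := (n.Φ v).2.1) (by
        rw [zero_smul, zero_add, mul_smul, ← smul_add, ha]
        abel)
    refine ⟨by rw [← h2, ← h1, mul_comm], ?_⟩
    exact (map_eq_zero _).1 h0.symm
  · rintro ⟨h1, h2⟩
    refine ⟨(n.Φ v).1, ?_⟩
    rw [h1, h2, map_zero, zero_smul, add_zero, smul_add, smul_smul, mul_comm]

theorem inf_le_lineInf (k : K) :
    (Projectivization.mk K _ (n.infVec_ne_zero k)).submodule ≤ lineInf K := by
  rw [Projectivization.submodule_mk, Submodule.span_singleton_le_iff_mem, mem_lineInf_iff]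
  simp [n.z1, n.z2]

theorem family_subset_regularSpread (σ' : K →ₐ[F] K) :
    family σ' n.Φ LinearMap.id ⊆ regularSpread F K := by
  rintro _ ⟨k, -, rfl⟩
  exact ⟨_, n.inf_le_lineInf k, (n.spreadPlane_mk k).symm⟩

theorem regularSpread_coords {α : Submodule F (BB F K)} (hα : α ∈ regularSpread F K) :
    ∃ a b : K, (a ≠ 0 ∨ b ≠ 0) ∧ ∀ x, n.Φ.symm (a * x, b * x, 0) ∈ α := by
  obtain ⟨T, hT, rfl⟩ := hα
  induction T using Projectivization.ind with
  | h w hw =>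
    obtain ⟨c, a, b, rfl⟩ := basis_comb_exists n.e w
    rw [Projectivization.submodule_mk, Submodule.span_singleton_le_iff_mem, mem_lineInf_iff] at hT
    have hc : c = 0 := by simpa [n.z0, n.z1, n.z2] using hT
    subst hc
    refine ⟨a, b, ?_, fun x => ?_⟩
    · by_contra! h
      exact hw (by simp [h.1, h.2])
    · rw [spreadPlane, Submodule.mem_comap, Projectivization.submodule_mk,
        Submodule.mem_span_singleton, n.bbLin_eq, LinearEquiv.apply_symm_apply]
      exact ⟨x, by simp only [map_zero]; module⟩

/-- With D = σ(w)u - σ(u)w, the line through the points of parameters u and w meets infinity at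
slope k = -σ²(D)/D, of norm -1. Conversely Hilbert 90 writes -k as y/σ(y), and a line with D in
`F`·σ(y) is needed. -/
theorem splash_eq (hσ : IsFrob σ) : π.splash = family σ n.Φ LinearMap.id := by
  ext α
  constructor
  · rintro ⟨T, hT, ⟨L, hL, hTL⟩, rfl⟩
    obtain ⟨hfin, P, hP, Q, hQ, hPQ, hPL, hQL⟩ := id hL
    obtain ⟨u, hu, rfl⟩ := n.mem_points_iff.1 hP
    obtain ⟨w, huw, rfl⟩ := n.exists_span_of_isLine hu hL hPL
    induction T using Projectivization.ind with
    | h x hx =>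
      rw [Projectivization.submodule_mk, Submodule.span_singleton_le_iff_mem] at hT hTL
      rw [mem_lineInf_iff] at hT
      obtain ⟨A, B, rfl⟩ := Submodule.mem_span_pair.1 hTL
      have hAB : A * u + B * w = 0 := by
        simpa [n.iota_apply_two] using hT
      have hA : A = -(B * w / u) := by field_simp; linear_combination hAB
      have hB : B ≠ 0 := by
        rintro rfl
        apply hx
        rw [hA]; simp
      set D := σ w * u - σ u * w with hD
      have hDD : σ (σ D) = w * σ (σ u) - u * σ (σ w) := by
        simp only [hD, map_sub, map_mul, hσ.cube]
      have hDn : nm σ D ≠ 0 := nm_ne_zero huw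
      have hs : σ D ≠ 0 := (map_ne_zero σ).2 huw
      have hss : σ (σ D) ≠ 0 := (map_ne_zero σ).2 hs
      refine ⟨-(σ (σ D) / D), ?_, ?_⟩
      · simp only [nm, map_neg, map_div₀, hσ.cube]
        field_simp
      · rw [← n.spreadPlane_mk]
        congr 1
        rw [Projectivization.mk_eq_mk_iff']
        refine ⟨B * D / u, ?_⟩
        rw [hA, iota, iota]
        have q1 : B * D / u * -(σ (σ D) / D) = -(B * w / u) * σ (σ u) + B * σ (σ w) := by
          rw [hDD]; field_simp; ring
        have q2 : B * D / u = -(B * w / u) * σ u + B * σ w := by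
          rw [hD]; field_simp; ring
        have q3 : -(B * w / u) * u + B * w = 0 := by field_simp; ring
        rw [smul_add, smul_smul, q1, q2]
        have : (-(B * w / u) * σ u + B * σ w) • n.e 1
            + (-(B * w / u) * σ (σ u) + B * σ (σ w)) • n.e 2
            = (-(B * w / u) * u + B * w) • n.e 0 + (-(B * w / u) * σ u + B * σ w) • n.e 1
            + (-(B * w / u) * σ (σ u) + B * σ (σ w)) • n.e 2 := by
          rw [q3, zero_smul, zero_add]
        rw [this]
        module
  · rintro ⟨k, hk, rfl⟩
    obtain ⟨r, hr⟩ := hσ.exists_ne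
    have hk0 := ne_zero_of_nm hk
    obtain ⟨y, hy0, hy⟩ := hσ.hilbert90 (c := -k) (by
      have : nm σ (-1 * k) = nm σ (-1) * nm σ k := nm_mul _ _
      rw [hk] at this
      simpa [nm] using this)
    have hd : σ r - r ≠ 0 := sub_ne_zero.2 hr
    have hsy : σ y ≠ 0 := (map_ne_zero σ).2 hy0
    -- For the parameters c and cr, D = cσ(c)(σr - r); this choice of c makes it N(c)σ(y).
    set c := σ ((σ r - r) / σ y) with hc
    have hc0 : c ≠ 0 := (map_ne_zero σ).2 (div_ne_zero hd hsy)
    have hσc0 : σ c ≠ 0 := (map_ne_zero σ).2 hc0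
    have hccc : σ (σ c) * σ y = σ r - r := by
      rw [hc, hσ.cube]; field_simp
    have hD : σ (c * r) * c - σ c * (c * r) = nm σ c * σ y := by
      rw [nm, map_mul]; linear_combination -(c * σ c) * hccc
    have hD0 : σ (c * r) * c - σ c * (c * r) ≠ 0 := by
      rw [hD]; exact mul_ne_zero (nm_ne_zero hc0) hsy
    have hDk : c * σ (σ (c * r)) - c * r * σ (σ c) = k * (nm σ c * σ y) := by
      have h3 : σ (σ (nm σ c * σ y)) = nm σ c * y := by
        simp only [nm, map_mul, hσ.cube]; ring
      have h4 := congrArg (fun x => σ (σ x)) hD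
      simp only [h3] at h4
      simp only [map_sub, map_mul, hσ.cube] at h4
      simp only [map_mul]
      linear_combination -h4 + nm σ c * hy
    refine ⟨_, n.inf_le_lineInf k, ⟨_, n.isLine_span hD0, ?_⟩, (n.spreadPlane_mk k).symm⟩
    rw [Projectivization.submodule_mk, Submodule.span_singleton_le_iff_mem,
      Submodule.mem_span_pair]
    refine ⟨-(c * r) / (nm σ c * σ y), c / (nm σ c * σ y), ?_⟩
    have hnc : nm σ c ≠ 0 := nm_ne_zero hc0
    rw [iota, iota]
    have q0 : -(c * r) / (nm σ c * σ y) * c + c / (nm σ c * σ y) * (c * r) = 0 := by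
      field_simp; ring
    have q1 : -(c * r) / (nm σ c * σ y) * σ c + c / (nm σ c * σ y) * σ (c * r) = 1 := by
      field_simp; linear_combination hD
    have q2 : -(c * r) / (nm σ c * σ y) * σ (σ c) + c / (nm σ c * σ y) * σ (σ (c * r)) = k := by
      field_simp; linear_combination hDk
    calc _ = (-(c * r) / (nm σ c * σ y) * c + c / (nm σ c * σ y) * (c * r)) • n.e 0
        + (-(c * r) / (nm σ c * σ y) * σ c + c / (nm σ c * σ y) * σ (c * r)) • n.e 1
        + (-(c * r) / (nm σ c * σ y) * σ (σ c) + c / (nm σ c * σ y) * σ (σ (c * r))) • n.e 2 := by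
          module
      _ = _ := by rw [q0, q1, q2]; module

theorem special_line_point (hσ : IsFrob σ) {N : TwistedCubic F (BB F K)}
    (hN : IsSpecialCubic (regularSpread F K) N) :
    ∃ p ∈ (N.extension K).points, p.submodule ≤ transLine σ n.Φ (AlgHom.id F K) :=
  hN.2.2 _ (hσ.isTransversal_transLine n.hz fun _ hα => n.regularSpread_coords hα)

/-- A transversal line of the whole spread is in particular one of the splash, hence one of the
three known lines, and the cubic meets each of these. -/
theorem exists_special_line (hσ : IsFrob σ) {r : K} (hr : σ r ≠ r) :
    ∃ N : TwistedCubic F (BB F K), IsSpecialCubic (regularSpread F K) N ∧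
      N.points = affPt σ n.Φ '' lineSet F 1 r := by
  obtain ⟨N, h1, ⟨α, hα, h2⟩, h3, h4⟩ := hσ.exists_lineCubic n.hz hr
  refine ⟨N, ⟨h1, ⟨α, n.family_subset_regularSpread σ hα, h2⟩, fun g hg => ?_⟩, h4⟩
  obtain ⟨τ, hτ, rfl⟩ := hσ.eq_transLine (n.family_subset_regularSpread σ) hg
  exact h3 τ hτ

theorem isTangentAt_line_iff (hσ : IsFrob σ) {N : TwistedCubic F (BB F K)}
    (hN : IsSpecialCubic (regularSpread F K) N) {v w : K} (hvw : σ w * v - σ v * w ≠ 0)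
    (hpts : N.points = affPt σ n.Φ '' lineSet F v w) (T : Submodule F (BB F K)) :
    N.IsTangentAt (affPt σ n.Φ v) T ↔ T = tanLine σ n.Φ v w :=
  hσ.isTangentAt_iff n.hz hN.1 (n.special_line_point hσ hN) hvw hpts T

theorem isCover_iff (hσ : IsFrob σ) {X : Set (Submodule F (BB F K))} : π.IsCover X ↔
    X = family σ n.Φ σ.toLinearMap ∨ X = family σ n.Φ (σ.toLinearMap ∘ₗ σ.toLinearMap) := by
  rw [← hσ.isCoverOf_iff n.hz, ← n.splash_eq hσ]
  rfl

/-- The tangent direction at v along w is (D, -σ²(D))/v² with D = σ(w)v - σ(v)w. It satisfies y =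
-(σ²(v)²/v²)σ²(x), an equation free of w. -/
theorem isTangentCover_family (hσ : IsFrob σ) :
    π.IsTangentCover (family σ n.Φ (σ.toLinearMap ∘ₗ σ.toLinearMap)) := by
  refine ⟨(n.isCover_iff hσ).2 (Or.inr rfl), fun p hp => ?_⟩
  obtain ⟨v, hv, hpv⟩ := n.mem_points_iff.1 hp
  have hp' := n.bbMap_eq_pt_iff.1 hpv
  have hs : σ v ≠ 0 := (map_ne_zero σ).2 hv
  have hss : σ (σ v) ≠ 0 := (map_ne_zero σ).2 hs
  refine ⟨_, ⟨-(σ (σ v) ^ 2 / v ^ 2), ?_, rfl⟩, ?_⟩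
  · simp only [nm, map_neg, map_div₀, map_pow, hσ.cube]
    field_simp
  · intro L hL hPL N hN hpts T hT
    rw [hpv] at hPL
    obtain ⟨w, hvw, rfl⟩ := n.exists_span_of_isLine hv hL hPL
    rw [n.linePoints_span hσ hvw, n.bb_image_pt] at hpts
    rw [hp', n.isTangentAt_line_iff hσ hN hvw hpts] at hT
    subst hT
    rintro x ⟨hx, hx'⟩
    rw [SetLike.mem_coe, mem_SigmaInf, ← n.hz] at hx'
    rw [SetLike.mem_coe, tanLine] at hx
    obtain ⟨a, b, rfl⟩ := Submodule.mem_span_pair.1 hx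
    simp only [map_add, map_smul, LinearEquiv.apply_symm_apply, Prod.snd_add, Prod.smul_snd,
      smul_eq_mul, mul_one, mul_zero, add_zero] at hx'
    subst hx'
    rw [zero_smul, zero_add]
    apply Submodule.smul_mem
    rw [mem_graphPlane, LinearEquiv.apply_symm_apply]
    refine ⟨?_, rfl⟩
    simp only [LinearMap.smul_apply, LinearMap.comp_apply, AlgHom.toLinearMap_apply, smul_eq_mul,
      map_div₀, map_sub, map_mul, map_pow, hσ.cube]
    field_simp
    ring

/-- At parameter 1 a plane of this family would have to contain all directions (σr - r, σ²r - r).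
The conditions for r and r² together give (σ²r - r)(σr - r) = 0. -/
theorem not_isTangentCover_family (hσ : IsFrob σ) :
    ¬ π.IsTangentCover (family σ n.Φ σ.toLinearMap) := by
  rintro ⟨-, h⟩
  obtain ⟨_, ⟨b, hb, rfl⟩, h⟩ := h (affPt σ n.Φ 1) (by
    change bbMap F K (affPt σ n.Φ 1) ∈ π.points
    rw [n.bbMap_eq_pt_iff.2 rfl]
    exact n.mem_points_iff.2 ⟨1, one_ne_zero, rfl⟩)
  rw [n.bbMap_eq_pt_iff.2 rfl] at h
  have key : ∀ r, σ r ≠ r → σ (σ r) - r = b * (σ (σ r) - σ r) := by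
    intro r hr
    have hvw : σ r * 1 - σ 1 * r ≠ 0 := by
      rw [map_one, mul_one, one_mul]; exact sub_ne_zero.2 hr
    obtain ⟨N, hN, hpts⟩ := n.exists_special_line hσ hr
    have hle := h _ (n.isLine_span hvw)
      ((n.pt_le_iff one_ne_zero).2 (Submodule.subset_span (by simp))) N hN
      (by rw [n.linePoints_span hσ hvw, n.bb_image_pt, hpts]) _
      ((n.isTangentAt_line_iff hσ hN hvw hpts _).2 rfl)
    have hmem := hle (x := n.Φ.symm ((σ r * 1 - σ 1 * r) / 1 ^ 2,
      (σ (σ r) * 1 - σ (σ 1) * r) / 1 ^ 2, 0)) ⟨Submodule.subset_span (by simp), by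
        rw [SetLike.mem_coe, mem_SigmaInf, ← n.hz, LinearEquiv.apply_symm_apply]⟩
    rw [mem_graphPlane, LinearEquiv.apply_symm_apply] at hmem
    simpa using hmem.1
  obtain ⟨r, hr⟩ := hσ.exists_ne
  have hr2 : σ (r ^ 2) ≠ r ^ 2 := by
    intro h2
    obtain ⟨a, ha⟩ := hσ.fixed _ h2
    have := hσ.powers_independent hr (s := -a) (t := 0) (m := 1) (by
      rw [map_neg, map_zero, map_one, ha]; ring)
    exact one_ne_zero this.2.2
  have k1 := key r hr
  have k2 := key (r ^ 2) hr2
  simp only [map_pow] at k2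
  have d2 : σ (σ r) - r ≠ 0 := sub_ne_zero.2 (hσ.ne₂ hr)
  apply hr
  have : (σ (σ r) - r) * (σ r - r) = 0 := by
    linear_combination (σ (σ r) + σ r) * k1 - k2
  exact sub_eq_zero.1 ((mul_eq_zero.1 this).resolve_left d2)

theorem isConicCover_iff (hσ : IsFrob σ) {X : Set (Submodule F (BB F K))} :
    π.IsConicCover X ↔ X = family σ n.Φ σ.toLinearMap := by
  constructor
  · rintro ⟨h1, h2⟩
    rcases (n.isCover_iff hσ).1 h1 with rfl | rfl
    · rfl
    · exact absurd (n.isTangentCover_family hσ) h2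
  · rintro rfl
    exact ⟨(n.isCover_iff hσ).2 (Or.inl rfl), n.not_isTangentCover_family hσ⟩

end NormalForm

end Splash

section Conics

variable {F K : Type*} [Field F] [Field K] [Algebra F K] {σ : K →ₐ[F] K} {π : Subplane F K}

/-! ### Ternary quadratic forms -/

/-- A function of three variables that is a quadratic form. -/
def IsTernaryQuadratic (f : K → K → K → K) : Prop :=
  ∃ A B C D E G : K, ∀ x y z,
    f x y z = A * x ^ 2 + B * y ^ 2 + C * z ^ 2 + D * (y * z) + E * (x * z) + G * (x * y)

theorem IsTernaryQuadratic.add {f g : K → K → K → K} (hf : IsTernaryQuadratic f)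
    (hg : IsTernaryQuadratic g) : IsTernaryQuadratic (fun x y z => f x y z + g x y z) := by
  obtain ⟨A, B, C, D, E, G, h⟩ := hf
  obtain ⟨A', B', C', D', E', G', h'⟩ := hg
  exact ⟨A + A', B + B', C + C', D + D', E + E', G + G', fun x y z => by
    beta_reduce; rw [h, h']; ring⟩

theorem IsTernaryQuadratic.mul_linear (c a₁ a₂ a₃ b₁ b₂ b₃ : K) :
    IsTernaryQuadratic (fun x y z =>
      c * ((a₁ * x + a₂ * y + a₃ * z) * (b₁ * x + b₂ * y + b₃ * z))) :=
  ⟨c * (a₁ * b₁), c * (a₂ * b₂), c * (a₃ * b₃), c * (a₂ * b₃ + a₃ * b₂), c * (a₁ * b₃ + a₃ * b₁),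
    c * (a₁ * b₂ + a₂ * b₁), fun x y z => by ring⟩

/-- A monomial of degree 2 is a product of two variables, hence becomes a product of two linear
forms. The six explicit coefficients make later identities accessible to direct computation. -/
theorem isTernaryQuadratic_aeval {p : MvPolynomial (Fin 3) F} (hp : p.IsHomogeneous 2)
    (a : Fin 3 → Fin 3 → K) :
    IsTernaryQuadratic (fun x y z =>
      MvPolynomial.aeval (fun i => a i 0 * x + a i 1 * y + a i 2 * z) p) := by
  rw [p.as_sum]
  refine Finset.sum_induction (fun d => MvPolynomial.monomial d (p.coeff d))
    (fun p => IsTernaryQuadratic (fun x y z =>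
      MvPolynomial.aeval (fun i => a i 0 * x + a i 1 * y + a i 2 * z) p)) ?_ ?_ ?_
  · intro p q h1 h2
    simpa only [map_add] using h1.add h2
  · exact ⟨0, 0, 0, 0, 0, 0, fun x y z => by simp⟩
  · intro d hd
    have hdeg : d 0 + d 1 + d 2 = 2 := by
      have := hp (MvPolynomial.mem_support_iff.1 hd)
      rw [Finsupp.weight_apply, Finsupp.sum_fintype _ _ (by simp), Fin.sum_univ_three] at this
      simpa using this
    have hprod : ∀ W : Fin 3 → K, d.prod (fun i k => W i ^ k)
        = W 0 ^ d 0 * W 1 ^ d 1 * W 2 ^ d 2 := by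
      intro W
      rw [Finsupp.prod_fintype _ _ (by simp), Fin.prod_univ_three]
    have key : ∃ i j : Fin 3, ∀ W : Fin 3 → K,
        W 0 ^ d 0 * W 1 ^ d 1 * W 2 ^ d 2 = W i * W j := by
      have h : (d 0 = 2 ∧ d 1 = 0 ∧ d 2 = 0) ∨ (d 0 = 0 ∧ d 1 = 2 ∧ d 2 = 0) ∨
          (d 0 = 0 ∧ d 1 = 0 ∧ d 2 = 2) ∨ (d 0 = 0 ∧ d 1 = 1 ∧ d 2 = 1) ∨
          (d 0 = 1 ∧ d 1 = 0 ∧ d 2 = 1) ∨ (d 0 = 1 ∧ d 1 = 1 ∧ d 2 = 0) := by omega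
      rcases h with ⟨h0, h1, h2⟩ | ⟨h0, h1, h2⟩ | ⟨h0, h1, h2⟩ | ⟨h0, h1, h2⟩ | ⟨h0, h1, h2⟩ |
        ⟨h0, h1, h2⟩ <;> rw [h0, h1, h2]
      · exact ⟨0, 0, fun W => by ring⟩
      · exact ⟨1, 1, fun W => by ring⟩
      · exact ⟨2, 2, fun W => by ring⟩
      · exact ⟨1, 2, fun W => by ring⟩
      · exact ⟨0, 2, fun W => by ring⟩
      · exact ⟨0, 1, fun W => by ring⟩
    obtain ⟨i, j, h⟩ := key
    have heq : (fun x y z : K => MvPolynomial.aeval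
        (fun i => a i 0 * x + a i 1 * y + a i 2 * z) (MvPolynomial.monomial d (p.coeff d)))
        = fun x y z => algebraMap F K (p.coeff d) * ((a i 0 * x + a i 1 * y + a i 2 * z) *
          (a j 0 * x + a j 1 * y + a j 2 * z)) := by
      funext x y z
      rw [MvPolynomial.aeval_monomial, hprod]
      exact congrArg _ (h fun i => a i 0 * x + a i 1 * y + a i 2 * z)
    rw [heq]
    exact IsTernaryQuadratic.mul_linear _ _ _ _ _ _ _

/-- A quadratic form over `F` that vanishes on `K³` is zero. -/
theorem IsFrob.eq_zero_of_aeval_eq_zero [Finite F] (hσ : IsFrob σ) {p : MvPolynomial (Fin 3) F}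
    (hp : p.IsHomogeneous 2) (h : ∀ W : Fin 3 → K, MvPolynomial.aeval W p = 0) : p = 0 := by
  have : Module.Finite F K := Module.finite_of_finrank_pos (by rw [hσ.finrank_eq]; omega)
  have : Finite K := Module.finite_of_finite F
  have := Fintype.ofFinite K
  -- The vanishing is tested over `K`, with at least 8 elements; `F` may have only two, too few for
  -- degree 2.
  have hcard : 2 < Fintype.card K := by
    rw [← Nat.card_eq_fintype_card, Module.natCard_eq_pow_finrank (K := F), hσ.finrank_eq]
    have : 1 < Nat.card F := Finite.one_lt_card
    calc 2 < 2 ^ 3 := by norm_num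
      _ ≤ _ := Nat.pow_le_pow_left this 3
  apply MvPolynomial.map_injective (algebraMap F K) (algebraMap F K).injective
  rw [map_zero]
  refine MvPolynomial.eq_zero_of_eval_zero_at_prod_finset _ (fun _ => Finset.univ) (fun i => ?_)
    (fun x _ => ?_)
  · calc _ ≤ _ := MvPolynomial.degreeOf_le_totalDegree _ _
      _ ≤ 2 := (hp.map _).totalDegree_le
      _ < _ := hcard
  · rw [MvPolynomial.eval_map]
    exact h x

/-! ### Quadratic forms of the subplane in normal form -/

namespace NormalForm

variable (n : NormalForm σ π)

/-- The value of a form of the subplane at a vector. -/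
def val (_ : NormalForm σ π) (p : MvPolynomial (Fin 3) F) (v : Fin 3 → K) : K :=
  MvPolynomial.aeval (π.frame.equivFun v) p

theorem exists_quadratic {p : MvPolynomial (Fin 3) F} (hp : p.IsHomogeneous 2) :
    IsTernaryQuadratic (fun x y z => n.val p (n.l • (x • n.e 0 + y • n.e 1 + z • n.e 2))) := by
  have heq : ∀ x y z : K, π.frame.equivFun (n.l • (x • n.e 0 + y • n.e 1 + z • n.e 2))
      = fun i => n.l * π.frame.equivFun (n.e 0) i * x + n.l * π.frame.equivFun (n.e 1) i * y
        + n.l * π.frame.equivFun (n.e 2) i * z := by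
    intro x y z
    ext i
    simp only [map_add, map_smul, Pi.add_apply, Pi.smul_apply, smul_eq_mul]
    ring
  simp only [val, heq]
  exact isTernaryQuadratic_aeval hp (fun i j => n.l * π.frame.equivFun (n.e j) i)

theorem exists_comb (v : Fin 3 → K) :
    ∃ x y z : K, v = n.l • (x • n.e 0 + y • n.e 1 + z • n.e 2) := by
  obtain ⟨x, y, z, h⟩ := basis_comb_exists n.e (n.l⁻¹ • v)
  exact ⟨x, y, z, by rw [← h, smul_inv_smul₀ n.l_ne]⟩

theorem val_smul {p : MvPolynomial (Fin 3) F} (hp : p.IsHomogeneous 2) (c : K) (v : Fin 3 → K) :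
    n.val p (c • v) = c ^ 2 * n.val p v := by
  obtain ⟨x, y, z, rfl⟩ := n.exists_comb v
  obtain ⟨A, B, C, D, E, G, h⟩ := n.exists_quadratic hp
  have : c • n.l • (x • n.e 0 + y • n.e 1 + z • n.e 2)
      = n.l • ((c * x) • n.e 0 + (c * y) • n.e 1 + (c * z) • n.e 2) := by
    module
  beta_reduce at h
  rw [this, h, h]
  ring

theorem mk_mem_extension (C : π.Conic) {v : Fin 3 → K} (hv : v ≠ 0) :
    Projectivization.mk K v hv ∈ C.extension ↔ n.val C.poly v = 0 := by
  obtain ⟨a, ha⟩ := Projectivization.exists_smul_eq_mk_rep K v hv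
  change n.val C.poly (Projectivization.mk K v hv).rep = 0 ↔ _
  rw [← ha, Units.smul_def, n.val_smul C.homogeneous, mul_eq_zero]
  simp

theorem pt_mem_extension (C : π.Conic) {u : K} (hu : u ≠ 0) :
    n.pt u ∈ C.extension ↔ n.val C.poly (n.l • n.iota u) = 0 := by
  rw [← n.mk_eq_pt hu (smul_ne_zero n.l_ne (n.iota_ne_zero hu)) rfl, n.mk_mem_extension]

theorem val_iota_mem (p : MvPolynomial (Fin 3) F) (u : K) :
    ∃ a : F, algebraMap F K a = n.val p (n.l • n.iota u) := by
  have hsum : ∑ i, (n.θ.repr u i) • n.θ i = u := n.θ.sum_repr u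
  have h0 := n.sum_frame (fun i => n.θ.repr u i)
  rw [hsum] at h0
  have : π.frame.equivFun (n.l • n.iota u) = algebraMap F K ∘ fun i => n.θ.repr u i := by
    rw [← h0, ← π.frame.equivFun_symm_apply, LinearEquiv.apply_symm_apply]
    rfl
  exact ⟨MvPolynomial.aeval (fun i => n.θ.repr u i) p, by
    rw [val, this, MvPolynomial.aeval_algebraMap_apply]⟩

theorem eq_zero_of_val_eq_zero [Finite F] (hσ : IsFrob σ) {p : MvPolynomial (Fin 3) F}
    (hp : p.IsHomogeneous 2) (h : ∀ v, n.val p v = 0) : p = 0 :=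
  hσ.eq_zero_of_aeval_eq_zero hp fun W => by
    have := h (π.frame.equivFun.symm W)
    rwa [val, LinearEquiv.apply_symm_apply] at this

/-- In the normal form, the quadratic form `p` is `a y z + σ a x z + σ² a x y`. -/
def HasForm (p : MvPolynomial (Fin 3) F) (a : K) : Prop :=
  ∀ x y z : K, n.val p (n.l • (x • n.e 0 + y • n.e 1 + z • n.e 2))
    = a * (y * z) + σ a * (x * z) + σ (σ a) * (x * y)

variable {n}

theorem HasForm.smul {p : MvPolynomial (Fin 3) F} {a : K} (h : n.HasForm p a) (c : F) :
    n.HasForm (c • p) (algebraMap F K c * a) := by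
  intro x y z
  have := h x y z
  simp only [val] at this ⊢
  rw [map_smul, this, Algebra.smul_def]
  simp only [map_mul, AlgHom.commutes]
  ring

theorem HasForm.eq [Finite F] (hσ : IsFrob σ) {p p' : MvPolynomial (Fin 3) F} {a : K}
    (hp : p.IsHomogeneous 2) (hp' : p'.IsHomogeneous 2) (h : n.HasForm p a)
    (h' : n.HasForm p' a) : p = p' := by
  rw [← sub_eq_zero]
  refine n.eq_zero_of_val_eq_zero hσ (hp.sub hp') fun v => ?_
  obtain ⟨x, y, z, rfl⟩ := n.exists_comb v
  have h1 := h x y z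
  have h2 := h' x y z
  simp only [val] at h1 h2 ⊢
  rw [map_sub, h1, h2, sub_self]

theorem HasForm.ne_zero [Finite F] (hσ : IsFrob σ) {C : π.Conic} {a : K}
    (h : n.HasForm C.poly a) : a ≠ 0 := by
  rintro rfl
  refine C.ne_zero (n.eq_zero_of_val_eq_zero hσ C.homogeneous fun v => ?_)
  obtain ⟨x, y, z, rfl⟩ := n.exists_comb v
  rw [h]
  simp

theorem HasForm.val_iota {p : MvPolynomial (Fin 3) F} {a : K} (h : n.HasForm p a) (hσ : IsFrob σ)
    (u : K) : n.val p (n.l • n.iota u) = tr σ (a * (σ u * σ (σ u))) := by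
  rw [iota, h, tr]
  simp only [map_mul, hσ.cube]
  ring

theorem HasForm.pt_mem {C : π.Conic} {a : K} (h : n.HasForm C.poly a) (hσ : IsFrob σ)
    {u : K} (hu : u ≠ 0) : n.pt u ∈ C.extension ↔ tr σ (a * (σ u * σ (σ u))) = 0 := by
  rw [n.pt_mem_extension C hu, h.val_iota hσ]

variable (n)

/-- Expanding tr(a σ(u) σ²(u)) at u = Σ wᵢθᵢ gives a quadratic form in the wᵢ whose coefficients are
traces, hence in `F`. -/
theorem exists_hasForm (hσ : IsFrob σ) (a : K) :
    ∃ p : MvPolynomial (Fin 3) F, p.IsHomogeneous 2 ∧ n.HasForm p a := by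
  choose t ht using fun i j : Fin 3 => hσ.exists_tr (a * (σ (n.θ i) * σ (σ (n.θ j))))
  refine ⟨∑ i, ∑ j, MvPolynomial.C (t i j) * (MvPolynomial.X i * MvPolynomial.X j), ?_, ?_⟩
  · refine MvPolynomial.IsHomogeneous.sum _ _ _ fun i _ =>
      MvPolynomial.IsHomogeneous.sum _ _ _ fun j _ => ?_
    exact (MvPolynomial.isHomogeneous_C _ _).mul
      ((MvPolynomial.isHomogeneous_X _ _).mul (MvPolynomial.isHomogeneous_X _ _))
  · intro x y z
    set v := n.l • (x • n.e 0 + y • n.e 1 + z • n.e 2) with hv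
    set W := π.frame.equivFun v with hW
    have hsum : ∑ i, W i • π.frame i = v := π.frame.sum_equivFun v
    simp only [n.frame_eq, Fin.sum_univ_three] at hsum
    obtain ⟨h0, h1, h2⟩ := basis_comb_inj n.e
      (a := W 0 * n.θ 0 + W 1 * n.θ 1 + W 2 * n.θ 2)
      (b := W 0 * σ (n.θ 0) + W 1 * σ (n.θ 1) + W 2 * σ (n.θ 2))
      (c := W 0 * σ (σ (n.θ 0)) + W 1 * σ (σ (n.θ 1)) + W 2 * σ (σ (n.θ 2)))
      (a' := x) (b' := y) (c' := z) (by
        apply smul_right_injective _ n.l_ne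
        change n.l • _ = n.l • _
        rw [← hv, ← hsum]
        module)
    rw [val, ← hW]
    simp only [Fin.sum_univ_three, map_add, map_mul, MvPolynomial.aeval_C, MvPolynomial.aeval_X,
      ht, tr, hσ.cube]
    rw [← h0, ← h1, ← h2]
    ring

end NormalForm

end Conics

section SpecialConics

variable {F K : Type*} [Field F] [Field K] [Algebra F K] {σ : K →ₐ[F] K} {π : Subplane F K}

namespace NormalForm

variable (n : NormalForm σ π)

/-! ### The fixed points of the stabilizer -/

theorem iota_add (u v : K) : n.iota (u + v) = n.iota u + n.iota v := by
  simp only [iota, map_add]; module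

theorem iota_mul (a : F) (u : K) :
    n.iota (algebraMap F K a * u) = algebraMap F K a • n.iota u := by
  simp only [iota, map_mul, AlgHom.commutes]; module

theorem iota_powers (hσ : IsFrob σ) {r : K} (hr : σ r ≠ r) {a b c : K}
    (h : a • n.iota 1 + b • n.iota r + c • n.iota (r ^ 2) = 0) : a = 0 ∧ b = 0 ∧ c = 0 := by
  obtain ⟨h0, h1, h2⟩ := basis_comb_inj n.e (a := a + b * r + c * r ^ 2)
    (b := a + b * σ r + c * (σ r) ^ 2) (c := a + b * σ (σ r) + c * (σ (σ r)) ^ 2)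
    (a' := 0) (b' := 0) (c' := 0) (by
      simp only [zero_smul, add_zero]
      rw [← h]
      simp only [iota, map_one, map_pow]
      module)
  exact hσ.vandermonde_eq_zero hr h0 h1 h2

/-- A homography that fixes the subplane and the line at infinity is, up to a scalar, the
multiplication of the parameter by a constant on three independent points. -/
theorem stabilizer_iota (hσ : IsFrob σ) {g : (Fin 3 → K) ≃ₗ[K] (Fin 3 → K)}
    (hg : π.IsStabilizer g) {r : K} (hr : σ r ≠ r) :
    ∃ m d : K, g (n.iota 1) = m • n.iota d ∧ g (n.iota r) = m • n.iota (d * r) ∧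
      g (n.iota (r ^ 2)) = m • n.iota (d * r ^ 2) := by
  have hinf : ∀ w : Fin 3 → K, w 2 = 0 → g w 2 = 0 := by
    intro w hw
    rw [← mem_lineInf_iff] at hw ⊢
    rw [← hg.2]
    exact Submodule.mem_map_of_mem hw
  set c := g (n.e 0) 2 with hc
  have hz : ∀ u, g (n.iota u) 2 = c * u := by
    intro u
    simp only [iota, map_add, map_smul, Pi.add_apply, Pi.smul_apply, smul_eq_mul,
      hinf _ n.z1, hinf _ n.z2, ← hc]
    ring
  have hpt : ∀ u, u ≠ 0 → ∃ l u', u' ≠ 0 ∧ l ≠ 0 ∧ g (n.iota u) = l • n.iota u' ∧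
      l * u' = c * u := by
    intro u hu
    have h1 : Projectivization.map g.toLinearMap g.injective (n.pt u) ∈ π.points := by
      rw [← hg.1]
      exact ⟨_, n.mem_points_iff.2 ⟨u, hu, rfl⟩, rfl⟩
    obtain ⟨u', hu', h⟩ := n.mem_points_iff.1 h1
    have hs : Submodule.span K {g (n.iota u)} = Submodule.span K {n.iota u'} := by
      have := congrArg Projectivization.submodule h
      rw [n.pt_submodule hu', ← n.mk_eq_pt hu (n.iota_ne_zero hu) (one_smul _ _).symm,
        Projectivization.map_mk, Projectivization.submodule_mk] at this
      exact this
    have hm : g (n.iota u) ∈ Submodule.span K {n.iota u'} := by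
      rw [← hs]; exact Submodule.mem_span_singleton_self _
    obtain ⟨l, hl⟩ := Submodule.mem_span_singleton.1 hm
    refine ⟨l, u', hu', ?_, hl.symm, ?_⟩
    · rintro rfl
      rw [zero_smul] at hl
      exact n.iota_ne_zero hu (g.injective (by rw [← hl, map_zero]))
    · rw [← hz, ← hl, Pi.smul_apply, n.iota_apply_two, smul_eq_mul]
  have hr0 : r ≠ 0 := by rintro rfl; exact hr (map_zero σ)
  -- A fourth point completes those of 1, r, r² to a frame. Its image forces the three scalars `l0`,
  -- `l1`, `l2` to be `F`-multiples of the single scalar `l`, and elements of `F` can be moved into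
  -- the parameter.
  have hs0 : 1 + r + r ^ 2 ≠ 0 := by
    intro h
    have := hσ.powers_independent hr (s := 1) (t := 1) (m := 1) (by
      rw [map_one]; linear_combination h)
    exact one_ne_zero this.1
  obtain ⟨l0, v0, hv0, hl0, g0, c0⟩ := hpt 1 one_ne_zero
  obtain ⟨l1, v1, hv1, hl1, g1, c1⟩ := hpt r hr0
  obtain ⟨l2, v2, hv2, hl2, g2, c2⟩ := hpt (r ^ 2) (pow_ne_zero 2 hr0)
  obtain ⟨l, v, hv, hl, gs, cs⟩ := hpt _ hs0
  have hind : ∀ a b d : K, a • n.iota v0 + b • n.iota v1 + d • n.iota v2 = 0 →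
      a = 0 ∧ b = 0 ∧ d = 0 := by
    intro a b d h
    have e0 : g ((a / l0) • n.iota 1) = a • n.iota v0 := by
      rw [map_smul, g0, smul_smul, div_mul_cancel₀ _ hl0]
    have e1 : g ((b / l1) • n.iota r) = b • n.iota v1 := by
      rw [map_smul, g1, smul_smul, div_mul_cancel₀ _ hl1]
    have e2 : g ((d / l2) • n.iota (r ^ 2)) = d • n.iota v2 := by
      rw [map_smul, g2, smul_smul, div_mul_cancel₀ _ hl2]
    rw [← e0, ← e1, ← e2, ← map_add, ← map_add] at h
    obtain ⟨h0, h1, h2⟩ := n.iota_powers hσ hr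
      (g.injective (h.trans (map_zero g).symm))
    exact ⟨(div_eq_zero_iff.1 h0).resolve_right hl0, (div_eq_zero_iff.1 h1).resolve_right hl1,
      (div_eq_zero_iff.1 h2).resolve_right hl2⟩
  have hli : LinearIndependent F ![v0, v1, v2] := by
    rw [Fintype.linearIndependent_iff]
    intro a ha
    simp only [Fin.sum_univ_three, Algebra.smul_def] at ha
    have hb : algebraMap F K (a 0) * v0 + algebraMap F K (a 1) * v1
        + algebraMap F K (a 2) * v2 = 0 := ha
    have := congrArg n.iota hb
    rw [n.iota_add, n.iota_add, n.iota_mul, n.iota_mul, n.iota_mul] at this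
    obtain ⟨h0, h1, h2⟩ := hind _ _ _ (this.trans (by simp [iota]))
    rw [map_eq_zero] at h0 h1 h2
    intro i; fin_cases i <;> assumption
  have htop := hli.span_eq_top_of_card_eq_finrank (by simp [hσ.finrank_eq])
  have hmem : v ∈ Submodule.span F (Set.range ![v0, v1, v2]) := by rw [htop]; trivial
  obtain ⟨a, ha⟩ := (Submodule.mem_span_range_iff_exists_fun F).1 hmem
  simp only [Fin.sum_univ_three, Algebra.smul_def] at ha
  have hb : algebraMap F K (a 0) * v0 + algebraMap F K (a 1) * v1
      + algebraMap F K (a 2) * v2 = v := ha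
  have gs' : g (n.iota (1 + r + r ^ 2)) = l0 • n.iota v0 + l1 • n.iota v1 + l2 • n.iota v2 := by
    rw [n.iota_add, n.iota_add, map_add, map_add, g0, g1, g2]
  rw [gs, ← hb, n.iota_add, n.iota_add, n.iota_mul, n.iota_mul, n.iota_mul] at gs'
  obtain ⟨k0, k1, k2⟩ := hind (l * algebraMap F K (a 0) - l0) (l * algebraMap F K (a 1) - l1)
    (l * algebraMap F K (a 2) - l2) (by
      rw [← sub_eq_zero] at gs'
      rw [← gs']
      module)
  rw [sub_eq_zero] at k0 k1 k2
  have aux : ∀ (b : F) (m w u : K), l * algebraMap F K b = m → m * w = c * u →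
      m • n.iota w = l • n.iota (c / l * u) := by
    rintro b m w u rfl h
    have : c / l * u = algebraMap F K b * w := by
      field_simp; linear_combination -h
    rw [this, n.iota_mul, smul_smul]
  refine ⟨l, c / l, ?_, ?_, ?_⟩
  · rw [g0, aux _ _ _ _ k0 c0, mul_one]
  · rw [g1, aux _ _ _ _ k1 c1]
  · rw [g2, aux _ _ _ _ k2 c2]

/-- The vectors of parameters 1, r, r² span the space over `K`, so the homography is diagonal with
entries md, mσ(d), mσ²(d). Lagrange coefficients express each basis vector through the three. -/
theorem stabilizer_basis (hσ : IsFrob σ) {g : (Fin 3 → K) ≃ₗ[K] (Fin 3 → K)}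
    (hg : π.IsStabilizer g) (j : Fin 3) : ∃ k : K, g (n.e j) = k • n.e j := by
  obtain ⟨r, hr⟩ := hσ.exists_ne
  obtain ⟨m, d, h0, h1, h2⟩ := n.stabilizer_iota hσ hg hr
  have key : ∀ x y z a b c : K, a + b * r + c * r ^ 2 = x → a + b * σ r + c * σ r ^ 2 = y →
      a + b * σ (σ r) + c * σ (σ r) ^ 2 = z →
      g (x • n.e 0 + y • n.e 1 + z • n.e 2)
        = m • ((d * x) • n.e 0 + (σ d * y) • n.e 1 + (σ (σ d) * z) • n.e 2) := by
    rintro _ _ _ a b c rfl rfl rfl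
    have : (a + b * r + c * r ^ 2) • n.e 0 + (a + b * σ r + c * σ r ^ 2) • n.e 1
        + (a + b * σ (σ r) + c * σ (σ r) ^ 2) • n.e 2
        = a • n.iota 1 + b • n.iota r + c • n.iota (r ^ 2) := by
      simp only [iota, map_one, map_pow]
      module
    rw [this, map_add, map_add, map_smul, map_smul, map_smul, h0, h1, h2]
    simp only [iota, map_mul, map_pow]
    module
  have hr1 : σ (σ r) ≠ σ r := hσ.ne₁₂ hr
  have hr2 : σ (σ (σ r)) ≠ σ (σ r) := by rw [hσ.cube]; exact (hσ.ne₂ hr).symm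
  fin_cases j
  · obtain ⟨a, b, c, e0, e1, e2⟩ := hσ.exists_lagrange hr
    have := key _ _ _ a b c e0 e1 e2
    exact ⟨m * d, by simpa [smul_smul] using this⟩
  · obtain ⟨a, b, c, e0, e1, e2⟩ := hσ.exists_lagrange hr1
    rw [hσ.cube] at e2
    have := key _ _ _ a b c e2 e0 e1
    exact ⟨m * σ d, by simpa [smul_smul] using this⟩
  · obtain ⟨a, b, c, e0, e1, e2⟩ := hσ.exists_lagrange hr2
    rw [hσ.cube] at e1 e2
    have := key _ _ _ a b c e1 e2 e0
    exact ⟨m * σ (σ d), by simpa [smul_smul] using this⟩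

theorem isFixedPoint_basis (hσ : IsFrob σ) (j : Fin 3) :
    π.IsFixedPoint (Projectivization.mk K (n.e j) (n.e.ne_zero j)) := by
  intro g hg
  obtain ⟨k, hk⟩ := n.stabilizer_basis hσ hg j
  rw [Projectivization.map_mk, Projectivization.mk_eq_mk_iff']
  exact ⟨k, hk.symm⟩

/-- The homography that multiplies the parameter of the points of the subplane by `r`. -/
theorem exists_stabilizer {r : K} (hr0 : r ≠ 0) :
    ∃ g : (Fin 3 → K) ≃ₗ[K] (Fin 3 → K), π.IsStabilizer g ∧ g (n.e 0) = r • n.e 0 ∧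
      g (n.e 1) = σ r • n.e 1 ∧ g (n.e 2) = σ (σ r) • n.e 2 := by
  have hs : σ r ≠ 0 := (map_ne_zero σ).2 hr0
  have hss : σ (σ r) ≠ 0 := (map_ne_zero σ).2 hs
  let c : Fin 3 → Kˣ := ![Units.mk0 r hr0, Units.mk0 _ hs, Units.mk0 _ hss]
  let g := n.e.equiv (n.e.unitsSMul c) (Equiv.refl _)
  have hg : ∀ j, g (n.e j) = (c j : K) • n.e j := by
    intro j
    rw [Module.Basis.equiv_apply, Module.Basis.unitsSMul_apply]
    rfl
  have g0 : g (n.e 0) = r • n.e 0 := hg 0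
  have g1 : g (n.e 1) = σ r • n.e 1 := hg 1
  have g2 : g (n.e 2) = σ (σ r) • n.e 2 := hg 2
  have hi : ∀ u, g (n.iota u) = n.iota (r * u) := by
    intro u
    simp only [iota, map_add, map_smul, g0, g1, g2, map_mul]
    module
  have hpt : ∀ u, u ≠ 0 → Projectivization.map g.toLinearMap g.injective (n.pt u)
      = n.pt (r * u) := by
    intro u hu
    rw [← n.mk_eq_pt hu (n.iota_ne_zero hu) (one_smul _ _).symm, Projectivization.map_mk]
    exact n.mk_eq_pt (mul_ne_zero hr0 hu) _ ((hi u).trans (one_smul _ _).symm)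
  have hz : ∀ w, g w 2 = r * w 2 := by
    intro w
    obtain ⟨x, y, z, rfl⟩ := basis_comb_exists n.e w
    simp [g0, g1, g2, n.z0, n.z1, n.z2]
    ring
  refine ⟨g, ⟨?_, ?_⟩, g0, g1, g2⟩
  · ext P
    constructor
    · rintro ⟨_, hQ, rfl⟩
      obtain ⟨u, hu, rfl⟩ := n.mem_points_iff.1 hQ
      rw [hpt u hu]
      exact n.mem_points_iff.2 ⟨_, mul_ne_zero hr0 hu, rfl⟩
    · intro hP
      obtain ⟨u, hu, rfl⟩ := n.mem_points_iff.1 hP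
      have hu' : r⁻¹ * u ≠ 0 := mul_ne_zero (inv_ne_zero hr0) hu
      exact ⟨_, n.mem_points_iff.2 ⟨_, hu', rfl⟩, by rw [hpt _ hu', mul_inv_cancel_left₀ hr0]⟩
  · ext w
    rw [Submodule.mem_map, mem_lineInf_iff]
    constructor
    · rintro ⟨v, hv, rfl⟩
      rw [mem_lineInf_iff] at hv
      change g v 2 = 0
      rw [hz, hv, mul_zero]
    · intro hw
      refine ⟨g.symm w, ?_, g.apply_symm_apply w⟩
      have := hz (g.symm w)
      rw [g.apply_symm_apply, hw] at this
      rw [mem_lineInf_iff]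
      exact (mul_eq_zero.1 this.symm).resolve_left hr0

/-- Multiplication of the parameter by an r outside `F` has the distinct eigenvalues r, σr, σ²r, so
it already fixes nothing but the three base points. -/
theorem eq_basis_of_isFixedPoint (hσ : IsFrob σ) {E : Pt K} (hE : π.IsFixedPoint E) :
    ∃ j, E = Projectivization.mk K (n.e j) (n.e.ne_zero j) := by
  obtain ⟨r, hr⟩ := hσ.exists_ne
  have hr0 : r ≠ 0 := by rintro rfl; exact hr (map_zero σ)
  obtain ⟨g, hg, g0, g1, g2⟩ := n.exists_stabilizer hr0
  have h := hE g hg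
  induction E using Projectivization.ind with
  | h v hv =>
    obtain ⟨x, y, z, rfl⟩ := basis_comb_exists n.e v
    rw [Projectivization.map_mk, Projectivization.mk_eq_mk_iff'] at h
    obtain ⟨m, hm⟩ := h
    obtain ⟨h0, h1, h2⟩ := basis_comb_inj n.e (a := m * x) (b := m * y) (c := m * z)
      (a' := r * x) (b' := σ r * y) (c' := σ (σ r) * z) (by
        simp only [LinearEquiv.coe_coe, map_add, map_smul, g0, g1, g2] at hm
        calc _ = m • (x • n.e 0 + y • n.e 1 + z • n.e 2) := by module
          _ = _ := hm
          _ = _ := by module)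
    have d1 := hr
    have d2 := hσ.ne₂ hr
    have d3 := hσ.ne₁₂ hr
    simp only [Projectivization.mk_eq_mk_iff']
    have hx : x = 0 ∨ m = r := by
      rcases eq_or_ne x 0 with hx | hx
      · exact Or.inl hx
      · exact Or.inr (mul_right_cancel₀ hx h0)
    have hy : y = 0 ∨ m = σ r := by
      rcases eq_or_ne y 0 with hx | hx
      · exact Or.inl hx
      · exact Or.inr (mul_right_cancel₀ hx h1)
    have hz : z = 0 ∨ m = σ (σ r) := by
      rcases eq_or_ne z 0 with hx | hx
      · exact Or.inl hx
      · exact Or.inr (mul_right_cancel₀ hx h2)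
    rcases hx with rfl | rfl
    · rcases hy with rfl | rfl
      · exact ⟨2, z, by simp⟩
      · rcases hz with rfl | h
        · exact ⟨1, y, by simp⟩
        · exact absurd h.symm d3
    · rcases hy with rfl | h
      · rcases hz with rfl | h
        · exact ⟨0, x, by simp⟩
        · exact absurd h.symm d2
      · exact absurd h.symm d1

/-! ### Special conics -/

/-- Passing through the three base points removes the squares. At the vector of parameter w⁻¹ the
rest has the value (Dw + Eσ(w) + Gσ²(w))/N(w), which must lie in `F`. Invariance under `σ` for all w
makes D, E, G conjugate. -/
theorem isSpecial_iff (hσ : IsFrob σ) (C : π.Conic) :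
    C.IsSpecial ↔ ∃ a, n.HasForm C.poly a := by
  have hval : ∀ j, n.val C.poly (n.l • n.e j) = 0 ↔
      Projectivization.mk K (n.e j) (n.e.ne_zero j) ∈ C.extension := by
    intro j
    rw [n.mk_mem_extension, n.val_smul C.homogeneous, mul_eq_zero, or_iff_right]
    exact pow_ne_zero 2 n.l_ne
  constructor
  · intro h
    obtain ⟨A, B, C', D, E, G, hq⟩ := n.exists_quadratic C.homogeneous
    beta_reduce at hq
    have hj := fun j => (hval j).2 (h _ (n.isFixedPoint_basis hσ j))
    have hA : A = 0 := by
      have := hq 1 0 0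
      simpa [hj 0] using this.symm
    have hB : B = 0 := by
      have := hq 0 1 0
      simpa [hj 1] using this.symm
    have hC : C' = 0 := by
      have := hq 0 0 1
      simpa [hj 2] using this.symm
    subst hA hB hC
    simp only [zero_mul, zero_add] at hq
    have hinv : ∀ w, (D - σ G) * w + (E - σ D) * σ w + (G - σ E) * σ (σ w) = 0 := by
      intro w
      rcases eq_or_ne w 0 with rfl | hw
      · simp
      have hs : σ w ≠ 0 := (map_ne_zero σ).2 hw
      have hss : σ (σ w) ≠ 0 := (map_ne_zero σ).2 hs
      obtain ⟨a, ha⟩ := n.val_iota_mem C.poly w⁻¹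
      rw [iota, hq] at ha
      have ha' := congrArg σ ha
      rw [AlgHom.commutes, ha] at ha'
      simp only [map_add, map_mul, map_inv₀, hσ.cube] at ha'
      field_simp at ha'
      linear_combination ha'
    obtain ⟨h0, h1, h2⟩ := hσ.conj_linearIndependent hinv
    rw [sub_eq_zero] at h0 h1 h2
    exact ⟨D, fun x y z => by rw [hq, h2, h1]⟩
  · rintro ⟨a, ha⟩ E hE
    obtain ⟨j, rfl⟩ := n.eq_basis_of_isFixedPoint hσ hE
    rw [← hval]
    fin_cases j
    · simpa using ha 1 0 0
    · simpa using ha 0 1 0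
    · simpa using ha 0 0 1

variable {n}

/-- On the line, at u = s + tr, the form is s²tr(a) + st·tr(a(σr + σ²r)) + t²tr(a σ(r)σ²(r)). Having
1 as its only zero forces the first two traces to vanish, which determines a up to a factor in `F`.
Conversely the third trace is then nonzero. -/
theorem HasForm.isTangentTo_iff [Finite F] (hσ : IsFrob σ) {C : π.Conic} {a : K}
    (h : n.HasForm C.poly a) {r : K} (hr : σ r ≠ r) :
    C.IsTangentTo (Submodule.span K {n.iota 1, n.iota r}) (n.pt 1) ↔
      ∃ c : F, c ≠ 0 ∧ a = algebraMap F K c * (σ r - σ (σ r)) := by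
  have hvw : σ r * 1 - σ 1 * r ≠ 0 := by
    rw [map_one, mul_one, one_mul]; exact sub_ne_zero.2 hr
  have d1 := sub_ne_zero.2 hr
  have d2 := sub_ne_zero.2 (hσ.ne₂ hr)
  have d3 := sub_ne_zero.2 (hσ.ne₁₂ hr)
  have hiff : C.IsTangentTo (Submodule.span K {n.iota 1, n.iota r}) (n.pt 1) ↔
      n.pt 1 ∈ C.extension ∧ ∀ u ∈ lineSet F 1 r, n.pt u ∈ C.extension → n.pt u = n.pt 1 := by
    rw [Subplane.Conic.IsTangentTo, n.linePoints_span hσ hvw]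
    constructor
    · intro h
      refine ⟨?_, fun u hu hu' => ?_⟩
      · have : n.pt 1 ∈ C.points ∩ n.pt '' lineSet F 1 r := by rw [h]; rfl
        exact this.1.2
      · have : n.pt u ∈ C.points ∩ n.pt '' lineSet F 1 r :=
          ⟨⟨n.mem_points_iff.2 ⟨u, hu.1, rfl⟩, hu'⟩, u, hu, rfl⟩
        rwa [h] at this
    · rintro ⟨h1, h2⟩
      ext Q
      constructor
      · rintro ⟨⟨-, hQ⟩, u, hu, rfl⟩
        exact h2 u hu hQ
      · rintro rfl
        exact ⟨⟨n.mem_points_iff.2 ⟨1, one_ne_zero, rfl⟩, h1⟩, 1,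
          ⟨one_ne_zero, 1, 0, by simp⟩, rfl⟩
  rw [hiff, h.pt_mem hσ one_ne_zero]
  have hexp : ∀ s t : F, tr σ (a * (σ (algebraMap F K s * 1 + algebraMap F K t * r)
        * σ (σ (algebraMap F K s * 1 + algebraMap F K t * r))))
      = algebraMap F K s ^ 2 * tr σ a + algebraMap F K s * algebraMap F K t
        * tr σ (a * (σ r + σ (σ r))) + algebraMap F K t ^ 2 * tr σ (a * (σ r * σ (σ r))) := by
    intro s t
    simp only [tr, map_mul, map_add, map_one, AlgHom.commutes, hσ.cube]
    ring
  constructor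
  · rintro ⟨h1, h2⟩
    have ha : tr σ a = 0 := by simpa using h1
    obtain ⟨B, hB⟩ := hσ.exists_tr (a * (σ r + σ (σ r)))
    obtain ⟨G, hG⟩ := hσ.exists_tr (a * (σ r * σ (σ r)))
    have hB0 : B = 0 := by
      by_contra hB0
      -- If B ≠ 0, then (s : t) = (-G : B) is a second zero of stB + t²G.
      have hu : algebraMap F K (-G) * 1 + algebraMap F K B * r ≠ 0 := by
        intro h0
        have := hσ.powers_independent hr (s := -G) (t := B) (m := 0) (by
          rw [map_zero]; linear_combination h0)
        exact hB0 this.2.1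
      have := h2 _ ⟨hu, -G, B, rfl⟩ ((h.pt_mem hσ hu).2 (by
        rw [hexp, ha, ← hB, ← hG, map_neg]; ring))
      refine n.pt_ne ?_ this.symm
      simp only [map_add, map_mul, map_one, AlgHom.commutes]
      have : algebraMap F K B * (σ r - r) ≠ 0 := mul_ne_zero ((map_ne_zero _).2 hB0) d1
      convert this using 1
      ring
    rw [hB0, map_zero] at hB
    simp only [tr, map_mul, map_add, hσ.cube] at ha hB
    have hA : a * (r - σ (σ r)) + σ a * (σ r - σ (σ r)) = 0 := by
      linear_combination (r + σ r) * ha + hB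
    have hd : σ r - σ (σ r) ≠ 0 := by
      rw [← neg_ne_zero, neg_sub]; exact d3
    obtain ⟨c, hc⟩ := hσ.fixed (a / (σ r - σ (σ r))) (by
      rw [map_div₀, map_sub, hσ.cube]
      have : σ (σ r) - r ≠ 0 := d2
      field_simp
      linear_combination hA)
    have hac : a = algebraMap F K c * (σ r - σ (σ r)) := by
      rw [hc]; field_simp
    refine ⟨c, ?_, hac⟩
    rintro rfl
    exact h.ne_zero hσ (by rw [hac, map_zero, zero_mul])
  · rintro ⟨c, hc, rfl⟩
    have ht : tr σ (algebraMap F K c * (σ r - σ (σ r))) = 0 := by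
      simp only [tr, map_mul, map_sub, AlgHom.commutes, hσ.cube]; ring
    refine ⟨by simpa using ht, ?_⟩
    rintro u ⟨hu, s, t, rfl⟩ hQ
    rw [h.pt_mem hσ hu, hexp, ht] at hQ
    have e1 : tr σ (algebraMap F K c * (σ r - σ (σ r)) * (σ r + σ (σ r))) = 0 := by
      simp only [tr, map_mul, map_sub, map_add, AlgHom.commutes, hσ.cube]; ring
    have e2 : tr σ (algebraMap F K c * (σ r - σ (σ r)) * (σ r * σ (σ r)))
        = algebraMap F K c * ((σ r - r) * (σ (σ r) - r) * (σ r - σ (σ r))) := by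
      simp only [tr, map_mul, map_sub, AlgHom.commutes, hσ.cube]; ring
    rw [e1, e2] at hQ
    have hne : algebraMap F K c * ((σ r - r) * (σ (σ r) - r) * (σ r - σ (σ r))) ≠ 0 := by
      refine mul_ne_zero ((map_ne_zero _).2 hc) (mul_ne_zero (mul_ne_zero d1 d2) ?_)
      rw [← neg_ne_zero, neg_sub]; exact d3
    have ht0 : algebraMap F K t = 0 := by
      have : algebraMap F K t ^ 2 = 0 := mul_right_cancel₀ hne (by linear_combination hQ)
      exact pow_eq_zero_iff (two_ne_zero) |>.1 this
    refine n.pt_eq_of_ratio hu one_ne_zero ?_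
    rw [ht0]
    simp

/-- The points of a special conic that is tangent at `1` to the line through `1` and `r`. -/
theorem HasForm.points_eq (hσ : IsFrob σ) {C : π.Conic} {r : K} (hr : σ r ≠ r)
    (h : n.HasForm C.poly (σ r - σ (σ r))) :
    C.points = n.pt '' ((·⁻¹) '' lineSet F 1 r) := by
  have d1 := sub_ne_zero.2 hr
  have d2 := sub_ne_zero.2 (hσ.ne₂ hr)
  have d3 := sub_ne_zero.2 (hσ.ne₁₂ hr)
  have key : ∀ v, v ≠ 0 → (n.pt v⁻¹ ∈ C.extension ↔ v ∈ lineSet F 1 r) := by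
    intro v hv
    have hs : σ v ≠ 0 := (map_ne_zero σ).2 hv
    have hss : σ (σ v) ≠ 0 := (map_ne_zero σ).2 hs
    rw [h.pt_mem hσ (inv_ne_zero hv)]
    -- Inverting the parameter makes the condition linear in v. Its solutions are the `F`-span of 1
    -- and r, since the coefficient of r² has a nonzero factor.
    have e : tr σ ((σ r - σ (σ r)) * (σ v⁻¹ * σ (σ v⁻¹)))
        = tr σ ((σ r - σ (σ r)) * v) / nm σ v := by
      simp only [tr, nm, map_mul, map_sub, map_inv₀, hσ.cube]
      field_simp
    rw [e, div_eq_zero_iff, or_iff_left (nm_ne_zero hv)]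
    constructor
    · intro h0
      obtain ⟨s, t, m, rfl⟩ := hσ.exists_coords hr v
      refine ⟨hv, s, t, ?_⟩
      have hm : algebraMap F K m * ((σ r - r) * (σ (σ r) - r) * (σ r - σ (σ r))) = 0 := by
        rw [← h0]
        simp only [tr, map_mul, map_sub, map_add, map_pow, AlgHom.commutes, hσ.cube]
        ring
      have hne : (σ r - r) * (σ (σ r) - r) * (σ r - σ (σ r)) ≠ 0 := by
        refine mul_ne_zero (mul_ne_zero d1 d2) ?_
        rw [← neg_ne_zero, neg_sub]; exact d3
      rw [(mul_eq_zero.1 hm).resolve_right hne]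
      ring
    · rintro ⟨-, s, t, rfl⟩
      simp only [tr, map_mul, map_sub, map_add, map_one, AlgHom.commutes, hσ.cube]
      ring
  ext Q
  constructor
  · rintro ⟨hQ, hC⟩
    obtain ⟨u, hu, rfl⟩ := n.mem_points_iff.1 hQ
    refine ⟨u, ⟨u⁻¹, (key u⁻¹ (inv_ne_zero hu)).1 (by rwa [inv_inv]), inv_inv u⟩, rfl⟩
  · rintro ⟨_, ⟨v, hv, rfl⟩, rfl⟩
    exact ⟨n.mem_points_iff.2 ⟨_, inv_ne_zero hv.1, rfl⟩, (key v hv.1).2 hv⟩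

variable (n)

/-- There is a unique special conic through a point with a given tangent. -/
theorem exists_conic [Finite F] (hσ : IsFrob σ) {r : K} (hr : σ r ≠ r) :
    ∃ C : π.Conic, C.points = n.pt '' ((·⁻¹) '' lineSet F 1 r) ∧
      ∀ C' : π.Conic, C'.IsSpecial ∧
        C'.IsTangentTo (Submodule.span K {n.iota 1, n.iota r}) (n.pt 1) ↔
          ∃ a : F, a ≠ 0 ∧ C'.poly = a • C.poly := by
  have hd : σ r - σ (σ r) ≠ 0 := sub_ne_zero.2 (hσ.ne₁₂ hr).symm
  obtain ⟨p, hp, hform⟩ := n.exists_hasForm hσ (σ r - σ (σ r))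
  have hp0 : p ≠ 0 := by
    rintro rfl
    have := hform 0 1 1
    simp [val] at this
    exact hd this.symm
  refine ⟨⟨p, hp, hp0⟩, HasForm.points_eq hσ hr hform, fun C' => ?_⟩
  rw [n.isSpecial_iff hσ]
  constructor
  · rintro ⟨⟨a, ha⟩, ht⟩
    obtain ⟨c, hc, rfl⟩ := (ha.isTangentTo_iff hσ hr).1 ht
    refine ⟨c, hc, ha.eq hσ C'.homogeneous ?_ (hform.smul c)⟩
    exact (MvPolynomial.homogeneousSubmodule (Fin 3) F 2).smul_mem c hp
  · rintro ⟨c, hc, h⟩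
    have ha : n.HasForm C'.poly (algebraMap F K c * (σ r - σ (σ r))) := by
      rw [h]; exact hform.smul c
    exact ⟨⟨_, ha⟩, (ha.isTangentTo_iff hσ hr).2 ⟨c, hc, rfl⟩⟩

end NormalForm

end SpecialConics

section ConicCubic

variable {F K : Type*} [Field F] [Field K] [Algebra F K] {σ : K →ₐ[F] K} {π : Subplane F K}

/-! ### Interchanging the splash and the conic cover -/

/-- The involution `(x, y, z) ↦ (σ y, σ² x, z)`, which interchanges the splash and the conic
cover. -/
def IsFrob.swap (hσ : IsFrob σ) : BB F K ≃ₗ[F] BB F K :=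
  LinearEquiv.ofInvolutive
    { toFun := fun v => (σ v.2.1, σ (σ v.1), v.2.2)
      map_add' := fun v w => by simp
      map_smul' := fun a v => by simp }
    (fun v => by simp [hσ.cube])

theorem IsFrob.swap_apply (hσ : IsFrob σ) (v : BB F K) :
    hσ.swap v = (σ v.2.1, σ (σ v.1), v.2.2) := rfl

theorem IsFrob.swap_symm_apply (hσ : IsFrob σ) (v : BB F K) :
    hσ.swap.symm v = (σ v.2.1, σ (σ v.1), v.2.2) := rfl

variable (Φ : BB F K ≃ₗ[F] BB F K)

theorem IsFrob.graphPlane_swap (hσ : IsFrob σ) {b : K} (hb : b ≠ 0) :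
    graphPlane Φ (b • σ.toLinearMap) = graphPlane (Φ.trans hσ.swap) ((σ b)⁻¹ • LinearMap.id) := by
  have hs : σ b ≠ 0 := (map_ne_zero σ).2 hb
  ext v
  rw [mem_graphPlane, mem_graphPlane]
  simp only [LinearEquiv.trans_apply, hσ.swap_apply, LinearMap.smul_apply, LinearMap.id_apply,
    AlgHom.toLinearMap_apply, smul_eq_mul]
  refine and_congr_left fun _ => ?_
  rw [eq_inv_mul_iff_mul_eq₀ hs, ← map_mul, hσ.injective.eq_iff, eq_comm]

theorem IsFrob.family_swap (hσ : IsFrob σ) :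
    family σ (Φ.trans hσ.swap) LinearMap.id = family σ Φ σ.toLinearMap := by
  have hn : ∀ b, nm σ b = -1 → nm σ (σ b)⁻¹ = -1 := by
    intro b hb
    have h0 : nm σ (σ b)⁻¹ = (nm σ (σ b))⁻¹ := by
      simp only [nm, map_inv₀, mul_inv]
    rw [h0, hσ.nm_map, hb, inv_neg, inv_one]
  ext α
  constructor
  · rintro ⟨b, hb, rfl⟩
    have hb0 := ne_zero_of_nm hb
    refine ⟨σ (σ b⁻¹), ?_, ?_⟩
    · rw [hσ.nm_map, map_inv₀, hn b hb]
    · rw [hσ.graphPlane_swap]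
      · simp [hσ.cube]
      · simpa using hb0
  · rintro ⟨b, hb, rfl⟩
    exact ⟨_, hn b hb, hσ.graphPlane_swap Φ (ne_zero_of_nm hb)⟩

/-- The involution sends (σu/u, σ²u/u) to (u/σu, u/σ²u). The quadratic map u ↦ u⁻¹, which turns the
line into the conic, thus becomes linear over `F`, and results on line cubics transfer to conic
cubics. -/
theorem IsFrob.affPt_swap (hσ : IsFrob σ) (u : K) :
    affPt σ (Φ.trans hσ.swap) u = affPt σ Φ u⁻¹ := by
  simp only [affPt, LinearEquiv.trans_symm, LinearEquiv.trans_apply, hσ.swap_symm_apply]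
  congr 3
  · simp only [map_div₀, map_inv₀, hσ.cube]
    field_simp
  · simp only [map_div₀, map_inv₀, hσ.cube]
    field_simp

/-- The involution fixes (1, 1, 1) and negates (σr - r, σ²r - r, 0). This is where the two tangents
become the same line. -/
theorem IsFrob.tanLine_swap (hσ : IsFrob σ) (r : K) :
    tanLine σ (Φ.trans hσ.swap) 1 r = tanLine σ Φ 1 r := by
  have h : (Φ.trans hσ.swap).symm ((σ r * 1 - σ 1 * r) / 1 ^ 2,
      (σ (σ r) * 1 - σ (σ 1) * r) / 1 ^ 2, 0)
      = -Φ.symm ((σ r * 1 - σ 1 * r) / 1 ^ 2, (σ (σ r) * 1 - σ (σ 1) * r) / 1 ^ 2, 0) := by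
    rw [LinearEquiv.trans_symm, LinearEquiv.trans_apply, hσ.swap_symm_apply, ← map_neg]
    simp [hσ.cube]
  rw [tanLine, tanLine, h, LinearEquiv.trans_symm, LinearEquiv.trans_apply, hσ.swap_symm_apply]
  simp only [map_one, div_one]
  rw [Submodule.span_insert, Submodule.span_insert, ← Set.neg_singleton, Submodule.span_neg]

theorem finrank_tanLine {r : K} (hr : σ r ≠ r) :
    Module.finrank F (tanLine σ Φ 1 r) = 2 := by
  have hli : LinearIndependent F ![Φ.symm (σ 1 / 1, σ (σ 1) / 1, 1),
      Φ.symm ((σ r * 1 - σ 1 * r) / 1 ^ 2, (σ (σ r) * 1 - σ (σ 1) * r) / 1 ^ 2, 0)] := by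
    rw [LinearIndependent.pair_iff]
    intro s t h
    rw [← map_smul, ← map_smul, ← map_add, LinearEquiv.map_eq_zero_iff] at h
    have h2 := congrArg (fun v : BB F K => v.2.2) h
    simp at h2
    subst h2
    refine ⟨rfl, ?_⟩
    have h1 := congrArg (fun v : BB F K => v.1) h
    simp [sub_eq_zero, hr] at h1
    exact h1
  have := finrank_span_eq_card hli
  rw [Matrix.range_cons_cons_empty] at this
  rw [tanLine, this]
  simp

namespace NormalForm

variable (n : NormalForm σ π)

theorem swap_hz (hσ : IsFrob σ) (v : BB F K) : (n.Φ.trans hσ.swap v).2.2 = v.2.2 := by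
  rw [LinearEquiv.trans_apply, hσ.swap_apply, n.hz]

theorem image_affPt_swap (hσ : IsFrob σ) (S : Set K) :
    affPt σ (n.Φ.trans hσ.swap) '' S = affPt σ n.Φ '' ((·⁻¹) '' S) := by
  rw [Set.image_image]
  exact Set.image_congr fun u _ => hσ.affPt_swap n.Φ u

theorem exists_special_conic (hσ : IsFrob σ) {r : K} (hr : σ r ≠ r) :
    ∃ N : TwistedCubic F (BB F K), IsSpecialCubic (family σ n.Φ σ.toLinearMap) N ∧
      N.points = affPt σ n.Φ '' ((·⁻¹) '' lineSet F 1 r) := by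
  obtain ⟨N, h1, ⟨α, hα, h2⟩, h3, h4⟩ := hσ.exists_lineCubic (n.swap_hz hσ) hr
  rw [← hσ.family_swap, ← n.image_affPt_swap hσ]
  refine ⟨N, ⟨h1, ⟨α, hα, h2⟩, fun g hg => ?_⟩, h4⟩
  obtain ⟨τ, hτ, rfl⟩ := hσ.eq_transLine subset_rfl hg
  exact h3 τ hτ

theorem isTangentAt_conic_iff (hσ : IsFrob σ) {N : TwistedCubic F (BB F K)}
    (hN : IsSpecialCubic (family σ n.Φ σ.toLinearMap) N) {r : K} (hr : σ r ≠ r)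
    (hpts : N.points = affPt σ n.Φ '' ((·⁻¹) '' lineSet F 1 r)) (T : Submodule F (BB F K)) :
    N.IsTangentAt (affPt σ n.Φ 1) T ↔ T = tanLine σ n.Φ 1 r := by
  rw [← hσ.family_swap] at hN
  rw [← n.image_affPt_swap hσ] at hpts
  have h1 : affPt σ n.Φ 1 = affPt σ (n.Φ.trans hσ.swap) 1 := by
    rw [hσ.affPt_swap, inv_one]
  rw [h1, ← hσ.tanLine_swap]
  refine hσ.isTangentAt_iff (n.swap_hz hσ) hN.1 (hN.2.2 _ ?_) ?_ hpts T
  · refine hσ.isTransversal_transLine (n.swap_hz hσ) ?_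
    rintro _ ⟨k, -, rfl⟩
    refine ⟨1, k, Or.inl one_ne_zero, fun x => ?_⟩
    rw [mem_graphPlane, LinearEquiv.apply_symm_apply]
    simp
  · rw [map_one, mul_one, one_mul]
    exact sub_ne_zero.2 hr

end NormalForm

end ConicCubic

end ExteriorSplash

end

/-! ### Assembly, with P at parameter 1 and the line spanned by 1 and r -/

theorem theorem3p8 {F K : Type*} [Field F] [Finite F] [Field K] [Algebra F K]
    (hK : Module.finrank F K = 3) (π : Subplane F K) (hπ : π.IsExterior)
    (P : Pt K) (hP : P ∈ π.points)
    (L : Submodule K (Fin 3 → K)) (hL : π.IsLine L) (hPL : P.submodule ≤ L) :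
    ∃ (C : π.Conic) (p : Projectivization F (BB F K)) (X : Set (Submodule F (BB F K)))
      (T : Submodule F (BB F K)),
      -- the special conics through `P` with tangent `L` are the nonzero multiples of `C`
      (∀ C' : π.Conic, C'.IsSpecial ∧ C'.IsTangentTo L P ↔ ∃ a : F, a ≠ 0 ∧ C'.poly = a • C.poly) ∧
      -- `p` is the point of `PG(6,q)` that corresponds to `P`
      bb F K {P} = {p} ∧
      -- `X` is the conic cover
      (∀ Y, π.IsConicCover Y ↔ Y = X) ∧
      -- the line and the conic correspond to special twisted cubics
      (∃ N, IsSpecialCubic (regularSpread F K) N ∧ N.points = bb F K (π.linePoints L)) ∧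
      (∃ N, IsSpecialCubic X N ∧ N.points = bb F K C.points) ∧
      -- the line `T` is the unique tangent at `p` to both of them
      Module.finrank F T = 2 ∧
      (∀ N, IsSpecialCubic (regularSpread F K) N → N.points = bb F K (π.linePoints L) →
        ∀ T', N.IsTangentAt p T' ↔ T' = T) ∧
      (∀ N, IsSpecialCubic X N → N.points = bb F K C.points →
        ∀ T', N.IsTangentAt p T' ↔ T' = T) := by
  obtain ⟨σ, hσ⟩ := exists_isFrob hK
  obtain ⟨n, rfl⟩ := hσ.exists_normalForm hπ hP
  obtain ⟨r, hvw, rfl⟩ := n.exists_span_of_isLine one_ne_zero hL hPL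
  have hr : σ r ≠ r := by
    rw [map_one, mul_one, one_mul] at hvw
    exact sub_ne_zero.1 hvw
  obtain ⟨C, hpts, hC⟩ := n.exists_conic hσ hr
  have hline : bb F K (π.linePoints (Submodule.span K {n.iota 1, n.iota r}))
      = affPt σ n.Φ '' lineSet F 1 r := by
    rw [n.linePoints_span hσ hvw, n.bb_image_pt]
  have hconic : bb F K C.points = affPt σ n.Φ '' ((·⁻¹) '' lineSet F 1 r) := by
    rw [hpts, n.bb_image_pt]
  refine ⟨C, affPt σ n.Φ 1, family σ n.Φ σ.toLinearMap, tanLine σ n.Φ 1 r, hC, ?_,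
    fun Y => n.isConicCover_iff hσ, ?_, ?_, finrank_tanLine n.Φ hr, ?_, ?_⟩
  · ext p
    exact n.bbMap_eq_pt_iff
  · rw [hline]
    exact n.exists_special_line hσ hr
  · rw [hconic]
    exact n.exists_special_conic hσ hr
  · intro N hN hNp T'
    rw [hline] at hNp
    exact n.isTangentAt_line_iff hσ hN hvw hNp T'
  · intro N hN hNp T'
    rw [hconic] at hNp
    exact n.isTangentAt_conic_iff hσ hN hr hNp T'
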